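/- \textbf{Model.} Let $p,q,d,\beta>0$, $\underline\lambda\ge 0$, and let $F_U,F_Y$ be probability laws on $(0,\infty)$. Catastrophes arrive at the times $T_1<T_2<\dots$ of a Poisson process of rate $\beta$ and carry i.i.d. marks $Y_k\sim F_Y$. For an initial intensity $\lambda\ge\underline\lambda$ put $$\lambda^c_t=\underline\lambda+e^{-dt}(\lambda-\underline\lambda),\qquad \lambda_t=\lambda^c_t+\sum_{k:\,T_k\le t}Y_k e^{-d(t-T_k)} .$$ Claims arrive at the times $\tau_1<\tau_2<\dots$ of a Cox process with intensity $(\lambda_t)$, and have i.i.d. sizes $U_j\sim F_U$, independent of the $T_k$, $Y_k$, $\tau_j$. The surplus without dividends is $X_t=x+pt-\sum_{j:\,\tau_j\le t}U_j$. \textbf{Grid strategies.} Fix $\delta>0$, let $x_n=np\delta$, $\mathcal G_\delta=\{x_n:n\ge 0\}$ and $\rho(x)=\max\{x_n: x_n\le x\}$ for $x\ge0$. At a grid surplus $x_n$ and an intensity $\lambda$ the following control actions are available. $\mathbf E_F$: pay $x_n$ as dividends and close the company. $\mathbf E_1$ (only if $n\ge 1$): pay the lump sum $p\delta$ at once, so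 that the surplus becomes $x_{n-1}$. $\mathbf E_0$: pay no dividends until the first of the next claim, the next catastrophe, and the elapse of a time $\delta$. If $\delta$ elapses first, the surplus is then $x_{n+1}$. If a claim or a catastrophe comes first and the surplus $y$ just after it is $\ge0$, pay $y-\rho(y)$ at that time, so that the surplus becomes $\rho(y)$. If $y<0$ (possible only at a claim), the company is ruined. A grid strategy from $(x_n,\lambda)$ is a finite or infinite sequence of control actions, ended by ruin or by $\mathbf E_F$, each of them chosen as a measurable function of what has been observed up to the time at which it is chosen. Its value is the expected sum of all dividends paid, discounted at rate $q$. Let $V^\delta(x_n,\lambda)\in[0,\infty]$ be the supremum of the values of all grid strategies from $(x_n,\lambda)$ and, for $l\ge 1$, let $V^\delta_l(x_n,\lambda)$ be the supremum over those that consist of exactly $l$ control actions, the $l$-th one being $\mathbf E_F$ (fewer only if ruin occurs before). \textbf{Operators.} Let $\tau,U$ be the time and size of the first claim and $T,Y$ the time and mark of the first catastrophe, when the initial intensity is $\lambda$. For functions $w\ge0$ on $\mathcal G_\delta\times[\underline\lambda,\infty)$, with $y=x_n+p\tau-U$, put $$\begin{aligned}\mathcal T_0(w)(x_n,\lambda)={}&\mathbb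 P(\delta\wedge T\wedge\tau=\delta)\,e^{-q\delta}w(x_{n+1},\lambda^c_\delta)+\mathbb E\big[\mathbf 1_{\{\delta\wedge T\wedge\tau=\tau,\ y\ge 0\}}e^{-q\tau}\big(w(\rho(y),\lambda^c_\tau)+y-\rho(y)\big)\big]\\&+\mathbb E\big[\mathbf 1_{\{\delta\wedge T\wedge\tau=T\}}e^{-qT}\big(w(x_n,\lambda^c_T+Y)+pT\big)\big],\end{aligned}$$ $\mathcal T_1(w)(x_n,\lambda)=w(x_{n-1},\lambda)+\delta p$ for $n\ge1$, $\mathcal T_F(w)(x_n,\lambda)=x_n$, and $\mathcal T=\max\{\mathcal T_0,\mathcal T_1,\mathcal T_F\}$, where $\mathcal T_1$ is omitted at $n=0$. A supersolution is a Lebesgue measurable $W:\mathcal G_\delta\times[\underline\lambda,\infty)\to[0,\infty)$ with $\mathcal T(W)\le W$. It has linear growth if for some $K$ one has $W(x,\lambda)\le K+x$ for all $x\in\mathcal G_\delta$, $x>0$, and $\lambda>\underline\lambda$. \textbf{Proposition.} On $\mathcal G_\delta\times[\underline\lambda,\infty)$ the following holds. (1) $V^\delta_l\le V^\delta_{l+1}$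 for all $l\ge 1$, and $\lim_{l\to\infty}V^\delta_l=V^\delta$ pointwise. (2) $V^\delta$ is Borel measurable, there is a constant $K$ with $V^\delta(x,\lambda)\le K+x$ everywhere, and $\mathcal T(V^\delta)=V^\delta$. (3) $V^\delta$ is the smallest supersolution with linear growth: it is one, and $V^\delta\le W$ for every supersolution $W$ with linear growth. (4) Let $\mathcal A^*$ be the set of all $(x_n,\lambda)$ with $n\ge 1$ and $\mathcal T_1(V^\delta)=V^\delta$, let $\mathcal{NA}^*$ be the set of all points outside $\mathcal A^*$ with $\mathcal T_0(V^\delta)=V^\delta$, and let $\mathcal B^*$ be the set of all points outside $\mathcal A^*\cup\mathcal{NA}^*$ with $\mathcal T_F(V^\delta)=V^\delta$. These sets form a measurable partition $\mathcal P^*_\delta$ of $\mathcal G_\delta\times[\underline\lambda,\infty)$, and $\mathcal B^*=\emptyset$. The stationary strategy that chooses $\mathbf E_1$ on $\mathcal A^*$, $\mathbf E_0$ on $\mathcal{NA}^*$ and $\mathbf E_F$ on $\mathcal B^*$, according to the current surplus and intensity, is a grid strategy from every $(x_n,\lambda)$, and its value is $V^\delta(x_n,\lambda)$. -/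

import Mathlib

open MeasureTheory ProbabilityTheory Filter Topology Set
open scoped ENNReal

/-- Data of the shot-noise Cox risk model: premium rate `p`, discount factor `q`, decay rate `d` of
the intensity, catastrophe rate `β`, base intensity `lamBar`, law `FU` of the claim sizes and law
`FY` of the intensity jumps (both carried by `(0, ∞)`). -/
structure CatModel where
  p : ℝ
  q : ℝ
  d : ℝ
  β : ℝ
  lamBar : ℝ
  FU : Measure ℝ
  FY : Measure ℝ
  p_pos : 0 < p
  q_pos : 0 < q
  d_pos : 0 < d
  β_pos : 0 < β
  lamBar_nonneg : 0 ≤ lamBar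
  FU_prob : IsProbabilityMeasure FU
  FY_prob : IsProbabilityMeasure FY
  FU_pos : FU (Iic 0) = 0
  FY_pos : FY (Iic 0) = 0

/-- Sample points: the `i`-th coordinate is `((a i, Y i), (e i, U i))`, where `a i` is the waiting
time between the catastrophes `i - 1` and `i`, `Y i` the intensity jump of catastrophe `i`, `e i`
the amount of integrated intensity between the claims `i - 1` and `i`, and `U i` the size of
claim `i` (indices start at `0`). -/
abbrev CatOmega : Type := ℕ → (ℝ × ℝ) × (ℝ × ℝ)

/-- Control actions: `pause` is `E₀` (no dividends until the next event or until `δ` has elapsed),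
`pay` is `E₁` (pay the lump sum `p δ`), `finish` is `E_F` (pay everything and close). -/
inductive CatAction where
  | pause
  | pay
  | finish

instance : MeasurableSpace CatAction := ⊤

/-- What is known when a control action is chosen: the current time, the path of the marked points
observed so far, the index `n` of the current surplus `n p δ`, and the current intensity. -/
abbrev CatInfo : Type := (ℝ × (ℕ → (ℝ × ℝ) × (ℝ × ℝ))) × (ℕ × ℝ)

/-- A decision rule: the `k`-th control action (`k = 0, 1, …`) as a function of the information
available when it is chosen. -/
abbrev CatRule : Type := ℕ → CatInfo → CatAction

/-- A triple of subsets of `{0, 1, 2, …} × ℝ`; `(n, lam)` stands for the surplus `n p δ` and the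
intensity `lam`. -/
structure CatPartition where
  A : Set (ℕ × ℝ)
  NA : Set (ℕ × ℝ)
  B : Set (ℕ × ℝ)

open Classical in
/-- The control action that a partition prescribes: `E₁` on `A`, `E₀` on `NA`, `E_F` on `B`. -/
noncomputable def CatPartition.action (P : CatPartition) (z : ℕ × ℝ) : CatAction :=
  if z ∈ P.A then .pay else if z ∈ P.NA then .pause else .finish

/-- The stationary strategy of a partition: it only looks at the current surplus and intensity. -/
noncomputable def CatPartition.rule (P : CatPartition) : CatRule :=
  fun _ info => P.action info.2

namespace CatModel

variable (M : CatModel)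

/-! ### The shot-noise Cox process -/

/-- The `a i` are exponential with parameter `β`, the `Y i` have law `FY`, the `e i` are standard
exponential, the `U i` have law `FU`, and all of them are independent. -/
noncomputable def prob : Measure CatOmega :=
  Measure.infinitePi fun _ : ℕ => ((expMeasure M.β).prod M.FY).prod ((expMeasure 1).prod M.FU)

theorem isProbabilityMeasure_prob : IsProbabilityMeasure M.prob := by
  have := M.FU_prob
  have := M.FY_prob
  have := isProbabilityMeasure_expMeasure M.β_pos
  have := isProbabilityMeasure_expMeasure (r := 1) one_pos
  unfold prob
  infer_instance

/-- Arrival time of catastrophe `i`, so that the catastrophes form a Poisson process of rate `β`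
under `prob`. -/
def jumpTime (i : ℕ) (ω : CatOmega) : ℝ := ∑ m ∈ Finset.range (i + 1), (ω m).1.1

def jumpSize (i : ℕ) (ω : CatOmega) : ℝ := (ω i).1.2

def claimSize (j : ℕ) (ω : CatOmega) : ℝ := (ω j).2.2

/-- The intensity at time `t` when it starts at `lam` and no catastrophe occurs. -/
noncomputable def lamC (lam t : ℝ) : ℝ := M.lamBar + Real.exp (-(M.d * t)) * (lam - M.lamBar)

/-- The shot-noise intensity started at `lam`. -/
noncomputable def intensity (lam t : ℝ) (ω : CatOmega) : ℝ :=
  M.lamC lam t +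
    ∑' i : ℕ, if jumpTime i ω ≤ t then
      jumpSize i ω * Real.exp (-(M.d * (t - jumpTime i ω))) else 0

/-- The integrated intensity. -/
noncomputable def cumIntensity (lam t : ℝ) (ω : CatOmega) : ℝ :=
  ∫ s in (0 : ℝ)..t, M.intensity lam s ω

/-- Arrival time of claim `j`. The claims are the points of a unit rate Poisson process, run with
the integrated intensity as its clock: given the catastrophes they form a Poisson process with
intensity `M.intensity lam`, i.e. the claim number process is the shot-noise Cox process. -/
noncomputable def claimTime (lam : ℝ) (j : ℕ) (ω : CatOmega) : ℝ :=
  sInf {t : ℝ | 0 ≤ t ∧ ∑ m ∈ Finset.range (j + 1), (ω m).2.1 ≤ M.cumIntensity lam t ω}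

/-- The path of the marked points (catastrophes and claims) stopped at time `t`: points after `t`
are replaced by `0`. The values of `M.observed lam t` generate the sigma-algebra of the events that
are observable up to time `t`. -/
noncomputable def observed (lam t : ℝ) (ω : CatOmega) : ℕ → (ℝ × ℝ) × (ℝ × ℝ) := fun i =>
  (if jumpTime i ω ≤ t then (jumpTime i ω, jumpSize i ω) else 0,
   if M.claimTime lam i ω ≤ t then (M.claimTime lam i ω, claimSize i ω) else 0)

/-- Index of the first catastrophe after time `t`. -/
noncomputable def nextJump (t : ℝ) (ω : CatOmega) : ℕ := sInf {i | t < jumpTime i ω}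

/-- Index of the first claim after time `t`. -/
noncomputable def nextClaim (lam t : ℝ) (ω : CatOmega) : ℕ := sInf {j | t < M.claimTime lam j ω}

/-! ### The grid and the control actions -/

/-- The grid point `x_n = n p δ`. -/
def grid (δ : ℝ) (n : ℕ) : ℝ := n * M.p * δ

/-- Index of the largest grid point below `x`, for `x ≥ 0`. -/
noncomputable def gridIndex (δ x : ℝ) : ℕ := ⌊x / (M.p * δ)⌋₊

theorem isGreatest_grid_gridIndex {δ x : ℝ} (hδ : 0 < δ) (hx : 0 ≤ x) :
    IsGreatest {y | (∃ n, y = M.grid δ n) ∧ y ≤ x} (M.grid δ (M.gridIndex δ x)) := by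
  have h : 0 < M.p * δ := mul_pos M.p_pos hδ
  refine ⟨⟨⟨_, rfl⟩, ?_⟩, ?_⟩
  · have := Nat.floor_le (div_nonneg hx h.le)
    rw [le_div_iff₀ h] at this
    simpa [grid, gridIndex, mul_assoc] using this
  · rintro y ⟨⟨n, rfl⟩, hy⟩
    have hn : n ≤ M.gridIndex δ x := by
      refine Nat.le_floor ?_
      rw [le_div_iff₀ h]
      simpa [grid, mul_assoc] using hy
    have : (n : ℝ) ≤ M.gridIndex δ x := by exact_mod_cast hn
    simpa [grid, mul_assoc] using mul_le_mul_of_nonneg_right this h.le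

/-- Effect of a control action chosen at time `t` at the grid point of index `n`: first the time
and the amount of the lump sum of dividends it pays, then the time and the grid index at which the
next control action is chosen (`none` if the company is closed or ruined). -/
noncomputable def step (δ lam : ℝ) (ω : CatOmega) (t : ℝ) (n : ℕ) :
    CatAction → (ℝ × ℝ) × Option (ℝ × ℕ)
  | .finish => ((t, M.grid δ n), none)
  | .pay => ((t, M.p * δ), some (t, n - 1))
  | .pause =>
    let τ := M.claimTime lam (M.nextClaim lam t ω) ω
    let U := claimSize (M.nextClaim lam t ω) ω
    let T := jumpTime (nextJump t ω) ω
    if τ ≤ min (t + δ) T then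
      let x := M.grid δ n + M.p * (τ - t) - U
      if x < 0 then ((τ, 0), none)
      else ((τ, x - M.grid δ (M.gridIndex δ x)), some (τ, M.gridIndex δ x))
    else if T ≤ t + δ then
      let x := M.grid δ n + M.p * (T - t)
      ((T, x - M.grid δ (M.gridIndex δ x)), some (T, M.gridIndex δ x))
    else ((t + δ, 0), some (t + δ, n + 1))

/-! ### Strategies and their values -/

/-- The action that the rule `π` takes as its `k`-th action, at time `t` and grid index `n`. -/
noncomputable def chosen (lam : ℝ) (π : CatRule) (ω : CatOmega) (k : ℕ) (t : ℝ) (n : ℕ) :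
    CatAction :=
  π k ((t, M.observed lam t ω), (n, M.intensity lam t ω))

/-- Time and grid index at which the `k`-th control action is chosen, when the rule `π` is used
from the grid index `n` and the intensity `lam`; `none` if the company is closed or ruined by
then. -/
noncomputable def state (δ lam : ℝ) (π : CatRule) (n : ℕ) (ω : CatOmega) : ℕ → Option (ℝ × ℕ)
  | 0 => some (0, n)
  | k + 1 =>
    match state δ lam π n ω k with
    | none => none
    | some (t, m) => (M.step δ lam ω t m (M.chosen lam π ω k t m)).2

/-- Time and amount of the dividends paid by the `k`-th control action. -/
noncomputable def payment (δ lam : ℝ) (π : CatRule) (n : ℕ) (ω : CatOmega) (k : ℕ) : ℝ × ℝ :=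
  match M.state δ lam π n ω k with
  | none => (0, 0)
  | some (t, m) => (M.step δ lam ω t m (M.chosen lam π ω k t m)).1

/-- The random measure `dL`: its mass on `[0, t]` is the cumulative amount `L_t` of dividends paid
up to time `t`, including the final payment if the company is closed. -/
noncomputable def dividends (δ lam : ℝ) (π : CatRule) (n : ℕ) (ω : CatOmega) : Measure ℝ :=
  Measure.sum fun k : ℕ =>
    ENNReal.ofReal (M.payment δ lam π n ω k).2 • Measure.dirac (M.payment δ lam π n ω k).1

/-- The expected discounted dividends until ruin or closure. -/
noncomputable def value (δ : ℝ) (π : CatRule) (n : ℕ) (lam : ℝ) : ℝ≥0∞ :=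
  ∫⁻ ω, ∫⁻ t, ENNReal.ofReal (Real.exp (-(M.q * t))) ∂(M.dividends δ lam π n ω) ∂M.prob

/-- The grid strategies from the grid index `n` and the intensity `lam`: every control action
depends measurably on what has been observed, and `E₁` is only chosen at positive surplus. -/
def IsGridStrategy (δ : ℝ) (π : CatRule) (n : ℕ) (lam : ℝ) : Prop :=
  (∀ k, Measurable (π k)) ∧
    ∀ᵐ ω ∂M.prob, ∀ k t m, M.state δ lam π n ω k = some (t, m) →
      M.chosen lam π ω k t m = .pay → 0 < m

/-- The strategy consists of exactly `l` control actions, unless ruin occurs before: the closing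
action `E_F` is the `l`-th one. -/
def HasLength (δ : ℝ) (π : CatRule) (n : ℕ) (lam : ℝ) (l : ℕ) : Prop :=
  ∀ᵐ ω ∂M.prob, ∀ k t m, M.state δ lam π n ω k = some (t, m) →
    (M.chosen lam π ω k t m = .finish ↔ k + 1 = l)

/-- The grid-optimal value function. -/
noncomputable def gridValue (δ : ℝ) (n : ℕ) (lam : ℝ) : ℝ≥0∞ :=
  ⨆ (π : CatRule) (_ : M.IsGridStrategy δ π n lam), M.value δ π n lam

/-- The value function of the problem with `l` control actions. -/
noncomputable def horizonValue (δ : ℝ) (l n : ℕ) (lam : ℝ) : ℝ≥0∞ :=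
  ⨆ (π : CatRule) (_ : M.IsGridStrategy δ π n lam ∧ M.HasLength δ π n lam l), M.value δ π n lam

/-! ### The discrete Hamilton-Jacobi-Bellman equation -/

/-- The operator of `E₀`. With `τ`, `U` the time and size of the first claim and `T`, `Y` the time
and size of the first intensity jump, the summands account for: no event before `δ`; the value
after a claim without ruin; the value after a jump; the dividends at a claim without ruin; the
dividends at a jump. -/
noncomputable def T0 (δ : ℝ) (w : ℕ → ℝ → ℝ≥0∞) (n : ℕ) (lam : ℝ) : ℝ≥0∞ :=
  let τ : CatOmega → ℝ := M.claimTime lam 0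
  let U : CatOmega → ℝ := claimSize 0
  let T : CatOmega → ℝ := jumpTime 0
  let Y : CatOmega → ℝ := jumpSize 0
  let x : CatOmega → ℝ := fun ω => M.grid δ n + M.p * τ ω - U ω
  let disc : ℝ → ℝ≥0∞ := fun t => ENNReal.ofReal (Real.exp (-(M.q * t)))
  M.prob {ω | min (min δ (T ω)) (τ ω) = δ} * disc δ * w (n + 1) (M.lamC lam δ)
    + ∫⁻ ω in {ω | min (min δ (T ω)) (τ ω) = τ ω ∧ 0 ≤ x ω},
        disc (τ ω) * w (M.gridIndex δ (x ω)) (M.lamC lam (τ ω)) ∂M.prob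
    + ∫⁻ ω in {ω | min (min δ (T ω)) (τ ω) = T ω},
        disc (T ω) * w n (M.lamC lam (T ω) + Y ω) ∂M.prob
    + ∫⁻ ω in {ω | min (min δ (T ω)) (τ ω) = τ ω ∧ 0 ≤ x ω},
        disc (τ ω) * ENNReal.ofReal (x ω - M.grid δ (M.gridIndex δ (x ω))) ∂M.prob
    + ∫⁻ ω in {ω | min (min δ (T ω)) (τ ω) = T ω},
        disc (T ω) * ENNReal.ofReal (M.p * T ω) ∂M.prob

/-- The operator of `E₁`, meaningful for `n ≥ 1`. -/
noncomputable def T1 (δ : ℝ) (w : ℕ → ℝ → ℝ≥0∞) (n : ℕ) (lam : ℝ) : ℝ≥0∞ :=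
  w (n - 1) lam + ENNReal.ofReal (δ * M.p)

/-- The operator of `E_F`. -/
noncomputable def TF (δ : ℝ) (n : ℕ) : ℝ≥0∞ := ENNReal.ofReal (M.grid δ n)

/-- The maximum of the operators of the available control actions. -/
noncomputable def T (δ : ℝ) (w : ℕ → ℝ → ℝ≥0∞) (n : ℕ) (lam : ℝ) : ℝ≥0∞ :=
  if n = 0 then max (M.T0 δ w n lam) (M.TF δ n)
  else max (max (M.T0 δ w n lam) (M.T1 δ w n lam)) (M.TF δ n)

/-- Finite, nonnegative, Lebesgue measurable functions on the grid times `[lamBar, ∞)`. -/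
def IsGridFunction (w : ℕ → ℝ → ℝ≥0∞) : Prop :=
  ∀ n, AEMeasurable (w n) (volume.restrict (Ici M.lamBar)) ∧ ∀ lam, M.lamBar ≤ lam → w n lam ≠ ∞

def IsSupersolution (δ : ℝ) (w : ℕ → ℝ → ℝ≥0∞) : Prop :=
  M.IsGridFunction w ∧ ∀ n lam, M.lamBar ≤ lam → M.T δ w n lam ≤ w n lam

/-- The growth condition `w (x, lam) ≤ K + x` for `x > 0` and `lam > lamBar`. -/
def HasLinearGrowth (δ : ℝ) (w : ℕ → ℝ → ℝ≥0∞) : Prop :=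
  ∃ K : ℝ, ∀ n, 0 < n → ∀ lam, M.lamBar < lam → w n lam ≤ ENNReal.ofReal (K + M.grid δ n)

/-! ### Partitions -/

/-- `P` partitions the grid times `[lamBar, ∞)` into measurable sets, and `E₁` is never prescribed
at surplus `0`. -/
structure IsPartition (P : CatPartition) : Prop where
  measurable_A : MeasurableSet P.A
  measurable_NA : MeasurableSet P.NA
  measurable_B : MeasurableSet P.B
  disjoint_A_NA : Disjoint P.A P.NA
  disjoint_A_B : Disjoint P.A P.B
  disjoint_NA_B : Disjoint P.NA P.B
  union : P.A ∪ P.NA ∪ P.B = {z | M.lamBar ≤ z.2}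
  zero_notMem : ∀ lam, (0, lam) ∉ P.A

def optA (δ : ℝ) : Set (ℕ × ℝ) :=
  {z | M.lamBar ≤ z.2 ∧ z.1 ≠ 0 ∧ M.T1 δ (M.gridValue δ) z.1 z.2 = M.gridValue δ z.1 z.2}

def optNA (δ : ℝ) : Set (ℕ × ℝ) :=
  {z | M.lamBar ≤ z.2 ∧ z ∉ M.optA δ ∧
    M.T0 δ (M.gridValue δ) z.1 z.2 = M.gridValue δ z.1 z.2}

def optB (δ : ℝ) : Set (ℕ × ℝ) :=
  {z | M.lamBar ≤ z.2 ∧ z ∉ M.optA δ ∪ M.optNA δ ∧ M.TF δ z.1 = M.gridValue δ z.1 z.2}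

/-- The optimal partition. -/
def optPartition (δ : ℝ) : CatPartition := ⟨M.optA δ, M.optNA δ, M.optB δ⟩

end CatModel

/-! The engine is value iteration. Put `V_0 = T_F` and `V_{l+1} = T V_l` (`valueIter`). Since `T_F ≤
T V_0` and `T` is monotone, the iterates increase, and monotone convergence makes their limit
`valueLim` a fixed point of `T` (`T_valueLim`). Every `W` with `T W ≤ W` dominates `T_F`, hence by
induction all iterates and the limit (`valueLim_le`): this is minimality. The function `x + p/q` is
such a `W`, because `1 + qs ≤ e^{qs}` lets discounting absorb the premium income; this gives linear
growth.

Strategies enter through one identity, `lintegral_discPayment_add`: the expected discounted payment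
of the `k`-th action plus the expected discounted value `w` of the next state equals the expected
discounted operator of the chosen action, applied to `w` at the present state. As each such operator
is at most `T`, telescoping shows that `K` actions followed by `V_l` are worth at most `V_{l+K}`,
with equality for greedy choices. So `L + 1` actions ending in `E_F` have optimal value `V_L`, and
the supremum over all strategies is the limit.

For `E_1` and `E_F` the identity is a computation. For `E_0` it is the strong Markov property
`lintegral_residual`. At a decision time at which catastrophe `i` and claim `j` are awaited, redraw
the data of catastrophe `i` and of claim `j` independently. The law of the sample point is unchanged
(`measurePreserving_resample`), and as long as the new points still lie in the future, the past, and
with it the decision time and the action, is unchanged too (`state_congr`). Conditionally on the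
past one therefore sees a fresh mark constrained to exceed the waiting time and the integrated
intensity already used up, and the exponential laws forget both (`lintegral_mark_shift`). Pathwise
statements are proved on an almost sure set of regular sample points.

Closing is never strictly better than `E_1` at positive surplus, and is worth `0` at surplus `0`, so
`E_1` and `E_0` suffice to attain `T V = V` and `B*` is empty. Along the resulting stationary
strategy the identity loses nothing. What remains is the discounted value of the `k`-th state, which
tends to `0` because decision times tend to infinity while the surplus grows at most linearly in
time. -/

/-! ### Exponential laws and infinite product measures -/

theorem lintegral_expMeasure {r : ℝ} (f : ℝ → ℝ≥0∞) (hf : Measurable f) :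
    ∫⁻ x, f x ∂expMeasure r = ∫⁻ x, exponentialPDF r x * f x := by
  have h : Measurable (gammaPDF 1 r) := (measurable_gammaPDFReal 1 r).ennreal_ofReal
  unfold expMeasure gammaMeasure
  rw [lintegral_withDensity_eq_lintegral_mul _ h hf]
  rfl

/-- Absence of atoms is what makes ties between a claim, a catastrophe and the clock `δ` null in
`ae_mark_ne`. -/
instance nullSingletonClass_expMeasure {r : ℝ} : NullSingletonClass (expMeasure r) := by
  unfold expMeasure gammaMeasure
  exact ⟨fun x => withDensity_absolutelyContinuous _ _ (measure_singleton x)⟩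

theorem expMeasure_Iic_zero {r : ℝ} : expMeasure r (Iic 0) = 0 := by
  have hi : Measurable ((Iic (0 : ℝ)).indicator (1 : ℝ → ℝ≥0∞)) :=
    measurable_one.indicator measurableSet_Iic
  have hpdf : Measurable (exponentialPDF r) := (measurable_exponentialPDFReal r).ennreal_ofReal
  have hm : Measurable fun x => exponentialPDF r x * (Iic (0 : ℝ)).indicator 1 x := hpdf.mul hi
  rw [← lintegral_indicator_one measurableSet_Iic, lintegral_expMeasure _ hi,
    lintegral_eq_zero_iff' hm.aemeasurable]
  have h : ∀ᵐ x : ℝ, x ≠ 0 := by simp [ae_iff]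
  filter_upwards [h] with x hx
  rcases lt_or_gt_of_ne hx with h | h
  · simp [exponentialPDF_of_neg h]
  · simp [not_le.2 h]

/-- The exponential distribution is memoryless. -/
theorem lintegral_expMeasure_shift {r α : ℝ} (hα : 0 ≤ α) (f : ℝ → ℝ≥0∞)
    (hf : Measurable f) :
    ∫⁻ x, (if α < x then f (x - α) else 0) ∂expMeasure r
      = ENNReal.ofReal (Real.exp (-(r * α))) * ∫⁻ x, f x ∂expMeasure r := by
  have hpdf : Measurable (exponentialPDF r) := (measurable_exponentialPDFReal r).ennreal_ofReal
  have hs : Measurable fun x => if α < x then f (x - α) else 0 :=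
    Measurable.ite measurableSet_Ioi (by fun_prop) measurable_const
  have hm : Measurable fun x => exponentialPDF r x * f x := hpdf.mul hf
  -- Translation by `α` turns the left side into an integral against the density at `x + α`, which
  -- for `x > 0` is `e^{-rα}` times the density at `x`; for `x < 0` both integrands vanish.
  rw [lintegral_expMeasure _ hf, lintegral_expMeasure _ hs, ← lintegral_const_mul _ hm,
    ← lintegral_add_right_eq_self (μ := volume)
      (fun x => exponentialPDF r x * (if α < x then f (x - α) else 0)) α]
  have h : ∀ᵐ x : ℝ, x ≠ 0 := by simp [ae_iff]
  refine lintegral_congr_ae ?_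
  filter_upwards [h] with x hx
  rcases lt_or_gt_of_ne hx with h | h
  · simp [exponentialPDF_of_neg h, h.le]
  · have h1 : exponentialPDF r (x + α)
        = ENNReal.ofReal (Real.exp (-(r * α))) * exponentialPDF r x := by
      rw [exponentialPDF_of_nonneg h.le, exponentialPDF_of_nonneg (by linarith),
        ← ENNReal.ofReal_mul (Real.exp_nonneg _)]
      congr 1
      rw [mul_left_comm, ← Real.exp_add]
      ring_nf
    simp [h, h1, mul_assoc]

/-- Resampling one coordinate preserves a product measure. -/
theorem measurePreserving_update_infinitePi {X : Type*} [MeasurableSpace X] (μ : Measure X)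
    [IsProbabilityMeasure μ] (i : ℕ) :
    MeasurePreserving (fun z : (ℕ → X) × X => Function.update z.1 i z.2)
      ((Measure.infinitePi fun _ : ℕ => μ).prod μ) (Measure.infinitePi fun _ : ℕ => μ) := by
  have hm : Measurable fun z : (ℕ → X) × X => Function.update z.1 i z.2 := by
    refine measurable_pi_iff.2 fun m => ?_
    by_cases h : m = i
    · subst h; simpa using measurable_snd
    · simp only [ne_eq, h, not_false_eq_true, Function.update_of_ne]; fun_prop
  refine ⟨hm, Measure.eq_infinitePi _ fun s t ht => ?_⟩
  have hs : MeasurableSet (Set.pi (s : Set ℕ) t) :=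
    MeasurableSet.pi s.countable_toSet fun m _ => ht m
  rw [Measure.map_apply hm hs]
  -- On a box, coordinate `i` is constrained only through the fresh draw, so its factor splits off
  -- the product and is put back by the second measure.
  by_cases hi : i ∈ s
  · have : (fun z : (ℕ → X) × X => Function.update z.1 i z.2) ⁻¹' (Set.pi (s : Set ℕ) t)
        = (Set.pi ((s.erase i : Finset ℕ) : Set ℕ) t) ×ˢ t i := by
      ext z
      simp only [mem_preimage, Set.mem_pi, Finset.mem_coe, Set.mem_prod, Finset.mem_erase]
      constructor
      · intro h
        refine ⟨fun m hm => ?_, ?_⟩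
        · simpa [hm.1] using h m hm.2
        · simpa using h i hi
      · rintro ⟨h1, h2⟩ m hm
        by_cases hmi : m = i
        · subst hmi; simpa using h2
        · simpa [hmi] using h1 m ⟨hmi, hm⟩
    rw [this, Measure.prod_prod, Measure.infinitePi_pi _ (fun m _ => ht m), mul_comm]
    exact Finset.mul_prod_erase s (fun m => μ (t m)) hi
  · have : (fun z : (ℕ → X) × X => Function.update z.1 i z.2) ⁻¹' (Set.pi (s : Set ℕ) t)
        = (Set.pi (s : Set ℕ) t) ×ˢ univ := by
      ext z
      simp only [mem_preimage, Set.mem_pi, Finset.mem_coe, Set.mem_prod, mem_univ, and_true]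
      refine forall₂_congr fun m hm => ?_
      have : m ≠ i := fun h => hi (h ▸ hm)
      simp [this]
    rw [this, Measure.prod_prod, Measure.infinitePi_pi _ (fun m _ => ht m)]
    simp

/-- Under an infinite product measure, the sum of a positive function of the coordinates
diverges. -/
theorem ae_tendsto_sum_infinitePi {X : Type*} [MeasurableSpace X] (μ : Measure X)
    [IsProbabilityMeasure μ] (f : X → ℝ) (hf : Measurable f) (hpos : ∀ᵐ x ∂μ, 0 < f x) :
    ∀ᵐ ω ∂(Measure.infinitePi fun _ : ℕ => μ),
      Tendsto (fun n => ∑ m ∈ Finset.range n, f (ω m)) atTop atTop := by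
  -- If no such level existed, `f ≤ 1/(n+1)` would hold almost surely for every `n`, against `f >
  -- 0`.
  obtain ⟨c, hc, hμ⟩ : ∃ c : ℝ, 0 < c ∧ μ {x | c < f x} ≠ 0 := by
    by_contra! h
    have h1 : ∀ n : ℕ, ∀ᵐ x ∂μ, f x ≤ 1 / ((n : ℝ) + 1) := fun n => by
      have := h (1 / ((n : ℝ) + 1)) (by positivity)
      simpa [ae_iff] using this
    have h2 : ∀ᵐ x ∂μ, False := by
      filter_upwards [ae_all_iff.2 h1, hpos] with x hx h0
      obtain ⟨n, hn⟩ := exists_nat_one_div_lt h0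
      exact absurd (hx n) (not_le.2 hn)
    simp at h2
    exact IsProbabilityMeasure.ne_zero μ h2
  set P := Measure.infinitePi fun _ : ℕ => μ
  set A : ℕ → Set (ℕ → X) := fun n => {ω | c < f (ω n)}
  have hS : MeasurableSet {x | c < f x} := measurableSet_lt measurable_const hf
  have hA : ∀ n, MeasurableSet (A n) := fun n => measurableSet_lt measurable_const (by fun_prop)
  have hPA : ∀ n, P (A n) = μ {x | c < f x} := fun n =>
    (measurePreserving_eval_infinitePi (fun _ : ℕ => μ) n).measure_preimage hS.nullMeasurableSet
  -- Second Borel–Cantelli: the independent events `A n` share one positive probability, so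
  -- infinitely many occur, and each adds at least `c` to the sum.
  have hind : iIndepSet A P := by
    rw [iIndepSet_iff_meas_biInter hA]
    intro s
    have : (⋂ i ∈ s, A i) = Set.pi (s : Set ℕ) fun _ => {x | c < f x} := by
      ext ω; simp [A]
    rw [this, Measure.infinitePi_pi _ fun _ _ => hS]
    simp [hPA]
  have hlim := measure_limsup_eq_one hA hind (by
    simp only [hPA]; exact ENNReal.tsum_const_eq_top_of_ne_zero hμ)
  have hlim' : ∀ᵐ ω ∂P, ω ∈ limsup A atTop := by
    rw [← prob_compl_eq_zero_iff (MeasurableSet.measurableSet_limsup hA)] at hlim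
    exact hlim
  have hpos' : ∀ᵐ ω ∂P, ∀ n, 0 < f (ω n) := ae_all_iff.2 fun n =>
    (measurePreserving_eval_infinitePi (fun _ : ℕ => μ) n).quasiMeasurePreserving.ae hpos
  filter_upwards [hlim', hpos'] with ω h1 h2
  rw [mem_limsup_iff_frequently_mem] at h1
  have hmono : Monotone fun n => ∑ m ∈ Finset.range n, f (ω m) :=
    monotone_nat_of_le_succ fun n => by rw [Finset.sum_range_succ]; linarith [h2 n]
  refine tendsto_atTop_atTop_of_monotone hmono fun b => ?_
  have key : ∀ k : ℕ, ∃ n, k * c ≤ ∑ m ∈ Finset.range n, f (ω m) := by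
    intro k
    induction k with
    | zero => exact ⟨0, by simp⟩
    | succ k ih =>
      obtain ⟨n, hn⟩ := ih
      obtain ⟨m, hm, hm2⟩ := (frequently_atTop.1 h1) n
      refine ⟨m + 1, ?_⟩
      rw [Finset.sum_range_succ]
      have := hmono hm
      have h3 : c < f (ω m) := hm2
      push_cast
      dsimp only at this
      linarith
  obtain ⟨k, hk⟩ := exists_nat_ge (b / c)
  obtain ⟨n, hn⟩ := key k
  exact ⟨n, ((div_le_iff₀ hc).1 hk).trans hn⟩

/-! ### Marks and their resampling -/

namespace CatModel

variable (M : CatModel)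

instance isProbabilityMeasure_FU : IsProbabilityMeasure M.FU := M.FU_prob

instance isProbabilityMeasure_FY : IsProbabilityMeasure M.FY := M.FY_prob

instance isProbabilityMeasure_exp_β : IsProbabilityMeasure (expMeasure M.β) :=
  isProbabilityMeasure_expMeasure M.β_pos

instance isProbabilityMeasure_exp_one : IsProbabilityMeasure (expMeasure 1) :=
  isProbabilityMeasure_expMeasure one_pos

/-- The law of one coordinate of a sample point. -/
noncomputable def mark : Measure ((ℝ × ℝ) × (ℝ × ℝ)) :=
  ((expMeasure M.β).prod M.FY).prod ((expMeasure 1).prod M.FU)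

instance isProbabilityMeasure_mark : IsProbabilityMeasure M.mark := by
  unfold mark; infer_instance

theorem measurePreserving_apply (i : ℕ) :
    MeasurePreserving (fun ω : CatOmega => ω i) M.prob M.mark :=
  measurePreserving_eval_infinitePi (fun _ : ℕ => M.mark) i

/-- The waiting time and the claim amount of a mark are memoryless. -/
theorem lintegral_mark_shift {α ε : ℝ} (hα : 0 ≤ α) (hε : 0 ≤ ε)
    (g : (ℝ × ℝ) × (ℝ × ℝ) → ℝ≥0∞) (hg : Measurable g) :
    ∫⁻ ξ, (if α < ξ.1.1 ∧ ε < ξ.2.1 then g ((ξ.1.1 - α, ξ.1.2), (ξ.2.1 - ε, ξ.2.2)) else 0)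
        ∂M.mark
      = ENNReal.ofReal (Real.exp (-(M.β * α))) * ENNReal.ofReal (Real.exp (-(1 * ε)))
        * ∫⁻ ξ, g ξ ∂M.mark := by
  have hmeas : Measurable fun ξ : (ℝ × ℝ) × (ℝ × ℝ) =>
      if α < ξ.1.1 ∧ ε < ξ.2.1 then g ((ξ.1.1 - α, ξ.1.2), (ξ.2.1 - ε, ξ.2.2)) else 0 := by
    refine Measurable.ite ?_ (hg.comp (by fun_prop)) measurable_const
    have h1 : Measurable fun ξ : (ℝ × ℝ) × (ℝ × ℝ) => ξ.1.1 := by fun_prop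
    have h2 : Measurable fun ξ : (ℝ × ℝ) × (ℝ × ℝ) => ξ.2.1 := by fun_prop
    exact (measurableSet_lt measurable_const h1).inter (measurableSet_lt measurable_const h2)
  unfold mark
  rw [lintegral_prod _ hmeas.aemeasurable, lintegral_prod _ hg.aemeasurable]
  have inner : ∀ x : ℝ × ℝ, ∫⁻ z, (if α < x.1 ∧ ε < z.1 then
      g ((x.1 - α, x.2), (z.1 - ε, z.2)) else 0) ∂((expMeasure 1).prod M.FU)
      = if α < x.1 then ENNReal.ofReal (Real.exp (-(1 * ε))) *
        ∫⁻ z, g ((x.1 - α, x.2), z) ∂((expMeasure 1).prod M.FU) else 0 := by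
    intro x
    by_cases hx : α < x.1
    · simp only [hx, true_and, if_true]
      have h0 : Measurable fun z : ℝ × ℝ => g ((x.1 - α, x.2), z) := hg.comp (by fun_prop)
      have h1 : Measurable fun z : ℝ × ℝ =>
          if ε < z.1 then g ((x.1 - α, x.2), (z.1 - ε, z.2)) else 0 :=
        Measurable.ite (measurableSet_lt measurable_const (by fun_prop)) (by fun_prop)
          measurable_const
      rw [lintegral_prod_symm _ h1.aemeasurable,
        lintegral_prod_symm _ h0.aemeasurable, ← lintegral_const_mul _ h0.lintegral_prod_left']
      refine lintegral_congr fun u => ?_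
      exact lintegral_expMeasure_shift hε (fun e => g ((x.1 - α, x.2), (e, u)))
        (hg.comp (by fun_prop))
    · simp [hx]
  rw [lintegral_congr inner]
  set G : ℝ × ℝ → ℝ≥0∞ := fun x => ∫⁻ z, g (x, z) ∂((expMeasure 1).prod M.FU) with hG
  have hGm : Measurable G := hg.lintegral_prod_right'
  change ∫⁻ x, (if α < x.1 then ENNReal.ofReal (Real.exp (-(1 * ε))) * G (x.1 - α, x.2) else 0)
    ∂((expMeasure M.β).prod M.FY) = _ * ∫⁻ x, G x ∂((expMeasure M.β).prod M.FY)
  have h1 : Measurable fun x : ℝ × ℝ =>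
      if α < x.1 then ENNReal.ofReal (Real.exp (-(1 * ε))) * G (x.1 - α, x.2) else 0 :=
    Measurable.ite (measurableSet_lt measurable_const (by fun_prop)) (by fun_prop)
      measurable_const
  rw [lintegral_prod_symm _ h1.aemeasurable,
    lintegral_prod_symm _ hGm.aemeasurable, ← lintegral_const_mul _ hGm.lintegral_prod_left']
  refine lintegral_congr fun y => ?_
  have := lintegral_expMeasure_shift (r := M.β) hα
    (fun a => ENNReal.ofReal (Real.exp (-(1 * ε))) * G (a, y)) ((hGm.comp (by fun_prop)).const_mul _)
  have hGy : Measurable fun a => G (a, y) := by fun_prop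
  rw [this, lintegral_const_mul _ hGy, mul_assoc]

/-- Replace the data of catastrophe `i` and of claim `j` by those of `ξ`. -/
def resample (i j : ℕ) (z : CatOmega × ((ℝ × ℝ) × (ℝ × ℝ))) : CatOmega := fun m =>
  (if m = i then z.2.1 else (z.1 m).1, if m = j then z.2.2 else (z.1 m).2)

theorem measurable_resample (i j : ℕ) : Measurable (resample i j) := by
  refine measurable_pi_iff.2 fun m => Measurable.prodMk ?_ ?_
  · by_cases h : m = i <;> simp only [h, if_true, if_false] <;> fun_prop
  · by_cases h : m = j <;> simp only [h, if_true, if_false] <;> fun_prop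

/-- Redraw first the whole coordinate `i`, which is harmless. Its two halves are then independent,
so drawing the catastrophe half once more changes nothing. -/
theorem map_resample_fst (i : ℕ) (f : CatOmega → ℝ≥0∞) (hf : Measurable f) :
    ∫⁻ ω, ∫⁻ x, f (fun m => (if m = i then x else (ω m).1, (ω m).2))
      ∂((expMeasure M.β).prod M.FY) ∂M.prob = ∫⁻ ω, f ω ∂M.prob := by
  have hg : Measurable fun z : CatOmega × (ℝ × ℝ) =>
      f (fun m => (if m = i then z.2 else (z.1 m).1, (z.1 m).2)) := by
    refine hf.comp (measurable_pi_iff.2 fun m => ?_)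
    by_cases h1 : m = i <;> simp only [h1, if_true, if_false] <;> fun_prop
  have hup := measurePreserving_update_infinitePi M.mark i
  have h1 := hup.lintegral_comp (f := fun ω => ∫⁻ x, f (fun m =>
    (if m = i then x else (ω m).1, (ω m).2)) ∂((expMeasure M.β).prod M.FY))
    hg.lintegral_prod_right'
  have h2 := hup.lintegral_comp hf
  have hfu : Measurable fun z : CatOmega × ((ℝ × ℝ) × (ℝ × ℝ)) =>
    f (Function.update z.1 i z.2) := hf.comp hup.measurable
  refine h1.symm.trans (Eq.trans ?_ h2)
  have hgu : Measurable fun z : CatOmega × ((ℝ × ℝ) × (ℝ × ℝ)) => ∫⁻ x, f (fun m =>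
      (if m = i then x else (Function.update z.1 i z.2 m).1, (Function.update z.1 i z.2 m).2))
      ∂((expMeasure M.β).prod M.FY) := hg.lintegral_prod_right'.comp hup.measurable
  rw [lintegral_prod _ hgu.aemeasurable,
    lintegral_prod _ hfu.aemeasurable]
  refine lintegral_congr fun ω => ?_
  have e : ∀ (x : ℝ × ℝ) (ζ : (ℝ × ℝ) × (ℝ × ℝ)), (fun m =>
      (if m = i then x else (Function.update ω i ζ m).1, (Function.update ω i ζ m).2))
      = Function.update ω i (x, ζ.2) := by
    intro x ζ
    funext m
    by_cases h : m = i
    · subst h; simp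
    · simp [h]
  simp only [e]
  have hF : Measurable fun ζ : (ℝ × ℝ) × (ℝ × ℝ) => f (Function.update ω i ζ) :=
    hf.comp (hup.measurable.comp (by fun_prop : Measurable fun ζ => (ω, ζ)))
  change ∫⁻ ζ, (fun z => ∫⁻ x, f (Function.update ω i (x, z.2)) ∂((expMeasure M.β).prod M.FY)) ζ
    ∂M.mark = ∫⁻ ζ, f (Function.update ω i ζ) ∂M.mark
  unfold mark
  rw [lintegral_prod_symm _ hF.aemeasurable, lintegral_prod_symm]
  · simp
  · have : Measurable fun z : (ℝ × ℝ) =>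
        ∫⁻ x, f (Function.update ω i (x, z)) ∂((expMeasure M.β).prod M.FY) :=
      hF.lintegral_prod_left'
    exact (this.comp measurable_snd).aemeasurable

theorem map_resample_snd (j : ℕ) (f : CatOmega → ℝ≥0∞) (hf : Measurable f) :
    ∫⁻ ω, ∫⁻ x, f (fun m => ((ω m).1, if m = j then x else (ω m).2))
      ∂((expMeasure 1).prod M.FU) ∂M.prob = ∫⁻ ω, f ω ∂M.prob := by
  have hg : Measurable fun z : CatOmega × (ℝ × ℝ) =>
      f (fun m => ((z.1 m).1, if m = j then z.2 else (z.1 m).2)) := by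
    refine hf.comp (measurable_pi_iff.2 fun m => ?_)
    by_cases h1 : m = j <;> simp only [h1, if_true, if_false] <;> fun_prop
  have hup := measurePreserving_update_infinitePi M.mark j
  have h1 := hup.lintegral_comp (f := fun ω => ∫⁻ x, f (fun m =>
    ((ω m).1, if m = j then x else (ω m).2)) ∂((expMeasure 1).prod M.FU))
    hg.lintegral_prod_right'
  have h2 := hup.lintegral_comp hf
  have hfu : Measurable fun z : CatOmega × ((ℝ × ℝ) × (ℝ × ℝ)) =>
    f (Function.update z.1 j z.2) := hf.comp hup.measurable
  refine h1.symm.trans (Eq.trans ?_ h2)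
  have hgu : Measurable fun z : CatOmega × ((ℝ × ℝ) × (ℝ × ℝ)) => ∫⁻ x, f (fun m =>
      ((Function.update z.1 j z.2 m).1, if m = j then x else (Function.update z.1 j z.2 m).2))
      ∂((expMeasure 1).prod M.FU) := hg.lintegral_prod_right'.comp hup.measurable
  rw [lintegral_prod _ hgu.aemeasurable,
    lintegral_prod _ hfu.aemeasurable]
  refine lintegral_congr fun ω => ?_
  have e : ∀ (x : ℝ × ℝ) (ζ : (ℝ × ℝ) × (ℝ × ℝ)), (fun m =>
      ((Function.update ω j ζ m).1, if m = j then x else (Function.update ω j ζ m).2))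
      = Function.update ω j (ζ.1, x) := by
    intro x ζ
    funext m
    by_cases h : m = j
    · subst h; simp
    · simp [h]
  simp only [e]
  have hF : Measurable fun ζ : (ℝ × ℝ) × (ℝ × ℝ) => f (Function.update ω j ζ) :=
    hf.comp (hup.measurable.comp (by fun_prop : Measurable fun ζ => (ω, ζ)))
  change ∫⁻ ζ, (fun z => ∫⁻ x, f (Function.update ω j (z.1, x)) ∂((expMeasure 1).prod M.FU)) ζ
    ∂M.mark = ∫⁻ ζ, f (Function.update ω j ζ) ∂M.mark
  unfold mark
  rw [lintegral_prod _ hF.aemeasurable, lintegral_prod]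
  · simp
  · have : Measurable fun z : (ℝ × ℝ) =>
        ∫⁻ x, f (Function.update ω j (z, x)) ∂((expMeasure 1).prod M.FU) :=
      hF.lintegral_prod_right'
    exact (this.comp measurable_fst).aemeasurable

/-- Catastrophes and claims are numbered separately, so the two redrawn halves may belong to
different coordinates. Since `mark` is a product, the joint redraw is the composition of the two
one-sided ones. -/
theorem lintegral_resample_of_measurable (i j : ℕ) (f : CatOmega → ℝ≥0∞) (hf : Measurable f) :
    ∫⁻ z, f (resample i j z) ∂(M.prob.prod M.mark) = ∫⁻ ω, f ω ∂M.prob := by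
  have hR : Measurable fun z => f (resample i j z) := hf.comp (measurable_resample i j)
  have hg : Measurable fun z : CatOmega × (ℝ × ℝ) =>
      f (fun m => (if m = i then z.2 else (z.1 m).1, (z.1 m).2)) := by
    refine hf.comp (measurable_pi_iff.2 fun m => ?_)
    by_cases h1 : m = i <;> simp only [h1, if_true, if_false] <;> fun_prop
  refine Eq.trans ?_ ((M.map_resample_snd j _ hg.lintegral_prod_right').trans
    (M.map_resample_fst i f hf))
  rw [lintegral_prod _ hR.aemeasurable]
  refine lintegral_congr fun ω => ?_
  have hω : Measurable fun ξ => f (resample i j (ω, ξ)) :=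
    hR.comp (by fun_prop : Measurable fun ξ => (ω, ξ))
  unfold mark
  rw [lintegral_prod_symm _ hω.aemeasurable]
  rfl

theorem measurePreserving_resample (i j : ℕ) :
    MeasurePreserving (resample i j) (M.prob.prod M.mark) M.prob := by
  refine ⟨measurable_resample i j, Measure.ext fun s hs => ?_⟩
  rw [Measure.map_apply (measurable_resample i j) hs, ← lintegral_indicator_one hs,
    ← M.lintegral_resample_of_measurable i j _ (measurable_one.indicator hs),
    ← lintegral_indicator_one (measurable_resample i j hs)]
  rfl

end CatModel

/-! ### Regular sample points -/

namespace CatModel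

variable (M : CatModel)

/-- Sample points with positive marks whose partial sums diverge. -/
structure IsRegular (ω : CatOmega) : Prop where
  wait_pos : ∀ m, 0 < (ω m).1.1
  jump_pos : ∀ m, 0 < (ω m).1.2
  amount_pos : ∀ m, 0 < (ω m).2.1
  claim_pos : ∀ m, 0 < (ω m).2.2
  wait_sum : ∀ b : ℕ, ∃ n, (b : ℝ) < ∑ m ∈ Finset.range n, (ω m).1.1
  jump_sum : ∀ b : ℕ, ∃ n, (b : ℝ) < ∑ m ∈ Finset.range n, (ω m).1.2
  amount_sum : ∀ b : ℕ, ∃ n, (b : ℝ) < ∑ m ∈ Finset.range n, (ω m).2.1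

theorem ae_mark_pos : (∀ᵐ ξ ∂M.mark, 0 < ξ.1.1) ∧ (∀ᵐ ξ ∂M.mark, 0 < ξ.1.2) ∧
    (∀ᵐ ξ ∂M.mark, 0 < ξ.2.1) ∧ ∀ᵐ ξ ∂M.mark, 0 < ξ.2.2 := by
  have h1 : ∀ᵐ ξ ∂M.mark, 0 < ξ.1.1 := by
    have : ∀ᵐ x ∂expMeasure M.β, 0 < x := by
      simpa [ae_iff, ← Set.Iic_def] using expMeasure_Iic_zero (r := M.β)
    exact (Measure.quasiMeasurePreserving_fst.comp Measure.quasiMeasurePreserving_fst).ae this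
  have h2 : ∀ᵐ ξ ∂M.mark, 0 < ξ.1.2 := by
    have : ∀ᵐ x ∂M.FY, 0 < x := by
      simpa [ae_iff, ← Set.Iic_def] using M.FY_pos
    exact (Measure.quasiMeasurePreserving_snd.comp Measure.quasiMeasurePreserving_fst).ae this
  have h3 : ∀ᵐ ξ ∂M.mark, 0 < ξ.2.1 := by
    have : ∀ᵐ x ∂expMeasure 1, 0 < x := by
      simpa [ae_iff, ← Set.Iic_def] using expMeasure_Iic_zero (r := 1)
    exact (Measure.quasiMeasurePreserving_fst.comp Measure.quasiMeasurePreserving_snd).ae this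
  have h4 : ∀ᵐ ξ ∂M.mark, 0 < ξ.2.2 := by
    have : ∀ᵐ x ∂M.FU, 0 < x := by
      simpa [ae_iff, ← Set.Iic_def] using M.FU_pos
    exact (Measure.quasiMeasurePreserving_snd.comp Measure.quasiMeasurePreserving_snd).ae this
  exact ⟨h1, h2, h3, h4⟩

theorem ae_isRegular : ∀ᵐ ω ∂M.prob, IsRegular ω := by
  obtain ⟨h1, h2, h3, h4⟩ := M.ae_mark_pos
  have hc : ∀ {p : (ℝ × ℝ) × (ℝ × ℝ) → Prop}, (∀ᵐ ξ ∂M.mark, p ξ) →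
      ∀ᵐ ω ∂M.prob, ∀ m, p (ω m) := fun h =>
    ae_all_iff.2 fun m => (M.measurePreserving_apply m).quasiMeasurePreserving.ae h
  have hs : ∀ {f : (ℝ × ℝ) × (ℝ × ℝ) → ℝ}, Measurable f → (∀ᵐ ξ ∂M.mark, 0 < f ξ) →
      ∀ᵐ ω ∂M.prob, ∀ b : ℕ, ∃ n, (b : ℝ) < ∑ m ∈ Finset.range n, f (ω m) := by
    intro f hf h
    filter_upwards [ae_tendsto_sum_infinitePi M.mark f hf h] with ω hω b
    exact (hω.eventually_gt_atTop (b : ℝ)).exists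
  filter_upwards [hc h1, hc h2, hc h3, hc h4, hs (by fun_prop) h1, hs (by fun_prop) h2,
    hs (by fun_prop) h3] with ω a1 a2 a3 a4 a5 a6 a7
  exact ⟨a1, a2, a3, a4, a5, a6, a7⟩

/-- Divergence is expressed through natural bounds so that this is a countable combination of
measurable conditions. -/
theorem measurableSet_isRegular : MeasurableSet {ω : CatOmega | IsRegular ω} := by
  have : {ω : CatOmega | IsRegular ω} =
      (⋂ m, {ω | 0 < (ω m).1.1}) ∩ (⋂ m, {ω | 0 < (ω m).1.2}) ∩ (⋂ m, {ω | 0 < (ω m).2.1}) ∩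
      (⋂ m, {ω | 0 < (ω m).2.2}) ∩
      (⋂ b : ℕ, ⋃ n, {ω | (b : ℝ) < ∑ m ∈ Finset.range n, (ω m).1.1}) ∩
      (⋂ b : ℕ, ⋃ n, {ω | (b : ℝ) < ∑ m ∈ Finset.range n, (ω m).1.2}) ∩
      (⋂ b : ℕ, ⋃ n, {ω | (b : ℝ) < ∑ m ∈ Finset.range n, (ω m).2.1}) := by
    ext ω
    simp only [mem_ofPred_eq, mem_inter_iff, mem_iInter, mem_iUnion]
    exact ⟨fun h => ⟨⟨⟨⟨⟨⟨h.1, h.2⟩, h.3⟩, h.4⟩, h.5⟩, h.6⟩, h.7⟩,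
      fun h => ⟨h.1.1.1.1.1.1, h.1.1.1.1.1.2, h.1.1.1.1.2, h.1.1.1.2, h.1.1.2, h.1.2, h.2⟩⟩
  rw [this]
  refine ((((((MeasurableSet.iInter fun m => ?_).inter (MeasurableSet.iInter fun m => ?_)).inter
    (MeasurableSet.iInter fun m => ?_)).inter (MeasurableSet.iInter fun m => ?_)).inter
    (MeasurableSet.iInter fun b => MeasurableSet.iUnion fun n => ?_)).inter
    (MeasurableSet.iInter fun b => MeasurableSet.iUnion fun n => ?_)).inter
    (MeasurableSet.iInter fun b => MeasurableSet.iUnion fun n => ?_) <;>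
  exact measurableSet_lt measurable_const (by fun_prop)

/-! ### Jump times -/

variable {M}
variable {ω : CatOmega}

theorem IsRegular.strictMono_jumpTime (h : IsRegular ω) : StrictMono fun i => jumpTime i ω :=
  strictMono_nat_of_lt_succ fun i => by
    unfold jumpTime; rw [Finset.sum_range_succ _ (i + 1)]; linarith [h.wait_pos (i + 1)]

theorem IsRegular.jumpTime_pos (h : IsRegular ω) (i : ℕ) : 0 < jumpTime i ω :=
  Finset.sum_pos (fun m _ => h.wait_pos m) (by simp)

theorem IsRegular.exists_lt_jumpTime (h : IsRegular ω) (t : ℝ) : ∃ i, t < jumpTime i ω := by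
  obtain ⟨b, hb⟩ := exists_nat_ge t
  obtain ⟨n, hn⟩ := h.wait_sum b
  refine ⟨n, hb.trans_lt (hn.trans ?_)⟩
  unfold jumpTime
  rw [Finset.sum_range_succ]
  linarith [h.wait_pos n]

/-- Divergence of the waiting times excludes the default value of `sInf ∅`, so `nextJump` is adjoint
to the increasing sequence of jump times; afterwards its definition is no longer needed. -/
theorem IsRegular.lt_jumpTime_iff (h : IsRegular ω) {t : ℝ} {i : ℕ} :
    t < jumpTime i ω ↔ nextJump t ω ≤ i :=
  ⟨fun hi => Nat.sInf_le hi, fun hi =>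
    lt_of_lt_of_le (show t < jumpTime (nextJump t ω) ω from Nat.sInf_mem (h.exists_lt_jumpTime t))
      (h.strictMono_jumpTime.monotone hi)⟩

theorem IsRegular.jumpTime_le_iff (h : IsRegular ω) {t : ℝ} {i : ℕ} :
    jumpTime i ω ≤ t ↔ i < nextJump t ω := by
  rw [← not_lt, h.lt_jumpTime_iff, not_le]

theorem IsRegular.lt_jumpTime_nextJump (h : IsRegular ω) (t : ℝ) :
    t < jumpTime (nextJump t ω) ω := h.lt_jumpTime_iff.2 le_rfl

theorem IsRegular.nextJump_mono (h : IsRegular ω) {s t : ℝ} (hst : s ≤ t) :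
    nextJump s ω ≤ nextJump t ω :=
  h.lt_jumpTime_iff.1 (hst.trans_lt (h.lt_jumpTime_nextJump t))

theorem IsRegular.nextJump_zero (h : IsRegular ω) : nextJump 0 ω = 0 :=
  Nat.le_zero.1 (h.lt_jumpTime_iff.1 (h.jumpTime_pos 0))

/-! ### The intensity and the claim times -/

variable (M)

/-- `∫₀ˢ e^{-d r} dr`. -/
noncomputable def decayInt (s : ℝ) : ℝ := (1 - Real.exp (-(M.d * s))) / M.d

/-- The integrated intensity at time `s` when it starts at `lam` and no catastrophe occurs. -/
noncomputable def cumC (lam s : ℝ) : ℝ := M.lamBar * s + (lam - M.lamBar) * M.decayInt s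

theorem decayInt_mono : Monotone M.decayInt := fun s t hst => by
  unfold decayInt
  have := M.d_pos
  gcongr

@[simp] theorem decayInt_zero : M.decayInt 0 = 0 := by simp [decayInt]

theorem hasDerivAt_decayInt (s : ℝ) : HasDerivAt M.decayInt (Real.exp (-(M.d * s))) s := by
  have h : HasDerivAt (fun s => -(M.d * s)) (-M.d) s := by
    simpa using (hasDerivAt_id s).const_mul (-M.d)
  have := ((h.exp.const_sub 1).div_const M.d)
  refine this.congr_deriv ?_
  field_simp [M.d_pos.ne']

theorem continuous_decayInt : Continuous M.decayInt := by unfold decayInt; fun_prop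

theorem decayInt_add (s t : ℝ) :
    M.decayInt (s + t) = M.decayInt s + Real.exp (-(M.d * s)) * M.decayInt t := by
  unfold decayInt
  have : Real.exp (-(M.d * (s + t))) = Real.exp (-(M.d * s)) * Real.exp (-(M.d * t)) := by
    rw [← Real.exp_add]; ring_nf
  rw [this]; ring

theorem cumC_mono {lam : ℝ} (hlam : M.lamBar ≤ lam) : Monotone (M.cumC lam) := fun s t hst => by
  unfold cumC
  have h1 := mul_le_mul_of_nonneg_left hst M.lamBar_nonneg
  have h2 := mul_le_mul_of_nonneg_left (M.decayInt_mono hst) (sub_nonneg.2 hlam)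
  linarith

theorem hasDerivAt_cumC (lam s : ℝ) : HasDerivAt (M.cumC lam) (M.lamC lam s) s := by
  have := ((hasDerivAt_id s).const_mul M.lamBar).add
    ((M.hasDerivAt_decayInt s).const_mul (lam - M.lamBar))
  refine this.congr_deriv ?_
  simp [lamC]; ring

theorem lamBar_le_lamC {lam : ℝ} (hlam : M.lamBar ≤ lam) (t : ℝ) : M.lamBar ≤ M.lamC lam t := by
  unfold lamC
  have := mul_nonneg (Real.exp_nonneg (-(M.d * t))) (sub_nonneg.2 hlam)
  linarith

variable {M}

/-- Catastrophes after `t` contribute `0`, so the series is finite. The bound `N` is left free so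
that one sum can serve several times. -/
theorem IsRegular.intensity_eq (h : IsRegular ω) (lam : ℝ) {t : ℝ} {N : ℕ}
    (hN : nextJump t ω ≤ N) :
    M.intensity lam t ω = M.lamC lam t + ∑ m ∈ Finset.range N, if jumpTime m ω ≤ t then
      jumpSize m ω * Real.exp (-(M.d * (t - jumpTime m ω))) else 0 := by
  unfold intensity
  rw [tsum_eq_sum]
  intro m hm
  rw [if_neg]
  rw [h.jumpTime_le_iff]
  simp at hm
  omega

theorem IsRegular.lamBar_le_intensity (h : IsRegular ω) {lam : ℝ} (hlam : M.lamBar ≤ lam)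
    (t : ℝ) : M.lamBar ≤ M.intensity lam t ω := by
  rw [h.intensity_eq lam le_rfl]
  have : 0 ≤ ∑ m ∈ Finset.range (nextJump t ω), if jumpTime m ω ≤ t then
      jumpSize m ω * Real.exp (-(M.d * (t - jumpTime m ω))) else 0 := by
    refine Finset.sum_nonneg fun m _ => ?_
    split_ifs
    · exact mul_nonneg (h.jump_pos m).le (Real.exp_nonneg _)
    · exact le_rfl
  linarith [M.lamBar_le_lamC hlam t]

theorem IsRegular.intensity_zero (h : IsRegular ω) (lam : ℝ) : M.intensity lam 0 ω = lam := by
  rw [h.intensity_eq lam h.nextJump_zero.le]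
  simp [lamC]

theorem IsRegular.intervalIntegrable_sum (N : ℕ) (lam a b : ℝ) :
    IntervalIntegrable (fun t => M.lamC lam t + ∑ m ∈ Finset.range N, if jumpTime m ω ≤ t then
      jumpSize m ω * Real.exp (-(M.d * (t - jumpTime m ω))) else 0) volume a b := by
  have h1 : Continuous (M.lamC lam) := by unfold lamC; fun_prop
  refine (h1.intervalIntegrable _ _).add ?_
  have h2 : ∀ m : ℕ, IntervalIntegrable (fun t => if jumpTime m ω ≤ t then
      jumpSize m ω * Real.exp (-(M.d * (t - jumpTime m ω))) else 0) volume a b := by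
    intro m
    have h3 : Continuous fun t => jumpSize m ω * Real.exp (-(M.d * (t - jumpTime m ω))) := by
      fun_prop
    have h4 := h3.intervalIntegrable (μ := volume) a b
    rw [intervalIntegrable_iff] at h4 ⊢
    have h5 : (fun t => if jumpTime m ω ≤ t then
        jumpSize m ω * Real.exp (-(M.d * (t - jumpTime m ω))) else 0)
        = (Ici (jumpTime m ω)).indicator
          fun t => jumpSize m ω * Real.exp (-(M.d * (t - jumpTime m ω))) := by
      funext t; simp [indicator, mem_Ici]
    rw [h5]
    exact h4.indicator measurableSet_Ici
  have := IntervalIntegrable.sum (Finset.range N) (fun m _ => h2 m)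
  exact this.congr (fun t _ => by simp)

theorem IsRegular.intervalIntegrable_intensity (h : IsRegular ω) (lam a b : ℝ) :
    IntervalIntegrable (fun t => M.intensity lam t ω) volume a b := by
  refine (IsRegular.intervalIntegrable_sum (M := M) (ω := ω) (nextJump (max a b) ω) lam a b).congr
    fun t ht => ?_
  exact (h.intensity_eq lam (h.nextJump_mono ht.2)).symm

/-- The truncation `max 0` makes the primitive continuous across jump times. It is differentiable
away from them, so the fundamental theorem of calculus with a countable exceptional set applies. -/
theorem IsRegular.cumIntensity_eq (h : IsRegular ω) (lam : ℝ) {t : ℝ} (ht : 0 ≤ t) {N : ℕ}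
    (hN : nextJump t ω ≤ N) :
    M.cumIntensity lam t ω = M.cumC lam t +
      ∑ m ∈ Finset.range N, jumpSize m ω * M.decayInt (max 0 (t - jumpTime m ω)) := by
  have hcongr : M.cumIntensity lam t ω = ∫ s in (0 : ℝ)..t, (M.lamC lam s +
      ∑ m ∈ Finset.range N, if jumpTime m ω ≤ s then
      jumpSize m ω * Real.exp (-(M.d * (s - jumpTime m ω))) else 0) := by
    unfold cumIntensity
    refine intervalIntegral.integral_congr fun s hs => ?_
    rw [uIcc_of_le ht] at hs
    exact h.intensity_eq lam ((h.nextJump_mono hs.2).trans hN)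
  have hcC : Continuous (M.cumC lam) := by
    unfold cumC; have := M.continuous_decayInt; fun_prop
  have hF := MeasureTheory.integral_eq_of_hasDerivAt_off_countable_of_le
    (fun s => M.cumC lam s + ∑ m ∈ Finset.range N,
      jumpSize m ω * M.decayInt (max 0 (s - jumpTime m ω))) _ ht
    (s := range fun m => jumpTime m ω) (countable_range _)
    (by have := M.continuous_decayInt; fun_prop)
    (fun s hs => ?_) (IsRegular.intervalIntegrable_sum (M := M) (ω := ω) N lam 0 t)
  · rw [hcongr, hF]
    have h0 : ∀ m, max 0 (-jumpTime m ω) = 0 := fun m => by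
      have := h.jumpTime_pos m
      rw [max_eq_left]; linarith
    simp [h0, cumC]
  · refine (M.hasDerivAt_cumC lam s).add (HasDerivAt.fun_sum fun m _ => ?_)
    have hne : jumpTime m ω ≠ s := fun e => hs.2 ⟨m, e⟩
    rcases lt_or_gt_of_ne hne with hlt | hgt
    · rw [if_pos hlt.le]
      have h1 : HasDerivAt (fun s => jumpSize m ω * M.decayInt (s - jumpTime m ω))
          (jumpSize m ω * Real.exp (-(M.d * (s - jumpTime m ω)))) s :=
        ((M.hasDerivAt_decayInt (s - jumpTime m ω)).comp_sub_const s _).const_mul _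
      refine h1.congr_of_eventuallyEq ?_
      filter_upwards [lt_mem_nhds hlt] with r hr
      rw [max_eq_right (by linarith)]
    · rw [if_neg (not_le.2 hgt)]
      refine (hasDerivAt_const s (0 : ℝ)).congr_of_eventuallyEq ?_
      filter_upwards [gt_mem_nhds hgt] with r hr
      rw [max_eq_left (by linarith)]
      simp

theorem cumIntensity_zero (lam : ℝ) : M.cumIntensity lam 0 ω = 0 := by simp [cumIntensity]

theorem IsRegular.cumIntensity_mono (h : IsRegular ω) {lam : ℝ} (hlam : M.lamBar ≤ lam)
    {s t : ℝ} (hs : 0 ≤ s) (hst : s ≤ t) : M.cumIntensity lam s ω ≤ M.cumIntensity lam t ω := by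
  rw [h.cumIntensity_eq lam hs (h.nextJump_mono hst), h.cumIntensity_eq lam (hs.trans hst) le_rfl]
  refine add_le_add (M.cumC_mono hlam hst) (Finset.sum_le_sum fun m _ => ?_)
  refine mul_le_mul_of_nonneg_left (M.decayInt_mono ?_) (h.jump_pos m).le
  exact max_le_max le_rfl (by linarith)

/-- The base intensity may be `0`, so the growth must come from the catastrophes: one time unit
after its arrival a jump of size `y` has contributed at least `y * M.decayInt 1`, and the sum of the
sizes diverges. Hence every claim time is an infimum over a nonempty set. -/
theorem IsRegular.exists_le_cumIntensity (h : IsRegular ω) {lam : ℝ} (hlam : M.lamBar ≤ lam)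
    (b : ℝ) : ∃ t, 0 ≤ t ∧ b ≤ M.cumIntensity lam t ω := by
  have hd := M.d_pos
  have h2 : 0 < 1 - Real.exp (-(M.d * 1)) := by
    have : Real.exp (-(M.d * 1)) < 1 := by simpa using hd
    linarith
  have hD : 0 < M.decayInt 1 := div_pos h2 hd
  obtain ⟨k, hk⟩ := exists_nat_ge (b / M.decayInt 1)
  obtain ⟨n, hn⟩ := h.jump_sum k
  set t := jumpTime n ω + 1
  have ht : 0 ≤ t := by linarith [h.jumpTime_pos n]
  refine ⟨t, ht, ?_⟩
  have hnt : n ≤ nextJump t ω := (h.jumpTime_le_iff.1 (by simp [t])).le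
  rw [h.cumIntensity_eq lam ht le_rfl]
  have h1 : 0 ≤ M.cumC lam t := by
    have := M.cumC_mono hlam ht
    simpa [cumC] using this
  have h3 : ∑ m ∈ Finset.range n, (ω m).1.2 * M.decayInt 1 ≤
      ∑ m ∈ Finset.range (nextJump t ω), jumpSize m ω * M.decayInt (max 0 (t - jumpTime m ω)) := by
    refine (Finset.sum_le_sum fun m hm => ?_).trans
      (Finset.sum_le_sum_of_subset_of_nonneg (Finset.range_mono hnt) fun m _ _ => ?_)
    · refine mul_le_mul_of_nonneg_left (M.decayInt_mono ?_) (h.jump_pos m).le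
      have : jumpTime m ω ≤ jumpTime n ω :=
        h.strictMono_jumpTime.monotone (Finset.mem_range.1 hm).le
      exact le_max_of_le_right (by simp only [t]; linarith)
    · refine mul_nonneg (h.jump_pos m).le ?_
      simpa using M.decayInt_mono (le_max_left 0 (t - jumpTime m ω))
  rw [← Finset.sum_mul] at h3
  rw [div_le_iff₀ hD] at hk
  have := mul_le_mul_of_nonneg_right hn.le hD.le
  linarith

/-- The integrated intensity that triggers claim `j`. -/
def claimLevel (j : ℕ) (ω : CatOmega) : ℝ := ∑ m ∈ Finset.range (j + 1), (ω m).2.1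

theorem IsRegular.strictMono_claimLevel (h : IsRegular ω) : StrictMono fun i => claimLevel i ω :=
  strictMono_nat_of_lt_succ fun i => by
    unfold claimLevel; rw [Finset.sum_range_succ _ (i + 1)]; linarith [h.amount_pos (i + 1)]

theorem IsRegular.claimLevel_pos (h : IsRegular ω) (i : ℕ) : 0 < claimLevel i ω :=
  Finset.sum_pos (fun m _ => h.amount_pos m) (by simp)

theorem IsRegular.claimTime_nonneg (lam : ℝ) (j : ℕ) :
    0 ≤ M.claimTime lam j ω := Real.sInf_nonneg fun _ hx => hx.1

/-- The integrated intensity is continuous, so its superlevel set is closed and the infimum is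
attained; monotonicity in time does the rest. Every later statement on claim times is reduced to
this comparison of levels. -/
theorem IsRegular.claimTime_le_iff (h : IsRegular ω) {lam : ℝ} (hlam : M.lamBar ≤ lam) {t : ℝ}
    (ht : 0 ≤ t) {j : ℕ} :
    M.claimTime lam j ω ≤ t ↔ claimLevel j ω ≤ M.cumIntensity lam t ω := by
  have hcont : Continuous fun t => M.cumIntensity lam t ω :=
    intervalIntegral.continuous_primitive (h.intervalIntegrable_intensity lam) 0
  have hclosed : IsClosed {t : ℝ | 0 ≤ t ∧ claimLevel j ω ≤ M.cumIntensity lam t ω} :=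
    (isClosed_le continuous_const continuous_id).inter (isClosed_le continuous_const hcont)
  have hbdd : BddBelow {t : ℝ | 0 ≤ t ∧ claimLevel j ω ≤ M.cumIntensity lam t ω} :=
    ⟨0, fun _ hx => hx.1⟩
  constructor
  · intro hle
    have hmem := hclosed.csInf_mem (h.exists_le_cumIntensity hlam _) hbdd
    exact hmem.2.trans (h.cumIntensity_mono hlam hmem.1 hle)
  · exact fun hle => csInf_le hbdd ⟨ht, hle⟩

theorem IsRegular.claimTime_pos (h : IsRegular ω) {lam : ℝ} (hlam : M.lamBar ≤ lam) (j : ℕ) :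
    0 < M.claimTime lam j ω := by
  rw [← not_le, h.claimTime_le_iff hlam le_rfl, cumIntensity_zero, not_le]
  exact h.claimLevel_pos j

theorem IsRegular.exists_lt_claimTime (h : IsRegular ω) {lam : ℝ} (hlam : M.lamBar ≤ lam) {t : ℝ}
    (ht : 0 ≤ t) : ∃ j, t < M.claimTime lam j ω := by
  obtain ⟨b, hb⟩ := exists_nat_ge (M.cumIntensity lam t ω)
  obtain ⟨n, hn⟩ := h.amount_sum b
  refine ⟨n, ?_⟩
  rw [← not_le, h.claimTime_le_iff hlam ht, not_le]
  unfold claimLevel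
  rw [Finset.sum_range_succ]
  linarith [h.amount_pos n]

theorem IsRegular.monotone_claimTime (h : IsRegular ω) {lam : ℝ} (hlam : M.lamBar ≤ lam) :
    Monotone fun j => M.claimTime lam j ω := by
  intro i j hij
  have hj := IsRegular.claimTime_nonneg (M := M) (ω := ω) lam j
  dsimp only
  rw [h.claimTime_le_iff hlam hj]
  exact (h.strictMono_claimLevel.monotone hij).trans ((h.claimTime_le_iff hlam hj).1 le_rfl)

theorem IsRegular.lt_claimTime_iff (h : IsRegular ω) {lam : ℝ} (hlam : M.lamBar ≤ lam) {t : ℝ}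
    (ht : 0 ≤ t) {j : ℕ} : t < M.claimTime lam j ω ↔ M.nextClaim lam t ω ≤ j :=
  ⟨fun hj => Nat.sInf_le hj, fun hj =>
    lt_of_lt_of_le (show t < M.claimTime lam (M.nextClaim lam t ω) ω from
      Nat.sInf_mem (h.exists_lt_claimTime hlam ht)) (h.monotone_claimTime hlam hj)⟩

theorem IsRegular.lt_claimTime_nextClaim (h : IsRegular ω) {lam : ℝ} (hlam : M.lamBar ≤ lam)
    {t : ℝ} (ht : 0 ≤ t) : t < M.claimTime lam (M.nextClaim lam t ω) ω :=
  (h.lt_claimTime_iff hlam ht).2 le_rfl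

theorem IsRegular.nextClaim_mono (h : IsRegular ω) {lam : ℝ} (hlam : M.lamBar ≤ lam) {s t : ℝ}
    (hs : 0 ≤ s) (hst : s ≤ t) : M.nextClaim lam s ω ≤ M.nextClaim lam t ω :=
  (h.lt_claimTime_iff hlam hs).1 (hst.trans_lt (h.lt_claimTime_nextClaim hlam (hs.trans hst)))

theorem IsRegular.nextClaim_zero (h : IsRegular ω) {lam : ℝ} (hlam : M.lamBar ≤ lam) :
    M.nextClaim lam 0 ω = 0 :=
  Nat.le_zero.1 ((h.lt_claimTime_iff hlam le_rfl).1 (h.claimTime_pos hlam 0))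

/-! ### Between two catastrophes -/

/-- Between catastrophes the intensity restarts deterministically from its present value. The
endpoint is allowed, because a jump adds no area at the instant at which it occurs. -/
theorem IsRegular.cumIntensity_add (h : IsRegular ω) (lam : ℝ) {t s : ℝ} (ht : 0 ≤ t)
    (hs : 0 ≤ s) (hts : t + s ≤ jumpTime (nextJump t ω) ω) :
    M.cumIntensity lam (t + s) ω =
      M.cumIntensity lam t ω + M.cumC (M.intensity lam t ω) s := by
  set N := nextJump t ω with hN
  -- At the endpoint catastrophe `N` has just occurred, hence the `+ 1`; its term in the sum is
  -- `decayInt 0 = 0`.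
  have hN' : nextJump (t + s) ω ≤ N + 1 :=
    h.lt_jumpTime_iff.1 (hts.trans_lt (h.strictMono_jumpTime (Nat.lt_succ_self N)))
  rw [h.cumIntensity_eq lam ht le_rfl, h.cumIntensity_eq lam (add_nonneg ht hs) hN',
    h.intensity_eq lam le_rfl, Finset.sum_range_succ, ← hN,
    max_eq_left (b := t + s - jumpTime N ω) (by linarith)]
  have e : ∀ m ∈ Finset.range N, jumpSize m ω * M.decayInt (max 0 (t + s - jumpTime m ω)) =
      jumpSize m ω * M.decayInt (max 0 (t - jumpTime m ω)) + (if jumpTime m ω ≤ t then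
        jumpSize m ω * Real.exp (-(M.d * (t - jumpTime m ω))) else 0) * M.decayInt s := by
    intro m hm
    have hm' : jumpTime m ω ≤ t := h.jumpTime_le_iff.2 (Finset.mem_range.1 hm)
    rw [if_pos hm', max_eq_right (by linarith), max_eq_right (by linarith),
      show t + s - jumpTime m ω = (t - jumpTime m ω) + s by ring, decayInt_add]
    ring
  rw [Finset.sum_congr rfl e, Finset.sum_add_distrib, ← Finset.sum_mul]
  simp only [cumC, lamC, decayInt_add, decayInt_zero]
  ring

theorem IsRegular.intensity_sum_add (lam t s : ℝ) (N : ℕ) (hs : 0 ≤ s)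
    (hN : ∀ m < N, jumpTime m ω ≤ t) :
    M.lamC lam (t + s) + ∑ m ∈ Finset.range N, (if jumpTime m ω ≤ t + s then
      jumpSize m ω * Real.exp (-(M.d * (t + s - jumpTime m ω))) else 0)
    = M.lamC (M.lamC lam t + ∑ m ∈ Finset.range N, if jumpTime m ω ≤ t then
      jumpSize m ω * Real.exp (-(M.d * (t - jumpTime m ω))) else 0) s := by
  have e : ∀ m ∈ Finset.range N, (if jumpTime m ω ≤ t + s then
      jumpSize m ω * Real.exp (-(M.d * (t + s - jumpTime m ω))) else 0) =
      Real.exp (-(M.d * s)) * (if jumpTime m ω ≤ t then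
        jumpSize m ω * Real.exp (-(M.d * (t - jumpTime m ω))) else 0) := by
    intro m hm
    have hm' := hN m (Finset.mem_range.1 hm)
    rw [if_pos hm', if_pos (by linarith), mul_left_comm, ← Real.exp_add]
    ring_nf
  rw [Finset.sum_congr rfl e, ← Finset.mul_sum]
  have : Real.exp (-(M.d * (t + s))) = Real.exp (-(M.d * t)) * Real.exp (-(M.d * s)) := by
    rw [← Real.exp_add]; ring_nf
  simp only [lamC, this]
  ring

/-- In contrast to the integrated intensity, the strict inequality matters here: at the catastrophe
itself the jump has to be added. -/
theorem IsRegular.intensity_add (h : IsRegular ω) (lam : ℝ) {t s : ℝ} (hs : 0 ≤ s)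
    (hts : t + s < jumpTime (nextJump t ω) ω) :
    M.intensity lam (t + s) ω = M.lamC (M.intensity lam t ω) s := by
  rw [h.intensity_eq lam (h.lt_jumpTime_iff.1 hts), h.intensity_eq lam (t := t) le_rfl]
  exact IsRegular.intensity_sum_add lam t s _ hs fun m hm => h.jumpTime_le_iff.2 hm

theorem IsRegular.intensity_jumpTime (h : IsRegular ω) (lam t : ℝ) :
    M.intensity lam (jumpTime (nextJump t ω) ω) ω =
      M.lamC (M.intensity lam t ω) (jumpTime (nextJump t ω) ω - t)
        + jumpSize (nextJump t ω) ω := by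
  set N := nextJump t ω with hN
  have h1 : nextJump (jumpTime N ω) ω ≤ N + 1 :=
    h.lt_jumpTime_iff.1 (h.strictMono_jumpTime (Nat.lt_succ_self N))
  rw [h.intensity_eq lam h1, Finset.sum_range_succ, h.intensity_eq lam (t := t) le_rfl,
    ← IsRegular.intensity_sum_add lam t (jumpTime N ω - t) N
      (by linarith [h.lt_jumpTime_nextJump t]) fun m hm => h.jumpTime_le_iff.2 hm,
    add_sub_cancel]
  simp
  ring

end CatModel

/-! ### The action `E₀` as a function of the residual waiting times -/

namespace CatModel

variable (M : CatModel)

/-- The discount factor. -/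
noncomputable def disc (t : ℝ) : ℝ≥0∞ := ENNReal.ofReal (Real.exp (-(M.q * t)))

theorem disc_add (s t : ℝ) : M.disc (s + t) = M.disc s * M.disc t := by
  unfold disc
  rw [← ENNReal.ofReal_mul (Real.exp_nonneg _), ← Real.exp_add]
  ring_nf

@[simp] theorem disc_zero : M.disc 0 = 1 := by simp [disc]

theorem measurable_disc : Measurable M.disc := by unfold disc; fun_prop

/-- The time at which the integrated intensity without catastrophes reaches `e`. -/
noncomputable def hitC (lam e : ℝ) : ℝ := sInf {s : ℝ | 0 ≤ s ∧ e ≤ M.cumC lam s}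

/-- The discounted dividends of the action `E₀` plus the discounted value `w` of the subsequent
state, when the waiting time for the next catastrophe, its mark, the integrated intensity until
the next claim and its size are given by `ξ`. -/
noncomputable def pauseValue (δ : ℝ) (w : ℕ → ℝ → ℝ≥0∞) (n : ℕ) (lam : ℝ)
    (ξ : (ℝ × ℝ) × (ℝ × ℝ)) : ℝ≥0∞ :=
  if ξ.2.1 ≤ M.cumC lam (min δ ξ.1.1) then
    if M.grid δ n + M.p * M.hitC lam ξ.2.1 - ξ.2.2 < 0 then 0
    else M.disc (M.hitC lam ξ.2.1) *
      (ENNReal.ofReal (M.grid δ n + M.p * M.hitC lam ξ.2.1 - ξ.2.2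
          - M.grid δ (M.gridIndex δ (M.grid δ n + M.p * M.hitC lam ξ.2.1 - ξ.2.2)))
        + w (M.gridIndex δ (M.grid δ n + M.p * M.hitC lam ξ.2.1 - ξ.2.2))
            (M.lamC lam (M.hitC lam ξ.2.1) + if ξ.1.1 ≤ M.hitC lam ξ.2.1 then ξ.1.2 else 0))
  else if ξ.1.1 ≤ δ then M.disc ξ.1.1 *
      (ENNReal.ofReal (M.grid δ n + M.p * ξ.1.1
          - M.grid δ (M.gridIndex δ (M.grid δ n + M.p * ξ.1.1)))
        + w (M.gridIndex δ (M.grid δ n + M.p * ξ.1.1)) (M.lamC lam ξ.1.1 + ξ.1.2))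
  else M.disc δ * w (n + 1) (M.lamC lam δ)

/-- The waiting times, counted from time `t`, and marks of the next catastrophe and claim. -/
noncomputable def residual (lam t : ℝ) (ω : CatOmega) : (ℝ × ℝ) × (ℝ × ℝ) :=
  ((jumpTime (nextJump t ω) ω - t, jumpSize (nextJump t ω) ω),
    (claimLevel (M.nextClaim lam t ω) ω - M.cumIntensity lam t ω,
      claimSize (M.nextClaim lam t ω) ω))

/-- Discounted value `w` of a state. -/
noncomputable def stateValue (lam : ℝ) (ω : CatOmega) (w : ℕ → ℝ → ℝ≥0∞) :
    Option (ℝ × ℕ) → ℝ≥0∞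
  | none => 0
  | some (t, m) => M.disc t * w m (M.intensity lam t ω)

variable {M} {ω : CatOmega}

theorem IsRegular.nextClaim_le_add_iff (h : IsRegular ω) {lam : ℝ} (hlam : M.lamBar ≤ lam)
    {t s : ℝ} (ht : 0 ≤ t) (hs : 0 ≤ s) (hts : t + s ≤ jumpTime (nextJump t ω) ω) :
    M.claimTime lam (M.nextClaim lam t ω) ω ≤ t + s ↔
      (M.residual lam t ω).2.1 ≤ M.cumC (M.intensity lam t ω) s := by
  rw [h.claimTime_le_iff hlam (add_nonneg ht hs), h.cumIntensity_add lam ht hs hts]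
  simp only [residual]
  rw [sub_le_iff_le_add']

/-- A claim that does not come after the next catastrophe only sees the undisturbed intensity, so
its waiting time is the hitting time of the residual amount by `cumC`. -/
theorem IsRegular.hitC_residual (h : IsRegular ω) {lam : ℝ} (hlam : M.lamBar ≤ lam)
    {t : ℝ} (ht : 0 ≤ t)
    (hle : M.claimTime lam (M.nextClaim lam t ω) ω ≤ jumpTime (nextJump t ω) ω) :
    M.hitC (M.intensity lam t ω) (M.residual lam t ω).2.1 =
      M.claimTime lam (M.nextClaim lam t ω) ω - t := by
  have hlt := h.lt_claimTime_nextClaim hlam ht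
  refine IsLeast.csInf_eq ⟨⟨by linarith, ?_⟩, fun s hs => ?_⟩
  · rw [← h.nextClaim_le_add_iff hlam ht (by linarith) (by linarith)]
    linarith
  · by_contra hc
    rw [not_le] at hc
    have := (h.nextClaim_le_add_iff hlam ht hs.1 (by linarith)).2 hs.2
    linarith

/-- The pathwise half of the Markov property: apart from discounting, the outcome of `E₀` depends on
`ω` only through the current intensity and the residual waiting times and marks. -/
theorem IsRegular.step_pause (h : IsRegular ω) {lam δ : ℝ} (hδ : 0 < δ) (hlam : M.lamBar ≤ lam)
    {t : ℝ} (ht : 0 ≤ t) (n : ℕ) (w : ℕ → ℝ → ℝ≥0∞) :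
    M.disc (M.step δ lam ω t n .pause).1.1 * ENNReal.ofReal (M.step δ lam ω t n .pause).1.2
        + M.stateValue lam ω w (M.step δ lam ω t n .pause).2
      = M.disc t * M.pauseValue δ w n (M.intensity lam t ω) (M.residual lam t ω) := by
  have hT := h.lt_jumpTime_nextJump t
  have hτ := h.lt_claimTime_nextClaim hlam ht
  have hcond : M.claimTime lam (M.nextClaim lam t ω) ω ≤
        min (t + δ) (jumpTime (nextJump t ω) ω) ↔
      (M.residual lam t ω).2.1 ≤ M.cumC (M.intensity lam t ω) (min δ (M.residual lam t ω).1.1) := by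
    rw [← h.nextClaim_le_add_iff hlam ht (le_min hδ.le (by simp [residual]; linarith))
      (by have := min_le_right δ (M.residual lam t ω).1.1; simp only [residual] at this ⊢; linarith),
      ← min_add_add_left]
    simp [residual]
  unfold pauseValue step
  simp only
  by_cases h1 : M.claimTime lam (M.nextClaim lam t ω) ω ≤
      min (t + δ) (jumpTime (nextJump t ω) ω)
  · rw [if_pos h1, if_pos (hcond.1 h1), h.hitC_residual hlam ht (h1.trans (min_le_right _ _))]
    set τ := M.claimTime lam (M.nextClaim lam t ω) ω with hτdef
    have hx : (M.residual lam t ω).2.2 = claimSize (M.nextClaim lam t ω) ω := rfl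
    rw [hx]
    by_cases h2 : M.grid δ n + M.p * (τ - t) - claimSize (M.nextClaim lam t ω) ω < 0
    · rw [if_pos h2, if_pos h2]
      simp [stateValue]
    · rw [if_neg h2, if_neg h2]
      have hdisc : M.disc τ = M.disc t * M.disc (τ - t) := by rw [← disc_add]; congr 1; ring
      -- The conditional term covers the null event of a claim exactly at a catastrophe; including
      -- it makes the identity hold at every regular point.
      have hint : M.intensity lam τ ω = M.lamC (M.intensity lam t ω) (τ - t) +
          if (M.residual lam t ω).1.1 ≤ τ - t then (M.residual lam t ω).1.2 else 0 := by
        rcases (h1.trans (min_le_right _ _)).lt_or_eq with h3 | h3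
        · have := h.intensity_add (M := M) lam (t := t) (s := τ - t) (by linarith) (by linarith)
          rw [add_sub_cancel] at this
          rw [this, if_neg (by simp only [residual]; linarith), add_zero]
        · rw [if_pos (by simp only [residual]; linarith), h3]
          exact h.intensity_jumpTime lam t
      simp only [stateValue, hdisc, hint]
      ring
  · rw [if_neg h1, if_neg (fun hc => h1 (hcond.2 hc))]
    by_cases h2 : jumpTime (nextJump t ω) ω ≤ t + δ
    · rw [if_pos h2, if_pos (by simp only [residual]; linarith)]
      have hdisc : M.disc (jumpTime (nextJump t ω) ω)
          = M.disc t * M.disc (M.residual lam t ω).1.1 := by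
        rw [← disc_add]; simp [residual]
      simp only [stateValue, hdisc, h.intensity_jumpTime lam t]
      simp only [residual]
      ring
    · rw [if_neg h2, if_neg (by simp only [residual]; linarith)]
      simp only [stateValue, ENNReal.ofReal_zero, mul_zero, zero_add, disc_add]
      rw [h.intensity_add lam hδ.le (not_le.1 h2), mul_assoc]

end CatModel

/-! ### Sample points with a common past -/

namespace CatModel

variable (M : CatModel)

/-- The catastrophes and claims up to time `t` are the same at `ω` and `ω'`. -/
structure SameUntil (lam t : ℝ) (ω ω' : CatOmega) : Prop where
  jump : ∀ l, jumpTime l ω ≤ t ∨ jumpTime l ω' ≤ t →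
    jumpTime l ω = jumpTime l ω' ∧ jumpSize l ω = jumpSize l ω'
  claim : ∀ l, M.claimTime lam l ω ≤ t ∨ M.claimTime lam l ω' ≤ t →
    M.claimTime lam l ω = M.claimTime lam l ω' ∧ claimSize l ω = claimSize l ω'

variable {M} {ω ω' : CatOmega} {lam t : ℝ}

theorem SameUntil.mono (h : M.SameUntil lam t ω ω') {s : ℝ} (hs : s ≤ t) :
    M.SameUntil lam s ω ω' :=
  ⟨fun l hl => h.jump l (hl.imp (·.trans hs) (·.trans hs)),
    fun l hl => h.claim l (hl.imp (·.trans hs) (·.trans hs))⟩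

theorem SameUntil.symm (h : M.SameUntil lam t ω ω') : M.SameUntil lam t ω' ω :=
  ⟨fun l hl => (h.jump l hl.symm).imp Eq.symm Eq.symm,
    fun l hl => (h.claim l hl.symm).imp Eq.symm Eq.symm⟩

theorem SameUntil.observed (h : M.SameUntil lam t ω ω') :
    M.observed lam t ω = M.observed lam t ω' := by
  funext l
  have h1 : (if jumpTime l ω ≤ t then (jumpTime l ω, jumpSize l ω) else 0)
      = if jumpTime l ω' ≤ t then (jumpTime l ω', jumpSize l ω') else 0 := by
    by_cases hl : jumpTime l ω ≤ t ∨ jumpTime l ω' ≤ t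
    · rw [(h.jump l hl).1, (h.jump l hl).2]
    · rw [not_or] at hl; rw [if_neg hl.1, if_neg hl.2]
  have h2 : (if M.claimTime lam l ω ≤ t then (M.claimTime lam l ω, claimSize l ω) else 0)
      = if M.claimTime lam l ω' ≤ t then (M.claimTime lam l ω', claimSize l ω') else 0 := by
    by_cases hl : M.claimTime lam l ω ≤ t ∨ M.claimTime lam l ω' ≤ t
    · rw [(h.claim l hl).1, (h.claim l hl).2]
    · rw [not_or] at hl; rw [if_neg hl.1, if_neg hl.2]
  exact Prod.ext h1 h2

theorem intensity_congr (h : ∀ l, jumpTime l ω ≤ t ∨ jumpTime l ω' ≤ t →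
    jumpTime l ω = jumpTime l ω' ∧ jumpSize l ω = jumpSize l ω') :
    M.intensity lam t ω = M.intensity lam t ω' := by
  unfold intensity
  congr 1
  refine tsum_congr fun l => ?_
  by_cases hl : jumpTime l ω ≤ t ∨ jumpTime l ω' ≤ t
  · rw [(h l hl).1, (h l hl).2]
  · rw [not_or] at hl; rw [if_neg hl.1, if_neg hl.2]

theorem cumIntensity_congr (h : ∀ l, jumpTime l ω ≤ t ∨ jumpTime l ω' ≤ t →
    jumpTime l ω = jumpTime l ω' ∧ jumpSize l ω = jumpSize l ω') (ht : 0 ≤ t) :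
    M.cumIntensity lam t ω = M.cumIntensity lam t ω' := by
  refine intervalIntegral.integral_congr fun s hs => ?_
  rw [uIcc_of_le ht] at hs
  exact intensity_congr fun l hl => h l (hl.imp (·.trans hs.2) (·.trans hs.2))

theorem SameUntil.intensity (h : M.SameUntil lam t ω ω') :
    M.intensity lam t ω = M.intensity lam t ω' := intensity_congr h.jump

theorem SameUntil.lt_jumpTime_iff (h : M.SameUntil lam t ω ω') (l : ℕ) :
    t < jumpTime l ω ↔ t < jumpTime l ω' := by
  by_cases hl : jumpTime l ω ≤ t ∨ jumpTime l ω' ≤ t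
  · rw [(h.jump l hl).1]
  · simp only [not_or, not_le] at hl; simp [hl.1, hl.2]

theorem SameUntil.lt_claimTime_iff (h : M.SameUntil lam t ω ω') (l : ℕ) :
    t < M.claimTime lam l ω ↔ t < M.claimTime lam l ω' := by
  by_cases hl : M.claimTime lam l ω ≤ t ∨ M.claimTime lam l ω' ≤ t
  · rw [(h.claim l hl).1]
  · simp only [not_or, not_le] at hl; simp [hl.1, hl.2]

theorem SameUntil.nextJump (h : M.SameUntil lam t ω ω') : nextJump t ω = nextJump t ω' := by
  unfold CatModel.nextJump
  simp only [h.lt_jumpTime_iff]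

theorem SameUntil.nextClaim (h : M.SameUntil lam t ω ω') :
    M.nextClaim lam t ω = M.nextClaim lam t ω' := by
  unfold CatModel.nextClaim
  simp only [h.lt_claimTime_iff]

/-- Points with index at least `i` or `j` lie after `t` on both paths. An earlier claim time, if it
is at most `t`, is determined by its common level and by the intensity up to `t`, which is the same
on both. -/
theorem IsRegular.sameUntil (h : IsRegular ω) (h' : IsRegular ω') (hlam : M.lamBar ≤ lam)
    (ht : 0 ≤ t) {i j : ℕ} (h1 : ∀ m < i, (ω m).1 = (ω' m).1) (h2 : ∀ m < j, (ω m).2 = (ω' m).2)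
    (hi : t < jumpTime i ω) (hi' : t < jumpTime i ω') (hj : t < M.claimTime lam j ω)
    (hj' : t < M.claimTime lam j ω') : M.SameUntil lam t ω ω' := by
  have hjump : ∀ l, jumpTime l ω ≤ t ∨ jumpTime l ω' ≤ t →
      jumpTime l ω = jumpTime l ω' ∧ jumpSize l ω = jumpSize l ω' := by
    intro l hl
    by_cases hli : l < i
    · refine ⟨Finset.sum_congr rfl fun m hm => ?_, ?_⟩
      · rw [h1 m (by simp at hm; omega)]
      · unfold jumpSize; rw [h1 l hli]
    · have e1 := h.strictMono_jumpTime.monotone (not_lt.1 hli)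
      have e2 := h'.strictMono_jumpTime.monotone (not_lt.1 hli)
      exact absurd hl (not_or.2 ⟨not_le.2 (hi.trans_le e1), not_le.2 (hi'.trans_le e2)⟩)
  refine ⟨hjump, fun l hl => ?_⟩
  by_cases hlj : l < j
  · have hlev : claimLevel l ω = claimLevel l ω' := Finset.sum_congr rfl fun m hm => by
      rw [h2 m (by simp at hm; omega)]
    refine ⟨?_, by unfold claimSize; rw [h2 l hlj]⟩
    have key : ∀ s, 0 ≤ s → s ≤ t → (M.claimTime lam l ω ≤ s ↔ M.claimTime lam l ω' ≤ s) := by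
      intro s hs hst
      rw [h.claimTime_le_iff hlam hs, h'.claimTime_le_iff hlam hs, hlev, cumIntensity_congr
        (fun l hl => hjump l (hl.imp (·.trans hst) (·.trans hst))) hs]
    have n1 := (h.claimTime_pos hlam l).le
    have n2 := (h'.claimTime_pos hlam l).le
    have hl1 : M.claimTime lam l ω ≤ t := hl.elim id (key t ht le_rfl).2
    have hl2 : M.claimTime lam l ω' ≤ t := (key t ht le_rfl).1 hl1
    exact le_antisymm ((key _ n2 hl2).2 le_rfl) ((key _ n1 hl1).1 le_rfl)
  · have e1 := h.monotone_claimTime hlam (not_lt.1 hlj)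
    have e2 := h'.monotone_claimTime hlam (not_lt.1 hlj)
    exact absurd hl (not_or.2 ⟨not_le.2 (hj.trans_le e1), not_le.2 (hj'.trans_le e2)⟩)

/-! ### States -/

theorem IsRegular.le_of_step (h : IsRegular ω) {δ : ℝ} (hδ : 0 < δ) (hlam : M.lamBar ≤ lam)
    (ht : 0 ≤ t) {n : ℕ} {a : CatAction} {s : ℝ} {m : ℕ}
    (hs : (M.step δ lam ω t n a).2 = some (s, m)) : t ≤ s := by
  have hT := h.lt_jumpTime_nextJump t
  have hτ := h.lt_claimTime_nextClaim hlam ht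
  cases a with
  | finish => simp [step] at hs
  | pay => simp [step] at hs; exact hs.1.le
  | pause =>
    simp only [step] at hs
    split_ifs at hs with h1 h2 h3
    all_goals simp at hs
    all_goals linarith [hs.1]

theorem IsRegular.state_nonneg (h : IsRegular ω) {δ : ℝ} (hδ : 0 < δ) (hlam : M.lamBar ≤ lam)
    {π : CatRule} {n k m : ℕ} (hs : M.state δ lam π n ω k = some (t, m)) : 0 ≤ t := by
  induction k generalizing t m with
  | zero => simp [state] at hs; exact hs.1.le
  | succ k ih =>
    rw [state] at hs
    split at hs
    · simp at hs
    · next s l hk => exact (ih hk).trans (h.le_of_step hδ hlam (ih hk) hs)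

/-- An event that ended the action earlier at `ω'` than at `ω` would occur by time `t`, hence be
shared by `ω`, where it did not happen. -/
theorem step_congr {δ s : ℝ}
    (hss : M.SameUntil lam s ω ω') (htt : M.SameUntil lam t ω ω') {n m : ℕ} {a : CatAction}
    (h : (M.step δ lam ω s n a).2 = some (t, m)) : (M.step δ lam ω' s n a).2 = some (t, m) := by
  cases a with
  | finish => simp [step] at h
  | pay => simpa [step] using h
  | pause =>
    simp only [step] at h ⊢
    rw [← hss.nextJump, ← hss.nextClaim]
    set i := CatModel.nextJump s ω
    set j := M.nextClaim lam s ω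
    have e1 := htt.jump i
    have e2 := htt.claim j
    have e3 := htt.lt_jumpTime_iff i
    have e4 := htt.lt_claimTime_iff j
    split_ifs at h with h1 h2 h3
    · simp at h
      obtain ⟨ht, hm⟩ := h
      obtain ⟨c1, c2⟩ := e2 (Or.inl ht.le)
      have h1' : M.claimTime lam j ω' ≤ min (s + δ) (jumpTime i ω') := by
        rw [← c1]
        refine le_min (h1.trans (min_le_left _ _)) ?_
        by_contra hc
        rw [not_le] at hc
        have := (e1 (Or.inr (by linarith))).1
        have := h1.trans (min_le_right _ _)
        linarith
      rw [if_pos h1', ← c1, ← c2, if_neg h2, ht, ← hm, ht]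
    · simp at h
      obtain ⟨ht, hm⟩ := h
      obtain ⟨c1, c2⟩ := e1 (Or.inl ht.le)
      have h1' : ¬ M.claimTime lam j ω' ≤ min (s + δ) (jumpTime i ω') := by
        rw [← c1, min_eq_right h3, not_le]
        rw [min_eq_right h3, not_le] at h1
        by_contra hc
        rw [not_lt] at hc
        have := (e2 (Or.inr (by linarith))).1
        linarith
      rw [if_neg h1', ← c1, if_pos h3, ht, ← hm, ht]
    · simp at h
      obtain ⟨ht, hm⟩ := h
      rw [ht] at h1 h3 ⊢
      have h3' : ¬ jumpTime i ω' ≤ t := not_le.2 (e3.1 (not_le.1 h3))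
      have h1' : ¬ M.claimTime lam j ω' ≤ min t (jumpTime i ω') := fun hc => by
        refine h1 (le_trans ?_ (le_min le_rfl (not_le.1 h3).le))
        by_contra hn
        exact absurd (hc.trans (min_le_left _ _)) (not_le.2 (e4.1 (not_le.1 hn)))
      rw [if_neg h1', if_neg h3', hm]

/-- Decision times are stopping times: rules read only the observed path and the intensity, both
fixed by the common past. -/
theorem IsRegular.state_congr (h : IsRegular ω) {δ : ℝ} (hδ : 0 < δ)
    (hlam : M.lamBar ≤ lam) {π : CatRule} {n k m : ℕ}
    (hs : M.state δ lam π n ω k = some (t, m)) (hsame : M.SameUntil lam t ω ω') :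
    M.state δ lam π n ω' k = some (t, m) := by
  induction k generalizing t m with
  | zero => simpa [state] using hs
  | succ k ih =>
    rw [state] at hs ⊢
    split at hs
    · simp at hs
    · next s l hk =>
      have h0 := h.state_nonneg hδ hlam hk
      have hss := hsame.mono (h.le_of_step hδ hlam h0 hs)
      rw [ih hk hss]
      have hc : M.chosen lam π ω k s l = M.chosen lam π ω' k s l := by
        unfold chosen; rw [hss.observed, hss.intensity]
      rw [hc] at hs
      exact step_congr hss hsame hs

/-! ### The strong Markov property -/

/-- The state at which a random time and grid index with values in `D` waits for catastrophe `i`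
and claim `j`. -/
def waitSet (M : CatModel) (lam : ℝ) (D : CatOmega → Option (ℝ × ℕ)) (i j : ℕ) : Set CatOmega :=
  {ω | ∃ t m, D ω = some (t, m) ∧ nextJump t ω = i ∧ M.nextClaim lam t ω = j}

theorem resample_fst {i j : ℕ} {ω : CatOmega} {ξ : (ℝ × ℝ) × (ℝ × ℝ)} {m : ℕ} (hm : m ≠ i) :
    (resample i j (ω, ξ) m).1 = (ω m).1 := by simp [resample, hm]

theorem resample_snd {i j : ℕ} {ω : CatOmega} {ξ : (ℝ × ℝ) × (ℝ × ℝ)} {m : ℕ} (hm : m ≠ j) :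
    (resample i j (ω, ξ) m).2 = (ω m).2 := by simp [resample, hm]

theorem jumpTime_resample (i j : ℕ) (ω : CatOmega) (ξ : (ℝ × ℝ) × (ℝ × ℝ)) :
    jumpTime i (resample i j (ω, ξ)) = ∑ m ∈ Finset.range i, (ω m).1.1 + ξ.1.1 := by
  unfold jumpTime
  rw [Finset.sum_range_succ]
  congr 1
  · exact Finset.sum_congr rfl fun m hm => by rw [resample_fst (by simp at hm; omega)]
  · simp [resample]

theorem claimLevel_resample (i j : ℕ) (ω : CatOmega) (ξ : (ℝ × ℝ) × (ℝ × ℝ)) :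
    claimLevel j (resample i j (ω, ξ)) = ∑ m ∈ Finset.range j, (ω m).2.1 + ξ.2.1 := by
  unfold claimLevel
  rw [Finset.sum_range_succ]
  congr 1
  · exact Finset.sum_congr rfl fun m hm => by rw [resample_snd (by simp at hm; omega)]
  · simp [resample]

/-- Given the past of a time at which catastrophe `i` and claim `j` are awaited, the residual
waiting times and marks have the law `mark`. -/
theorem lintegral_resample_residual (M : CatModel) {lam : ℝ} (hlam : M.lamBar ≤ lam)
    {D : CatOmega → Option (ℝ × ℕ)}
    (hD0 : ∀ ω t m, IsRegular ω → D ω = some (t, m) → 0 ≤ t)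
    (hD : ∀ ω ω' t m, IsRegular ω → D ω = some (t, m) → M.SameUntil lam t ω ω' →
      D ω' = some (t, m))
    (g : ℕ → ℝ → (ℝ × ℝ) × (ℝ × ℝ) → ℝ≥0∞) (hg : ∀ n l, M.lamBar ≤ l → Measurable (g n l))
    (i j : ℕ) (ω : CatOmega) (hω : ∀ᵐ ξ ∂M.mark, IsRegular (resample i j (ω, ξ))) :
    ∫⁻ ξ, (M.waitSet lam D i j).indicator (fun ω => (D ω).elim 0 fun z => M.disc z.1 *
        g z.2 (M.intensity lam z.1 ω) (M.residual lam z.1 ω)) (resample i j (ω, ξ)) ∂M.mark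
      = ∫⁻ ξ, (M.waitSet lam D i j).indicator (fun ω => (D ω).elim 0 fun z => M.disc z.1 *
        ∫⁻ ζ, g z.2 (M.intensity lam z.1 ω) ζ ∂M.mark) (resample i j (ω, ξ)) ∂M.mark := by
  -- If no regular redraw waits for `i` and `j`, both integrands vanish almost everywhere. Otherwise
  -- one such redraw serves as a reference path and fixes the decision time `t` and the index `m`.
  by_cases hex : ∃ ξ, IsRegular (resample i j (ω, ξ)) ∧ resample i j (ω, ξ) ∈ M.waitSet lam D i j
  swap
  · push Not at hex
    refine lintegral_congr_ae ?_
    filter_upwards [hω] with ξ hξ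
    rw [indicator_of_notMem (hex ξ hξ), indicator_of_notMem (hex ξ hξ)]
  obtain ⟨ξ₀, hreg₀, t, m, hDt, hi, hj⟩ := hex
  set ω₀ := resample i j (ω, ξ₀) with hω₀
  have ht := hD0 _ _ _ hreg₀ hDt
  have hTi : t < jumpTime i ω₀ := hi ▸ hreg₀.lt_jumpTime_nextJump t
  have hCj : t < M.claimTime lam j ω₀ := hj ▸ hreg₀.lt_claimTime_nextClaim hlam ht
  have a1 : ∀ ξ, ∀ l < i, (ω₀ l).1 = (resample i j (ω, ξ) l).1 := fun ξ l hl => by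
    rw [hω₀, resample_fst hl.ne, resample_fst hl.ne]
  have a2 : ∀ ξ, ∀ l < j, (ω₀ l).2 = (resample i j (ω, ξ) l).2 := fun ξ l hl => by
    rw [hω₀, resample_snd hl.ne, resample_snd hl.ne]
  -- `α` is the time elapsed at `t` since the last catastrophe and `ε` the integrated intensity
  -- accumulated since the last claim. A redraw waits for `i` and `j` exactly when its two
  -- exponential components exceed them.
  set α := t - ∑ l ∈ Finset.range i, (ω l).1.1 with hα
  set ε := M.cumIntensity lam t ω₀ - ∑ l ∈ Finset.range j, (ω l).2.1 with hε
  have hα0 : 0 ≤ α := by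
    rcases Nat.eq_zero_or_pos i with h0 | h0
    · simp [hα, h0, ht]
    · obtain ⟨i', rfl⟩ := Nat.exists_eq_succ_of_ne_zero h0.ne'
      have h1 : jumpTime i' ω₀ ≤ t := hreg₀.jumpTime_le_iff.2 (by omega)
      have h2 : jumpTime i' ω₀ = ∑ l ∈ Finset.range (i' + 1), (ω l).1.1 :=
        Finset.sum_congr rfl fun l hl => by
          rw [hω₀, resample_fst (by simp at hl; omega)]
      simp only [hα, Nat.succ_eq_add_one]
      linarith
  have hε0 : 0 ≤ ε := by
    rcases Nat.eq_zero_or_pos j with h0 | h0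
    · simp only [hε, h0, Finset.range_zero, Finset.sum_empty, sub_zero]
      have := hreg₀.cumIntensity_mono hlam le_rfl ht
      rwa [cumIntensity_zero] at this
    · obtain ⟨j', rfl⟩ := Nat.exists_eq_succ_of_ne_zero h0.ne'
      have h1 : M.claimTime lam j' ω₀ ≤ t := by
        rw [← not_lt, hreg₀.lt_claimTime_iff hlam ht]; omega
      rw [hreg₀.claimTime_le_iff hlam ht] at h1
      have h2 : claimLevel j' ω₀ = ∑ l ∈ Finset.range (j' + 1), (ω l).2.1 :=
        Finset.sum_congr rfl fun l hl => by
          rw [hω₀, resample_snd (by simp at hl; omega)]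
      simp only [hε, Nat.succ_eq_add_one]
      linarith
  have hjump : ∀ ξ, IsRegular (resample i j (ω, ξ)) → t < jumpTime i (resample i j (ω, ξ)) →
      M.cumIntensity lam t (resample i j (ω, ξ)) = M.cumIntensity lam t ω₀ := by
    intro ξ hξ hlt
    refine cumIntensity_congr (fun l hl => ?_) ht
    have hli : l < i := by
      by_contra hc
      have e1 := hreg₀.strictMono_jumpTime.monotone (not_lt.1 hc)
      have e2 := hξ.strictMono_jumpTime.monotone (not_lt.1 hc)
      exact absurd hl (not_or.2 ⟨not_le.2 (hlt.trans_le e2), not_le.2 (hTi.trans_le e1)⟩)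
    refine ⟨Finset.sum_congr rfl fun m hm => ?_, ?_⟩
    · rw [a1 ξ m (by simp at hm; omega)]
    · unfold jumpSize; rw [a1 ξ l hli]
  have hlt1 : ∀ ξ, t < jumpTime i (resample i j (ω, ξ)) ↔ α < ξ.1.1 := fun ξ => by
    rw [jumpTime_resample, hα, sub_lt_iff_lt_add']
  have hlt2 : ∀ ξ, IsRegular (resample i j (ω, ξ)) → α < ξ.1.1 →
      (t < M.claimTime lam j (resample i j (ω, ξ)) ↔ ε < ξ.2.1) := fun ξ hξ h1 => by
    rw [← not_le, hξ.claimTime_le_iff hlam ht, not_le, hjump ξ hξ ((hlt1 ξ).2 h1),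
      claimLevel_resample, hε, sub_lt_iff_lt_add']
  have hsame : ∀ ξ, IsRegular (resample i j (ω, ξ)) → α < ξ.1.1 → ε < ξ.2.1 →
      M.SameUntil lam t ω₀ (resample i j (ω, ξ)) := fun ξ hξ h1 h2 =>
    hreg₀.sameUntil hξ hlam ht (a1 ξ) (a2 ξ) hTi ((hlt1 ξ).2 h1) hCj ((hlt2 ξ hξ h1).2 h2)
  have hmem : ∀ ξ, IsRegular (resample i j (ω, ξ)) →
      resample i j (ω, ξ) ∈ M.waitSet lam D i j → α < ξ.1.1 ∧ ε < ξ.2.1 := by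
    rintro ξ hξ ⟨t', m', hDt', hi', hj'⟩
    have ht' := hD0 _ _ _ hξ hDt'
    have hTi' : t' < jumpTime i (resample i j (ω, ξ)) :=
      (hξ.lt_jumpTime_nextJump t').trans_eq (by rw [hi'])
    have hCj' : t' < M.claimTime lam j (resample i j (ω, ξ)) :=
      (hξ.lt_claimTime_nextClaim hlam ht').trans_eq (by rw [hj'])
    -- Both paths agree up to the smaller of the two times, which is a decision time on one of them,
    -- hence on the other.
    have htt : t = t' := by
      rcases le_total t t' with hle | hle
      · have hs := hreg₀.sameUntil hξ hlam ht (a1 ξ) (a2 ξ) hTi (hle.trans_lt hTi') hCj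
          (hle.trans_lt hCj')
        have := hD _ _ _ _ hreg₀ hDt hs
        rw [hDt'] at this
        simp at this
        exact this.1.symm
      · have hs := hreg₀.sameUntil hξ hlam ht' (a1 ξ) (a2 ξ) (hle.trans_lt hTi) hTi'
          (hle.trans_lt hCj) hCj'
        have := hD _ _ _ _ hξ hDt' hs.symm
        rw [hDt] at this
        simp at this
        exact this.1
    subst htt
    have h1 := (hlt1 ξ).1 hTi'
    exact ⟨h1, (hlt2 ξ hξ h1).1 hCj'⟩
  have hl : M.lamBar ≤ M.intensity lam t ω₀ := hreg₀.lamBar_le_intensity hlam t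
  -- Stated for arbitrary `G` because it is used twice: with `g` itself and with its average, which
  -- ignores the residual.
  have hval : ∀ ξ, IsRegular (resample i j (ω, ξ)) → ∀ G : ℕ → ℝ → (ℝ × ℝ) × (ℝ × ℝ) → ℝ≥0∞,
      (M.waitSet lam D i j).indicator (fun ω => (D ω).elim 0 fun z => M.disc z.1 *
        G z.2 (M.intensity lam z.1 ω) (M.residual lam z.1 ω)) (resample i j (ω, ξ)) =
      if α < ξ.1.1 ∧ ε < ξ.2.1 then M.disc t * G m (M.intensity lam t ω₀)
        ((ξ.1.1 - α, ξ.1.2), (ξ.2.1 - ε, ξ.2.2)) else 0 := by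
    intro ξ hξ G
    by_cases hc : α < ξ.1.1 ∧ ε < ξ.2.1
    · have hs := hsame ξ hξ hc.1 hc.2
      have hDξ := hD _ _ _ _ hreg₀ hDt hs
      have hi' := hs.nextJump.symm.trans hi
      have hj' := hs.nextClaim.symm.trans hj
      have hin : resample i j (ω, ξ) ∈ M.waitSet lam D i j := ⟨t, m, hDξ, hi', hj'⟩
      rw [indicator_of_mem hin, if_pos hc, hDξ]
      simp only [Option.elim_some, residual, hi', hj', ← hs.intensity, jumpTime_resample,
        claimLevel_resample, hjump ξ hξ ((hlt1 ξ).2 hc.1)]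
      congr 2
      refine Prod.ext (Prod.ext ?_ ?_) (Prod.ext ?_ ?_)
      · simp only [hα]; ring
      · simp [jumpSize, resample]
      · simp only [hε]; ring
      · simp [claimSize, resample]
    · rw [indicator_of_notMem fun hin => hc (hmem ξ hξ hin), if_neg hc]
  have E1 : ∫⁻ ξ, (M.waitSet lam D i j).indicator (fun ω => (D ω).elim 0 fun z => M.disc z.1 *
        g z.2 (M.intensity lam z.1 ω) (M.residual lam z.1 ω)) (resample i j (ω, ξ)) ∂M.mark =
      ∫⁻ ξ, (if α < ξ.1.1 ∧ ε < ξ.2.1 then M.disc t * g m (M.intensity lam t ω₀)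
        ((ξ.1.1 - α, ξ.1.2), (ξ.2.1 - ε, ξ.2.2)) else 0) ∂M.mark :=
    lintegral_congr_ae (hω.mono fun ξ hξ => hval ξ hξ g)
  have E2 : ∫⁻ ξ, (M.waitSet lam D i j).indicator (fun ω => (D ω).elim 0 fun z => M.disc z.1 *
        ∫⁻ ζ, g z.2 (M.intensity lam z.1 ω) ζ ∂M.mark) (resample i j (ω, ξ)) ∂M.mark =
      ∫⁻ ξ, (if α < ξ.1.1 ∧ ε < ξ.2.1 then M.disc t *
        ∫⁻ ζ, g m (M.intensity lam t ω₀) ζ ∂M.mark else 0) ∂M.mark :=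
    lintegral_congr_ae (hω.mono fun ξ hξ => hval ξ hξ fun n l _ => ∫⁻ ζ, g n l ζ ∂M.mark)
  rw [E1, E2, M.lintegral_mark_shift hα0 hε0 (fun ζ => M.disc t * g m (M.intensity lam t ω₀) ζ)
      ((hg m _ hl).const_mul _),
    M.lintegral_mark_shift hα0 hε0 (fun _ => M.disc t *
      ∫⁻ ζ, g m (M.intensity lam t ω₀) ζ ∂M.mark) measurable_const,
    lintegral_const_mul _ (hg m _ hl)]
  simp

/-- The strong Markov property: the residual waiting times and marks are independent of the past
and have the law `mark`. -/
theorem lintegral_residual (M : CatModel) {lam : ℝ} (hlam : M.lamBar ≤ lam)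
    {D : CatOmega → Option (ℝ × ℕ)}
    (hD0 : ∀ ω t m, IsRegular ω → D ω = some (t, m) → 0 ≤ t)
    (hD : ∀ ω ω' t m, IsRegular ω → D ω = some (t, m) → M.SameUntil lam t ω ω' →
      D ω' = some (t, m))
    (g : ℕ → ℝ → (ℝ × ℝ) × (ℝ × ℝ) → ℝ≥0∞) (hg : ∀ n l, M.lamBar ≤ l → Measurable (g n l))
    (hset : ∀ i j, NullMeasurableSet (M.waitSet lam D i j) M.prob)
    (hf : AEMeasurable (fun ω => (D ω).elim 0 fun z => M.disc z.1 *
      g z.2 (M.intensity lam z.1 ω) (M.residual lam z.1 ω)) M.prob)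
    (hh : AEMeasurable (fun ω => (D ω).elim 0 fun z => M.disc z.1 *
      ∫⁻ ζ, g z.2 (M.intensity lam z.1 ω) ζ ∂M.mark) M.prob) :
    ∫⁻ ω, (D ω).elim 0 (fun z => M.disc z.1 *
        g z.2 (M.intensity lam z.1 ω) (M.residual lam z.1 ω)) ∂M.prob
      = ∫⁻ ω, (D ω).elim 0 (fun z => M.disc z.1 *
        ∫⁻ ζ, g z.2 (M.intensity lam z.1 ω) ζ ∂M.mark) ∂M.prob := by
  -- The awaited indices are random, whereas resampling needs fixed ones, so the sample space is cut
  -- along the countably many pairs of indices.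
  have hsplit : ∀ f : CatOmega → ℝ≥0∞, (∀ ω, D ω = none → f ω = 0) → ∀ ω,
      f ω = ∑' p : ℕ × ℕ, (M.waitSet lam D p.1 p.2).indicator f ω := by
    intro f hf0 ω
    rcases hDω : D ω with _ | ⟨t, m⟩
    · have : ∀ p : ℕ × ℕ, (M.waitSet lam D p.1 p.2).indicator f ω = 0 := fun p => by
        simp [hf0 ω hDω]
      simp [this, hf0 ω hDω]
    · rw [tsum_eq_single (nextJump t ω, M.nextClaim lam t ω)]
      · have hin : ω ∈ M.waitSet lam D (nextJump t ω) (M.nextClaim lam t ω) :=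
          ⟨t, m, hDω, rfl, rfl⟩
        rw [indicator_of_mem hin]
      · intro p hp
        refine indicator_of_notMem ?_ _
        rintro ⟨t', m', h1, h2, h3⟩
        rw [hDω] at h1
        simp at h1
        obtain ⟨rfl, rfl⟩ := h1
        exact hp (Prod.ext h2.symm h3.symm)
  have hsum : ∀ f : CatOmega → ℝ≥0∞, (∀ ω, D ω = none → f ω = 0) → AEMeasurable f M.prob →
      ∫⁻ ω, f ω ∂M.prob = ∑' p : ℕ × ℕ, ∫⁻ ω, ∫⁻ ξ, (M.waitSet lam D p.1 p.2).indicator f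
        (resample p.1 p.2 (ω, ξ)) ∂M.mark ∂M.prob := by
    intro f hf0 hfm
    rw [lintegral_congr (hsplit f hf0),
      lintegral_tsum fun p : ℕ × ℕ => hfm.indicator₀ (hset p.1 p.2)]
    refine tsum_congr fun p => ?_
    have hR := M.measurePreserving_resample p.1 p.2
    have hi := hfm.indicator₀ (hset p.1 p.2)
    rw [← lintegral_prod (fun z => (M.waitSet lam D p.1 p.2).indicator f (resample p.1 p.2 z))
      (hi.comp_quasiMeasurePreserving hR.quasiMeasurePreserving)]
    conv_lhs => rw [← hR.map_eq]
    rw [lintegral_map' (by rwa [hR.map_eq]) hR.measurable.aemeasurable]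
  rw [hsum _ (fun ω h => by simp [h]) hf, hsum _ (fun ω h => by simp [h]) hh]
  refine tsum_congr fun p => lintegral_congr_ae ?_
  have hreg := Measure.ae_ae_of_ae_prod
    ((M.measurePreserving_resample p.1 p.2).quasiMeasurePreserving.ae M.ae_isRegular)
  filter_upwards [hreg] with ω hω
  exact M.lintegral_resample_residual hlam hD0 hD g hg p.1 p.2 ω hω

end CatModel

/-! ### Measurability on the set of regular sample points -/

theorem Measurable.comp_nat {α β : Type*} [MeasurableSpace α] [MeasurableSpace β]
    {f : ℕ → α → β} (hf : ∀ n, Measurable (f n)) {N : α → ℕ} (hN : Measurable N) :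
    Measurable fun a => f (N a) a :=
  (measurable_from_prod_countable_right (f := fun z : ℕ × α => f z.1 z.2) hf).comp
    (hN.prodMk measurable_id)

namespace CatModel

/-- The set of regular sample points. -/
def regularSet : Set CatOmega := {ω | IsRegular ω}

theorem isRegular_coe (ω : regularSet) : IsRegular (ω : CatOmega) := ω.2

variable (M : CatModel)

theorem restrict_regularSet : M.prob.restrict regularSet = M.prob :=
  Measure.restrict_eq_self_of_ae_mem M.ae_isRegular

/-- The explicit descriptions of intensities, claim times and awaited indices hold at regular
points. Measurability is therefore proved on this subtype and transferred as almost everywhere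
measurability under `prob`. -/
theorem aemeasurable_of_regularSet {β : Type*} [MeasurableSpace β] {f : CatOmega → β}
    (hf : Measurable fun ω : regularSet => f ω) : AEMeasurable f M.prob := by
  rw [← M.restrict_regularSet]
  exact aemeasurable_restrict_of_measurable_subtype measurableSet_isRegular hf

theorem nullMeasurableSet_of_regularSet {s : Set CatOmega}
    (hs : MeasurableSet {ω : regularSet | (ω : CatOmega) ∈ s}) : NullMeasurableSet s M.prob := by
  have h := (MeasurableSet.subtype_image measurableSet_isRegular hs).nullMeasurableSet
    (μ := M.prob)
  refine h.congr (eventuallyEq_set.2 ?_)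
  filter_upwards [M.ae_isRegular] with ω hω
  constructor
  · rintro ⟨ω', h', rfl⟩; exact h'
  · exact fun h' => ⟨⟨ω, hω⟩, h', rfl⟩

variable {M} {α : Type*} [MeasurableSpace α] {W : α → regularSet} {T : α → ℝ} {lam : ℝ}

theorem measurable_jumpTime (i : ℕ) : Measurable (jumpTime i) := by unfold jumpTime; fun_prop

theorem measurable_jumpSize (i : ℕ) : Measurable (jumpSize i) := by unfold jumpSize; fun_prop

theorem measurable_claimSize (i : ℕ) : Measurable (claimSize i) := by unfold claimSize; fun_prop

theorem measurable_claimLevel (i : ℕ) : Measurable (claimLevel i) := by unfold claimLevel; fun_prop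

theorem measurable_lamC : Measurable fun z : ℝ × ℝ => M.lamC z.1 z.2 := by unfold lamC; fun_prop

theorem measurable_cumC : Measurable fun z : ℝ × ℝ => M.cumC z.1 z.2 := by
  unfold cumC decayInt; fun_prop

/-- At each regular point the finite sums are eventually equal to the intensity, so it is a
pointwise limit of measurable functions. Random times are allowed, as needed at decision times. -/
theorem measurable_intensity (lam : ℝ) (hT : Measurable T) (hW : Measurable W) :
    Measurable fun a => M.intensity lam (T a) (W a) := by
  have hW' : Measurable fun a => (W a : CatOmega) := measurable_subtype_coe.comp hW
  have hj : ∀ m, Measurable fun a => jumpTime m (W a : CatOmega) := fun m =>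
    (measurable_jumpTime m).comp hW'
  have hy : ∀ m, Measurable fun a => jumpSize m (W a : CatOmega) := fun m =>
    (measurable_jumpSize m).comp hW'
  refine measurable_of_tendsto_metrizable (f := fun N a => M.lamC lam (T a) +
    ∑ m ∈ Finset.range N, if jumpTime m (W a : CatOmega) ≤ T a then jumpSize m (W a : CatOmega) *
      Real.exp (-(M.d * (T a - jumpTime m (W a : CatOmega)))) else 0) (fun N => ?_) ?_
  · refine Measurable.add ?_ (Finset.measurable_fun_sum _ fun m _ => ?_)
    · unfold lamC; fun_prop
    · refine Measurable.ite (measurableSet_le (hj m) hT) ?_ measurable_const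
      have := hj m
      have := hy m
      fun_prop
  · refine tendsto_pi_nhds.2 fun a => tendsto_const_nhds.congr' ?_
    filter_upwards [eventually_ge_atTop (nextJump (T a) (W a : CatOmega))] with N hN
    exact (isRegular_coe (W a)).intensity_eq lam hN

theorem measurable_cumIntensity (lam : ℝ) (hT : Measurable T) (hT0 : ∀ a, 0 ≤ T a)
    (hW : Measurable W) : Measurable fun a => M.cumIntensity lam (T a) (W a) := by
  have hW' : Measurable fun a => (W a : CatOmega) := measurable_subtype_coe.comp hW
  have hj : ∀ m, Measurable fun a => jumpTime m (W a : CatOmega) := fun m =>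
    (measurable_jumpTime m).comp hW'
  have hy : ∀ m, Measurable fun a => jumpSize m (W a : CatOmega) := fun m =>
    (measurable_jumpSize m).comp hW'
  have hD := M.continuous_decayInt.measurable
  refine measurable_of_tendsto_metrizable (f := fun N a => M.cumC lam (T a) +
    ∑ m ∈ Finset.range N, jumpSize m (W a : CatOmega) *
      M.decayInt (max 0 (T a - jumpTime m (W a : CatOmega)))) (fun N => ?_) ?_
  · refine Measurable.add ?_ (Finset.measurable_fun_sum _ fun m _ => ?_)
    · unfold cumC; fun_prop
    · have := hj m
      have := hy m
      fun_prop
  · refine tendsto_pi_nhds.2 fun a => tendsto_const_nhds.congr' ?_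
    filter_upwards [eventually_ge_atTop (nextJump (T a) (W a : CatOmega))] with N hN
    exact (isRegular_coe (W a)).cumIntensity_eq lam (hT0 a) hN

theorem measurable_claimTime (hlam : M.lamBar ≤ lam) (j : ℕ) (hW : Measurable W) :
    Measurable fun a => M.claimTime lam j (W a) := by
  have hW' : Measurable fun a => (W a : CatOmega) := measurable_subtype_coe.comp hW
  refine measurable_of_Iic fun t => ?_
  rcases lt_or_ge t 0 with ht | ht
  · convert MeasurableSet.empty
    refine eq_empty_iff_forall_notMem.2 fun a ha => ?_
    have : M.claimTime lam j (W a) ≤ t := ha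
    have := IsRegular.claimTime_nonneg (M := M) (ω := (W a : CatOmega)) lam j
    linarith
  · have : (fun a => M.claimTime lam j (W a)) ⁻¹' Iic t =
        {a | claimLevel j (W a : CatOmega) ≤ M.cumIntensity lam t (W a)} := by
      ext a
      exact (isRegular_coe (W a)).claimTime_le_iff hlam ht
    rw [this]
    exact measurableSet_le ((measurable_claimLevel j).comp hW')
      (measurable_cumIntensity lam measurable_const (fun _ => ht) hW)

theorem measurable_nextJump (hT : Measurable T) (hW : Measurable W) :
    Measurable fun a => nextJump (T a) (W a : CatOmega) := by
  have hW' : Measurable fun a => (W a : CatOmega) := measurable_subtype_coe.comp hW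
  refine measurable_of_Iic fun i => ?_
  have : (fun a => nextJump (T a) (W a : CatOmega)) ⁻¹' Iic i =
      {a | T a < jumpTime i (W a : CatOmega)} := by
    ext a
    exact (isRegular_coe (W a)).lt_jumpTime_iff.symm
  rw [this]
  exact measurableSet_lt hT ((measurable_jumpTime i).comp hW')

theorem measurable_nextClaim (hlam : M.lamBar ≤ lam) (hT : Measurable T) (hT0 : ∀ a, 0 ≤ T a)
    (hW : Measurable W) : Measurable fun a => M.nextClaim lam (T a) (W a) := by
  refine measurable_of_Iic fun j => ?_
  have : (fun a => M.nextClaim lam (T a) (W a)) ⁻¹' Iic j =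
      {a | T a < M.claimTime lam j (W a)} := by
    ext a
    exact ((isRegular_coe (W a)).lt_claimTime_iff hlam (hT0 a)).symm
  rw [this]
  exact measurableSet_lt hT (measurable_claimTime hlam j hW)

theorem measurable_observed (hlam : M.lamBar ≤ lam) (hT : Measurable T) (hW : Measurable W) :
    Measurable fun a => M.observed lam (T a) (W a) := by
  have hW' : Measurable fun a => (W a : CatOmega) := measurable_subtype_coe.comp hW
  refine measurable_pi_iff.2 fun i => Measurable.prodMk ?_ ?_
  · have hj := (measurable_jumpTime i).comp hW'
    exact Measurable.ite (measurableSet_le hj hT)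
      (hj.prodMk ((measurable_jumpSize i).comp hW')) measurable_const
  · have hj := measurable_claimTime hlam i hW
    exact Measurable.ite (measurableSet_le hj hT)
      (hj.prodMk ((measurable_claimSize i).comp hW')) measurable_const

theorem measurable_chosen (hlam : M.lamBar ≤ lam) {π : CatRule} {k : ℕ} (hπ : Measurable (π k))
    (hT : Measurable T) (hW : Measurable W) {N : α → ℕ} (hN : Measurable N) :
    Measurable fun a => M.chosen lam π (W a) k (T a) (N a) :=
  hπ.comp ((hT.prodMk (measurable_observed hlam hT hW)).prodMk
    (hN.prodMk (measurable_intensity lam hT hW)))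

theorem measurable_grid (δ : ℝ) : Measurable fun n => M.grid δ n := measurable_of_countable _

theorem measurable_gridIndex (δ : ℝ) : Measurable fun x => M.gridIndex δ x := by
  unfold gridIndex
  exact Nat.measurable_floor.comp (by fun_prop)

/-- Encoding of optional states by a real number and a natural number. -/
def encodeState : Option (ℝ × ℕ) → ℝ × ℕ
  | none => (0, 0)
  | some (t, m) => (t, m + 1)

theorem measurable_residual (hlam : M.lamBar ≤ lam) (hT : Measurable T) (hT0 : ∀ a, 0 ≤ T a)
    (hW : Measurable W) : Measurable fun a => M.residual lam (T a) (W a) := by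
  have hW' : Measurable fun a => (W a : CatOmega) := measurable_subtype_coe.comp hW
  have h1 := measurable_nextJump hT hW
  have h2 := measurable_nextClaim hlam hT hT0 hW
  exact (((Measurable.comp_nat (fun i => (measurable_jumpTime i).comp hW') h1).sub hT).prodMk
    (Measurable.comp_nat (fun i => (measurable_jumpSize i).comp hW') h1)).prodMk
    (((Measurable.comp_nat (fun i => (measurable_claimLevel i).comp hW') h2).sub
      (measurable_cumIntensity lam hT hT0 hW)).prodMk
    (Measurable.comp_nat (fun i => (measurable_claimSize i).comp hW') h2))

theorem measurable_step_pause (hlam : M.lamBar ≤ lam) (δ : ℝ) (hT : Measurable T)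
    (hT0 : ∀ a, 0 ≤ T a) (hW : Measurable W) {N : α → ℕ} (hN : Measurable N) :
    Measurable fun a => ((M.step δ lam (W a) (T a) (N a) .pause).1,
      encodeState (M.step δ lam (W a) (T a) (N a) .pause).2) := by
  have hW' : Measurable fun a => (W a : CatOmega) := measurable_subtype_coe.comp hW
  have h1 := measurable_nextJump hT hW
  have h2 := measurable_nextClaim hlam hT hT0 hW
  have hτ : Measurable fun a => M.claimTime lam (M.nextClaim lam (T a) (W a)) (W a) :=
    Measurable.comp_nat (fun i => measurable_claimTime hlam i hW) h2
  have hU := Measurable.comp_nat (fun i => (measurable_claimSize i).comp hW') h2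
  have hJ : Measurable fun a => jumpTime (nextJump (T a) (W a : CatOmega)) (W a : CatOmega) :=
    Measurable.comp_nat (fun i => (measurable_jumpTime i).comp hW') h1
  have hgN : Measurable fun a => M.grid δ (N a) := (measurable_grid δ).comp hN
  have hx1 := (hgN.add ((hτ.sub hT).const_mul M.p)).sub hU
  have hx2 := hgN.add ((hJ.sub hT).const_mul M.p)
  have hi1 := (measurable_gridIndex (M := M) δ).comp hx1
  have hi2 := (measurable_gridIndex (M := M) δ).comp hx2
  have hs : Measurable (Nat.succ) := measurable_of_countable _
  have key : Measurable fun a =>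
      if M.claimTime lam (M.nextClaim lam (T a) (W a)) (W a) ≤
          min (T a + δ) (jumpTime (nextJump (T a) (W a : CatOmega)) (W a : CatOmega)) then
        if M.grid δ (N a) + M.p * (M.claimTime lam (M.nextClaim lam (T a) (W a)) (W a) - T a)
            - claimSize (M.nextClaim lam (T a) (W a)) (W a) < 0 then
          ((M.claimTime lam (M.nextClaim lam (T a) (W a)) (W a), (0 : ℝ)), ((0 : ℝ), (0 : ℕ)))
        else ((M.claimTime lam (M.nextClaim lam (T a) (W a)) (W a),
          M.grid δ (N a) + M.p * (M.claimTime lam (M.nextClaim lam (T a) (W a)) (W a) - T a)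
            - claimSize (M.nextClaim lam (T a) (W a)) (W a) - M.grid δ (M.gridIndex δ
            (M.grid δ (N a) + M.p * (M.claimTime lam (M.nextClaim lam (T a) (W a)) (W a) - T a)
            - claimSize (M.nextClaim lam (T a) (W a)) (W a)))),
          (M.claimTime lam (M.nextClaim lam (T a) (W a)) (W a), (M.gridIndex δ
            (M.grid δ (N a) + M.p * (M.claimTime lam (M.nextClaim lam (T a) (W a)) (W a) - T a)
            - claimSize (M.nextClaim lam (T a) (W a)) (W a))).succ))
      else if jumpTime (nextJump (T a) (W a : CatOmega)) (W a : CatOmega) ≤ T a + δ then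
        ((jumpTime (nextJump (T a) (W a : CatOmega)) (W a : CatOmega),
          M.grid δ (N a) + M.p *
            (jumpTime (nextJump (T a) (W a : CatOmega)) (W a : CatOmega) - T a)
            - M.grid δ (M.gridIndex δ (M.grid δ (N a) + M.p *
            (jumpTime (nextJump (T a) (W a : CatOmega)) (W a : CatOmega) - T a)))),
          (jumpTime (nextJump (T a) (W a : CatOmega)) (W a : CatOmega),
            (M.gridIndex δ (M.grid δ (N a) + M.p *
            (jumpTime (nextJump (T a) (W a : CatOmega)) (W a : CatOmega) - T a))).succ))
      else ((T a + δ, 0), (T a + δ, (N a + 1).succ)) := by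
    refine Measurable.ite (measurableSet_le hτ ((hT.add_const δ).min hJ)) ?_
      (Measurable.ite (measurableSet_le hJ (hT.add_const δ)) ?_ ?_)
    · refine Measurable.ite (measurableSet_lt hx1 measurable_const) (by fun_prop) ?_
      exact (hτ.prodMk (hx1.sub ((measurable_grid δ).comp hi1))).prodMk
        (hτ.prodMk (hs.comp hi1))
    · exact (hJ.prodMk (hx2.sub ((measurable_grid δ).comp hi2))).prodMk (hJ.prodMk (hs.comp hi2))
    · exact ((hT.add_const δ).prodMk measurable_const).prodMk ((hT.add_const δ).prodMk
        (hs.comp (hs.comp hN)))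
  convert key using 2 with a
  simp only [step]
  split_ifs <;> rfl

theorem measurable_step (hlam : M.lamBar ≤ lam) (δ : ℝ) (hT : Measurable T)
    (hT0 : ∀ a, 0 ≤ T a) (hW : Measurable W) {N : α → ℕ} (hN : Measurable N) {A : α → CatAction}
    (hA : Measurable A) :
    Measurable fun a => ((M.step δ lam (W a) (T a) (N a) (A a)).1,
      encodeState (M.step δ lam (W a) (T a) (N a) (A a)).2) := by
  classical
  have hs : ∀ c, MeasurableSet {a | A a = c} := fun c =>
    hA (t := {c}) MeasurableSpace.measurableSet_top
  have hgN : Measurable fun a => M.grid δ (N a) := (measurable_grid δ).comp hN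
  have hp : Measurable fun n : ℕ => n - 1 + 1 := measurable_of_countable _
  have key : Measurable fun a => if A a = .pause then ((M.step δ lam (W a) (T a) (N a) .pause).1,
      encodeState (M.step δ lam (W a) (T a) (N a) .pause).2) else
      if A a = .pay then ((T a, M.p * δ), (T a, N a - 1 + 1))
      else ((T a, M.grid δ (N a)), (0, 0)) := by
    refine Measurable.ite (hs _) (measurable_step_pause hlam δ hT hT0 hW hN)
      (Measurable.ite (hs _) ?_ ?_)
    · exact (hT.prodMk measurable_const).prodMk (hT.prodMk (hp.comp hN))
    · exact (hT.prodMk hgN).prodMk measurable_const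
  convert key using 2 with a
  cases h : A a <;> simp [step, encodeState]

/-! ### Measurability of the states -/

/-- The code of the index is shifted by one, so that `0` marks `none`. This replaces a sigma-algebra
on optional states. -/
theorem elim_eq_encodeState {β : Type*} (o : Option (ℝ × ℕ)) (c : β) (f : ℝ × ℕ → β) :
    o.elim c f = if (encodeState o).2 = 0 then c else
      f ((encodeState o).1, (encodeState o).2 - 1) := by
  rcases o with _ | ⟨t, m⟩ <;> simp [encodeState]

theorem measurable_elim_of_encodeState {β : Type*} [MeasurableSpace β] {S : α → Option (ℝ × ℕ)}
    (hS : Measurable fun a => encodeState (S a)) (c : β) {F : ℝ → ℕ → α → β}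
    (hF : Measurable fun a => F (encodeState (S a)).1 ((encodeState (S a)).2 - 1) a) :
    Measurable fun a => (S a).elim c fun z => F z.1 z.2 a := by
  have hs : MeasurableSet {a | (encodeState (S a)).2 = 0} := hS.snd (measurableSet_singleton 0)
  convert Measurable.ite hs (measurable_const (a := c)) hF using 2 with a
  exact elim_eq_encodeState (S a) c fun z => F z.1 z.2 a

theorem encodeState_nonneg {δ : ℝ} (hδ : 0 < δ) (hlam : M.lamBar ≤ lam) (π : CatRule)
    (n k : ℕ) (ω : regularSet) : 0 ≤ (encodeState (M.state δ lam π n ω k)).1 := by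
  rcases h : M.state δ lam π n ω k with _ | ⟨t, m⟩
  · exact le_rfl
  · exact (isRegular_coe ω).state_nonneg hδ hlam h

theorem measurable_encodeState {δ : ℝ} (hδ : 0 < δ) (hlam : M.lamBar ≤ lam) {π : CatRule}
    (hπ : ∀ k, Measurable (π k)) (n k : ℕ) :
    Measurable fun ω : regularSet => encodeState (M.state δ lam π n ω k) := by
  induction k with
  | zero => exact measurable_const
  | succ k ih =>
    have hp : Measurable fun n : ℕ => n - 1 := measurable_of_countable _
    have hN := hp.comp ih.snd
    have hA := measurable_chosen hlam (hπ k) ih.fst measurable_id hN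
    have hst := (measurable_step hlam δ ih.fst (encodeState_nonneg hδ hlam π n k) measurable_id
      hN hA).snd
    have key := measurable_elim_of_encodeState (F := fun t m (ω : regularSet) => encodeState
      (M.step δ lam ω t m (M.chosen lam π ω k t m)).2) ih (0, 0) hst
    convert key using 2 with ω
    rw [state]
    rcases M.state δ lam π n ω k with _ | ⟨t, m⟩ <;> rfl

theorem measurable_payment {δ : ℝ} (hδ : 0 < δ) (hlam : M.lamBar ≤ lam) {π : CatRule}
    (hπ : ∀ k, Measurable (π k)) (n k : ℕ) :
    Measurable fun ω : regularSet => M.payment δ lam π n ω k := by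
  have ih := measurable_encodeState hδ hlam hπ n k
  have hp : Measurable fun n : ℕ => n - 1 := measurable_of_countable _
  have hN := hp.comp ih.snd
  have hA := measurable_chosen hlam (hπ k) ih.fst measurable_id hN
  have hst := (measurable_step hlam δ ih.fst (encodeState_nonneg hδ hlam π n k) measurable_id
    hN hA).fst
  have key := measurable_elim_of_encodeState (F := fun t m (ω : regularSet) =>
    (M.step δ lam ω t m (M.chosen lam π ω k t m)).1) ih (0, 0) hst
  convert key using 2 with ω
  rw [payment]
  rcases M.state δ lam π n ω k with _ | ⟨t, m⟩ <;> rfl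

/-! ### Measurability of the one-step value -/

theorem measurable_hitC : Measurable fun z : ℝ × ℝ => M.hitC (max M.lamBar z.1) z.2 := by
  have hc : ∀ s, Measurable fun z : ℝ × ℝ => M.cumC (max M.lamBar z.1) s := fun s =>
    measurable_cumC.comp ((measurable_const.max measurable_fst).prodMk measurable_const)
  refine measurable_of_Iic fun s => ?_
  have hnn : ∀ z : ℝ × ℝ, 0 ≤ M.hitC (max M.lamBar z.1) z.2 := fun z =>
    Real.sInf_nonneg fun _ hx => hx.1
  rcases lt_or_ge s 0 with hs | hs
  · convert MeasurableSet.empty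
    refine eq_empty_iff_forall_notMem.2 fun z hz => ?_
    have : M.hitC (max M.lamBar z.1) z.2 ≤ s := hz
    linarith [hnn z]
  · have : (fun z : ℝ × ℝ => M.hitC (max M.lamBar z.1) z.2) ⁻¹' Iic s =
        {z | z.2 ≤ M.cumC (max M.lamBar z.1) s} ∪
        ⋂ n : ℕ, {z | M.cumC (max M.lamBar z.1) n < z.2} := by
      ext z
      simp only [mem_preimage, mem_Iic, mem_union, mem_ofPred_eq, mem_iInter]
      have hmono := M.cumC_mono (le_max_left M.lamBar z.1)
      have hcont : Continuous (M.cumC (max M.lamBar z.1)) := by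
        unfold cumC; have := M.continuous_decayInt; fun_prop
      have hbdd : BddBelow {s : ℝ | 0 ≤ s ∧ z.2 ≤ M.cumC (max M.lamBar z.1) s} :=
        ⟨0, fun _ hx => hx.1⟩
      have hclosed : IsClosed {s : ℝ | 0 ≤ s ∧ z.2 ≤ M.cumC (max M.lamBar z.1) s} :=
        (isClosed_le continuous_const continuous_id).inter (isClosed_le continuous_const hcont)
      constructor
      · intro h
        by_cases hne : {s : ℝ | 0 ≤ s ∧ z.2 ≤ M.cumC (max M.lamBar z.1) s}.Nonempty
        · exact Or.inl ((hclosed.csInf_mem hne hbdd).2.trans (hmono h))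
        · refine Or.inr fun n => not_le.1 fun hc => hne ⟨n, Nat.cast_nonneg n, hc⟩
      · rintro (h | h)
        · exact csInf_le hbdd ⟨hs, h⟩
        · have : {s : ℝ | 0 ≤ s ∧ z.2 ≤ M.cumC (max M.lamBar z.1) s} = ∅ := by
            refine eq_empty_iff_forall_notMem.2 fun x hx => ?_
            obtain ⟨n, hn⟩ := exists_nat_ge x
            exact absurd (hx.2.trans (hmono hn)) (not_le.2 (h n))
          rw [hitC, this, Real.sInf_empty]
          exact hs
    rw [this]
    exact (measurableSet_le measurable_snd (hc s)).union
      (MeasurableSet.iInter fun n => measurableSet_lt (hc n) measurable_snd)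

theorem measurable_pauseValue (δ : ℝ) {w : ℕ → ℝ → ℝ≥0∞} (hw : ∀ n, Measurable (w n)) {N : α → ℕ}
    {L : α → ℝ} {X : α → (ℝ × ℝ) × (ℝ × ℝ)} (hN : Measurable N) (hL : Measurable L)
    (hL0 : ∀ a, M.lamBar ≤ L a) (hX : Measurable X) :
    Measurable fun a => M.pauseValue δ w (N a) (L a) (X a) := by
  have hw' : Measurable fun z : ℕ × ℝ => w z.1 z.2 := measurable_from_prod_countable_right hw
  have hgN : Measurable fun a => M.grid δ (N a) := (measurable_grid δ).comp hN
  have hhit : Measurable fun a => M.hitC (L a) (X a).2.1 := by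
    have := (measurable_hitC (M := M)).comp (hL.prodMk hX.snd.fst)
    convert this using 2 with a
    simp [max_eq_right (hL0 a)]
  have hx1 := (hgN.add (hhit.const_mul M.p)).sub hX.snd.snd
  have hx2 := hgN.add (hX.fst.fst.const_mul M.p)
  have hi1 := (measurable_gridIndex (M := M) δ).comp hx1
  have hi2 := (measurable_gridIndex (M := M) δ).comp hx2
  have hs : Measurable (Nat.succ) := measurable_of_countable _
  refine Measurable.ite (measurableSet_le hX.snd.fst (measurable_cumC.comp (hL.prodMk
    (measurable_const.min hX.fst.fst)))) (Measurable.ite (measurableSet_lt hx1 measurable_const)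
    measurable_const ?_) (Measurable.ite (measurableSet_le hX.fst.fst measurable_const) ?_ ?_)
  · refine (M.measurable_disc.comp hhit).mul ((hx1.sub ((measurable_grid δ).comp
      hi1)).ennreal_ofReal.add (hw'.comp (hi1.prodMk ?_)))
    exact (measurable_lamC.comp (hL.prodMk hhit)).add
      (Measurable.ite (measurableSet_le hX.fst.fst hhit) hX.fst.snd measurable_const)
  · refine (M.measurable_disc.comp hX.fst.fst).mul ((hx2.sub ((measurable_grid δ).comp
      hi2)).ennreal_ofReal.add (hw'.comp (hi2.prodMk ?_)))
    exact (measurable_lamC.comp (hL.prodMk hX.fst.fst)).add hX.fst.snd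
  · exact (hw'.comp ((hs.comp hN).prodMk (measurable_lamC.comp
      (hL.prodMk measurable_const)))).const_mul _

end CatModel

namespace CatModel

variable {M : CatModel} {lam δ : ℝ}

/-! ### The operator of `E₀` as an integral with respect to one mark -/

/-- Premiums earned in less than `δ` do not fill a grid cell. This is why `T0` returns to index `n`
after a catastrophe and pays out `p T`. -/
theorem gridIndex_grid_add (hδ : 0 < δ) (n : ℕ) {a : ℝ} (ha : 0 ≤ a) (haδ : a < δ) :
    M.gridIndex δ (M.grid δ n + M.p * a) = n := by
  have hp := M.p_pos
  have e : (M.grid δ n + M.p * a) / (M.p * δ) = n + a / δ := by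
    unfold grid; field_simp
  rw [gridIndex, e, Nat.floor_eq_iff (by positivity)]
  constructor
  · have : 0 ≤ a / δ := by positivity
    linarith
  · have : a / δ < 1 := (div_lt_one hδ).2 haδ
    linarith

theorem grid_nonneg (hδ : 0 ≤ δ) (n : ℕ) : 0 ≤ M.grid δ n := by
  have := M.p_pos
  unfold grid; positivity

/-- The events in `T0` are defined by equalities with a minimum and overlap exactly at ties, and
these are null because the exponential laws have no atoms. -/
theorem ae_mark_ne (lam δ : ℝ) : ∀ᵐ ξ ∂M.mark,
    ξ.1.1 ≠ δ ∧ ξ.2.1 ≠ M.cumC lam δ ∧ ξ.2.1 ≠ M.cumC lam ξ.1.1 := by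
  have hne : ∀ r c : ℝ, ∀ᵐ x ∂expMeasure r, x ≠ c := fun r c => by simp [ae_iff]
  have h1 : ∀ᵐ ξ ∂M.mark, ξ.1.1 ≠ δ :=
    (Measure.quasiMeasurePreserving_fst.comp Measure.quasiMeasurePreserving_fst).ae (hne M.β δ)
  have h2 : ∀ᵐ ξ ∂M.mark, ξ.2.1 ≠ M.cumC lam δ :=
    (Measure.quasiMeasurePreserving_fst.comp Measure.quasiMeasurePreserving_snd).ae (hne 1 _)
  have h3 : ∀ᵐ ξ ∂M.mark, ξ.2.1 ≠ M.cumC lam ξ.1.1 := by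
    have hm : Measurable fun ξ : (ℝ × ℝ) × (ℝ × ℝ) => M.cumC lam ξ.1.1 :=
      measurable_cumC.comp (by fun_prop : Measurable fun ξ : (ℝ × ℝ) × (ℝ × ℝ) => (lam, ξ.1.1))
    have hs : MeasurableSet {ξ : (ℝ × ℝ) × (ℝ × ℝ) | ξ.2.1 = M.cumC lam ξ.1.1} :=
      measurableSet_eq_fun (by fun_prop) hm
    have : M.mark {ξ | ξ.2.1 = M.cumC lam ξ.1.1} = 0 := by
      unfold mark
      rw [Measure.measure_prod_null hs]
      refine Eventually.of_forall fun x => ?_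
      have h0 : ∀ᵐ z ∂((expMeasure 1).prod M.FU), z.1 ≠ M.cumC lam x.1 :=
        Measure.quasiMeasurePreserving_fst.ae (hne 1 _)
      simpa [ae_iff] using h0
    simpa [ae_iff] using this
  filter_upwards [h1, h2, h3] with ξ a b c using ⟨a, b, c⟩

variable {ω : CatOmega}

theorem IsRegular.residual_zero (h : IsRegular ω) (hlam : M.lamBar ≤ lam) :
    M.residual lam 0 ω = ω 0 := by
  simp [residual, h.nextJump_zero, h.nextClaim_zero hlam, jumpTime, claimLevel, jumpSize,
    claimSize, cumIntensity_zero]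

theorem IsRegular.claimTime_zero_le_iff (h : IsRegular ω) (hlam : M.lamBar ≤ lam) {s : ℝ}
    (hs : 0 ≤ s) (hsT : s ≤ (ω 0).1.1) :
    M.claimTime lam 0 ω ≤ s ↔ (ω 0).2.1 ≤ M.cumC lam s := by
  have := h.nextClaim_le_add_iff hlam le_rfl hs (by
    simpa [h.nextJump_zero, jumpTime] using hsT)
  simpa [h.nextClaim_zero hlam, h.residual_zero hlam, h.intensity_zero] using this

theorem IsRegular.hitC_eq (h : IsRegular ω) (hlam : M.lamBar ≤ lam)
    (hle : M.claimTime lam 0 ω ≤ (ω 0).1.1) : M.hitC lam (ω 0).2.1 = M.claimTime lam 0 ω := by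
  have := h.hitC_residual hlam (t := 0) le_rfl (by
    simpa [h.nextClaim_zero hlam, h.nextJump_zero, jumpTime] using hle)
  simpa [h.nextClaim_zero hlam, h.residual_zero hlam, h.intensity_zero] using this

/-- By continuity the level is hit without overshoot: otherwise it would have been reached slightly
earlier. Ties of claims thus become equalities of the exponential amount with a given number, as in
`ae_mark_ne`. -/
theorem IsRegular.cumC_claimTime (h : IsRegular ω) (hlam : M.lamBar ≤ lam)
    (hle : M.claimTime lam 0 ω ≤ (ω 0).1.1) :
    (ω 0).2.1 = M.cumC lam (M.claimTime lam 0 ω) := by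
  have hpos := h.claimTime_pos hlam 0
  refine le_antisymm ((h.claimTime_zero_le_iff hlam hpos.le hle).1 le_rfl) ?_
  by_contra hc
  rw [not_le] at hc
  have hcont : Continuous (M.cumC lam) := by
    unfold cumC; have := M.continuous_decayInt; fun_prop
  have h1 := (hcont.tendsto (M.claimTime lam 0 ω)).eventually_const_lt hc
  obtain ⟨s, ⟨hs1, hs2⟩, hs3⟩ := (((h1.and (lt_mem_nhds hpos)).filter_mono
    nhdsWithin_le_nhds).and (self_mem_nhdsWithin (s := Iio (M.claimTime lam 0 ω)))).exists
  have hs3' : s < M.claimTime lam 0 ω := hs3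
  have := (h.claimTime_zero_le_iff hlam hs2.le (hs3'.le.trans hle)).2 hs1.le
  linarith

theorem lintegral_add_five {Ω : Type*} [MeasurableSpace Ω] {μ : Measure Ω}
    {f₁ f₂ f₃ f₄ f₅ : Ω → ℝ≥0∞} (h₁ : AEMeasurable f₁ μ) (h₂ : AEMeasurable f₂ μ)
    (h₃ : AEMeasurable f₃ μ) (h₄ : AEMeasurable f₄ μ) :
    ∫⁻ x, f₁ x ∂μ + ∫⁻ x, f₂ x ∂μ + ∫⁻ x, f₃ x ∂μ + ∫⁻ x, f₄ x ∂μ + ∫⁻ x, f₅ x ∂μ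
      = ∫⁻ x, f₁ x + f₂ x + f₃ x + f₄ x + f₅ x ∂μ := by
  rw [← lintegral_add_left' h₁, ← lintegral_add_left' (h₁.fun_add h₂),
    ← lintegral_add_left' ((h₁.fun_add h₂).fun_add h₃),
    ← lintegral_add_left' (((h₁.fun_add h₂).fun_add h₃).fun_add h₄)]

/-- At time `0` the residual is coordinate `0`. Off ties the claim, catastrophe and timeout events
are disjoint, so the five summands of `T0` add up to the single integrand `pauseValue`. -/
theorem T0_eq_lintegral_pauseValue (hδ : 0 < δ) (hlam : M.lamBar ≤ lam) {w : ℕ → ℝ → ℝ≥0∞}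
    (hw : ∀ n, Measurable (w n)) (n : ℕ) :
    M.T0 δ w n lam = ∫⁻ ξ, M.pauseValue δ w n lam ξ ∂M.mark := by
  have hw' : Measurable fun z : ℕ × ℝ => w z.1 z.2 := measurable_from_prod_countable_right hw
  have hpv : Measurable (M.pauseValue δ w n lam) := measurable_pauseValue δ hw measurable_const
    measurable_const (fun _ => hlam) measurable_id
  rw [← (M.measurePreserving_apply 0).lintegral_comp hpv]
  have hτ : Measurable fun ω : regularSet => M.claimTime lam 0 (ω : CatOmega) :=
    measurable_claimTime hlam 0 measurable_id
  have hT : Measurable fun ω : regularSet => jumpTime 0 (ω : CatOmega) :=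
    (measurable_jumpTime 0).comp measurable_subtype_coe
  have hY : Measurable fun ω : regularSet => jumpSize 0 (ω : CatOmega) :=
    (measurable_jumpSize 0).comp measurable_subtype_coe
  have hU : Measurable fun ω : regularSet => claimSize 0 (ω : CatOmega) :=
    (measurable_claimSize 0).comp measurable_subtype_coe
  have hmin := (measurable_const (a := δ)).min hT |>.min hτ
  have hx := ((measurable_const (a := M.grid δ n)).add (hτ.const_mul M.p)).sub hU
  have hi := (measurable_gridIndex (M := M) δ).comp hx
  have hE1 : NullMeasurableSet
      {ω | min (min δ (jumpTime 0 ω)) (M.claimTime lam 0 ω) = δ} M.prob :=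
    M.nullMeasurableSet_of_regularSet (measurableSet_eq_fun hmin measurable_const)
  have hE2 : NullMeasurableSet
      {ω | min (min δ (jumpTime 0 ω)) (M.claimTime lam 0 ω) = M.claimTime lam 0 ω ∧
        0 ≤ M.grid δ n + M.p * M.claimTime lam 0 ω - claimSize 0 ω} M.prob :=
    M.nullMeasurableSet_of_regularSet ((measurableSet_eq_fun hmin hτ).inter
      (measurableSet_le measurable_const hx))
  have hE3 : NullMeasurableSet
      {ω | min (min δ (jumpTime 0 ω)) (M.claimTime lam 0 ω) = jumpTime 0 ω} M.prob :=
    M.nullMeasurableSet_of_regularSet (measurableSet_eq_fun hmin hT)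
  have hf2 : AEMeasurable (fun ω => M.disc (M.claimTime lam 0 ω) *
      w (M.gridIndex δ (M.grid δ n + M.p * M.claimTime lam 0 ω - claimSize 0 ω))
        (M.lamC lam (M.claimTime lam 0 ω))) M.prob :=
    M.aemeasurable_of_regularSet ((M.measurable_disc.comp hτ).mul (hw'.comp (hi.prodMk
      (measurable_lamC.comp (measurable_const.prodMk hτ)))))
  have hf3 : AEMeasurable (fun ω => M.disc (jumpTime 0 ω) *
      w n (M.lamC lam (jumpTime 0 ω) + jumpSize 0 ω)) M.prob :=
    M.aemeasurable_of_regularSet ((M.measurable_disc.comp hT).mul ((hw n).comp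
      ((measurable_lamC.comp (measurable_const.prodMk hT)).add hY)))
  have hf4 : AEMeasurable (fun ω => M.disc (M.claimTime lam 0 ω) * ENNReal.ofReal
      (M.grid δ n + M.p * M.claimTime lam 0 ω - claimSize 0 ω - M.grid δ (M.gridIndex δ
        (M.grid δ n + M.p * M.claimTime lam 0 ω - claimSize 0 ω)))) M.prob :=
    M.aemeasurable_of_regularSet ((M.measurable_disc.comp hτ).mul
      (hx.sub ((measurable_grid δ).comp hi)).ennreal_ofReal)
  have e1 : M.prob {ω | min (min δ (jumpTime 0 ω)) (M.claimTime lam 0 ω) = δ} * M.disc δ *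
      w (n + 1) (M.lamC lam δ) = ∫⁻ _ in
        {ω | min (min δ (jumpTime 0 ω)) (M.claimTime lam 0 ω) = δ},
        M.disc δ * w (n + 1) (M.lamC lam δ) ∂M.prob := by
    rw [setLIntegral_const]; ring
  unfold T0
  simp only
  change M.prob {ω | min (min δ (jumpTime 0 ω)) (M.claimTime lam 0 ω) = δ} * M.disc δ *
      w (n + 1) (M.lamC lam δ) + _ + _ + _ + _ = _
  rw [e1, ← lintegral_indicator₀ hE1, ← lintegral_indicator₀ hE2, ← lintegral_indicator₀ hE3,
    ← lintegral_indicator₀ hE2, ← lintegral_indicator₀ hE3]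
  refine (lintegral_add_five (aemeasurable_const.indicator₀ hE1) (hf2.indicator₀ hE2)
    (hf3.indicator₀ hE3) (hf4.indicator₀ hE2)).trans ?_
  refine lintegral_congr_ae ?_
  filter_upwards [M.ae_isRegular,
    (M.measurePreserving_apply 0).quasiMeasurePreserving.ae (ae_mark_ne lam δ)]
    with ω hω ⟨n1, n2, n3⟩
  have hTa : jumpTime 0 ω = (ω 0).1.1 := by simp [jumpTime]
  have ha := hω.wait_pos 0
  have hτp := hω.claimTime_pos hlam 0
  simp only [hTa, indicator_apply, mem_ofPred_eq]
  set a := (ω 0).1.1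
  set τ := M.claimTime lam 0 ω with hτd
  have hmn : (0 : ℝ) ≤ min δ a := le_min hδ.le ha.le
  have hiff := hω.claimTime_zero_le_iff hlam hmn (min_le_right _ _)
  have hU0 : claimSize 0 ω = (ω 0).2.2 := rfl
  have hY0 : jumpSize 0 ω = (ω 0).1.2 := rfl
  unfold pauseValue
  rw [← hτd] at hiff
  by_cases h1 : τ ≤ min δ a
  · have hτa : τ ≤ a := h1.trans (min_le_right _ _)
    have hτδ : τ ≤ δ := h1.trans (min_le_left _ _)
    have hcum := hω.cumC_claimTime hlam hτa
    rw [← hτd] at hcum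
    have hτa' : τ ≠ a := fun h => n3 (by rw [hcum, h])
    have hτδ' : τ ≠ δ := fun h => n2 (by rw [hcum, h])
    rw [if_pos (hiff.1 h1), hω.hitC_eq hlam hτa, ← hτd, min_eq_right h1, if_neg hτδ', if_neg hτa',
      if_neg hτa', if_neg (not_le.2 (lt_of_le_of_ne hτa hτa')), hU0]
    by_cases h2 : M.grid δ n + M.p * τ - (ω 0).2.2 < 0
    · rw [if_pos h2, if_neg fun h => absurd h.2 (not_le.2 h2),
        if_neg fun h => absurd h.2 (not_le.2 h2)]
      simp
    · rw [if_neg h2, if_pos ⟨rfl, not_lt.1 h2⟩, if_pos ⟨rfl, not_lt.1 h2⟩]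
      simp only [zero_add, add_zero, mul_add, disc]
      rw [add_comm]
  · rw [if_neg fun h => h1 (hiff.2 h)]
    rw [not_le] at h1
    have hne : ¬ min δ a = τ := h1.ne
    by_cases h2 : a ≤ δ
    · have h2' : a < δ := lt_of_le_of_ne h2 n1
      rw [min_eq_right h2] at hne
      rw [if_pos h2, min_eq_left h1.le, min_eq_right h2, if_neg n1, if_neg fun h => hne h.1,
        if_pos rfl, if_neg fun h : _ ∧ _ => hne h.1, if_pos rfl, gridIndex_grid_add hδ n ha.le h2', hY0,
        add_sub_cancel_left]
      simp only [zero_add, add_zero, mul_add, disc]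
      rw [add_comm]
    · have h2' : δ < a := not_le.1 h2
      rw [min_eq_left h2'.le] at hne
      rw [if_neg h2, min_eq_left h1.le, min_eq_left h2'.le, if_pos rfl, if_neg fun h => hne h.1,
        if_neg h2'.ne, if_neg fun h : _ ∧ _ => hne h.1, if_neg h2'.ne]
      simp only [add_zero]

/-! ### One control action -/

/-- The operator of a control action. -/
noncomputable def actionValue (M : CatModel) (δ : ℝ) (w : ℕ → ℝ → ℝ≥0∞) :
    CatAction → ℕ → ℝ → ℝ≥0∞
  | .pause, n, lam => M.T0 δ w n lam
  | .pay, n, lam => M.T1 δ w n lam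
  | .finish, n, _ => M.TF δ n

/-- Discounted dividends paid by the `k`-th control action. -/
noncomputable def discPayment (M : CatModel) (δ lam : ℝ) (π : CatRule) (n k : ℕ) (ω : CatOmega) :
    ℝ≥0∞ :=
  M.disc (M.payment δ lam π n ω k).1 * ENNReal.ofReal (M.payment δ lam π n ω k).2

open Classical in
/-- The state at which the `k`-th control action is chosen, provided that this action is `E₀`. -/
noncomputable def pauseState (M : CatModel) (δ lam : ℝ) (π : CatRule) (n k : ℕ) (ω : CatOmega) :
    Option (ℝ × ℕ) :=
  (M.state δ lam π n ω k).bind fun z =>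
    if M.chosen lam π ω k z.1 z.2 = .pause then some z else none

theorem pauseState_eq_some {π : CatRule} {n k m : ℕ} {t : ℝ} :
    M.pauseState δ lam π n k ω = some (t, m) ↔
      M.state δ lam π n ω k = some (t, m) ∧ M.chosen lam π ω k t m = .pause := by
  unfold pauseState
  rcases M.state δ lam π n ω k with _ | ⟨s, l⟩
  · simp
  · simp only [Option.bind_some, Option.some.injEq, Prod.mk.injEq]
    split_ifs with h
    · simp only [Option.some.injEq, Prod.mk.injEq]
      constructor
      · rintro ⟨rfl, rfl⟩; exact ⟨⟨rfl, rfl⟩, h⟩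
      · exact fun h => h.1
    · simp only [false_iff]
      rintro ⟨⟨rfl, rfl⟩, h'⟩
      exact h h'

open Classical in
theorem elim_pauseState {π : CatRule} {n k : ℕ} (F : ℝ × ℕ → ℝ≥0∞) :
    (M.pauseState δ lam π n k ω).elim 0 F = (M.state δ lam π n ω k).elim 0 fun z =>
      if M.chosen lam π ω k z.1 z.2 = .pause then F z else 0 := by
  unfold pauseState
  rcases M.state δ lam π n ω k with _ | ⟨s, l⟩
  · rfl
  · simp only [Option.bind_some, Option.elim_some]
    split_ifs <;> rfl

/-- Discounted value of the dividends of the `k`-th control action and of the value `w` of the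
subsequent state, as seen when the action is chosen. -/
noncomputable def chosenValue (M : CatModel) (δ lam : ℝ) (π : CatRule) (n : ℕ)
    (w : ℕ → ℝ → ℝ≥0∞) (k : ℕ) (ω : CatOmega) : ℝ≥0∞ :=
  (M.state δ lam π n ω k).elim 0 fun z => M.disc z.1 *
    M.actionValue δ w (M.chosen lam π ω k z.1 z.2) z.2 (M.intensity lam z.1 ω)

theorem stateValue_eq_elim (w : ℕ → ℝ → ℝ≥0∞) (o : Option (ℝ × ℕ)) : M.stateValue lam ω w o =
    o.elim 0 fun z => M.disc z.1 * w z.2 (M.intensity lam z.1 ω) := by cases o <;> rfl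

theorem aemeasurable_stateValue (hδ : 0 < δ) (hlam : M.lamBar ≤ lam) {π : CatRule}
    (hπ : ∀ k, Measurable (π k)) (n k : ℕ) {w : ℕ → ℝ → ℝ≥0∞} (hw : ∀ n, Measurable (w n)) :
    AEMeasurable (fun ω => M.stateValue lam ω w (M.state δ lam π n ω k)) M.prob := by
  have hw' : Measurable fun z : ℕ × ℝ => w z.1 z.2 := measurable_from_prod_countable_right hw
  have ih := measurable_encodeState hδ hlam hπ n k
  have hp : Measurable fun n : ℕ => n - 1 := measurable_of_countable _
  simp only [stateValue_eq_elim]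
  refine M.aemeasurable_of_regularSet (measurable_elim_of_encodeState
    (F := fun t m (ω : regularSet) => M.disc t * w m (M.intensity lam t ω)) ih 0 ?_)
  exact (M.measurable_disc.comp ih.fst).mul (hw'.comp ((hp.comp ih.snd).prodMk
    (measurable_intensity lam ih.fst measurable_id)))

theorem aemeasurable_discPayment (hδ : 0 < δ) (hlam : M.lamBar ≤ lam) {π : CatRule}
    (hπ : ∀ k, Measurable (π k)) (n k : ℕ) :
    AEMeasurable (M.discPayment δ lam π n k) M.prob := by
  have h := measurable_payment hδ hlam hπ n k
  exact M.aemeasurable_of_regularSet ((M.measurable_disc.comp h.fst).mul h.snd.ennreal_ofReal)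

open Classical in
-- The dynamic programming identity for one action, valid for every measurable rule and every
-- measurable `w`. Split according to the action: for `E₀` apply `step_pause`, the strong Markov
-- property and `T0_eq_lintegral_pauseValue`; the other two actions involve no new randomness.
theorem lintegral_discPayment_add (hδ : 0 < δ) (hlam : M.lamBar ≤ lam) {π : CatRule}
    (hπ : ∀ k, Measurable (π k)) (n k : ℕ) {w : ℕ → ℝ → ℝ≥0∞} (hw : ∀ n, Measurable (w n)) :
    ∫⁻ ω, M.discPayment δ lam π n k ω ∂M.prob
        + ∫⁻ ω, M.stateValue lam ω w (M.state δ lam π n ω (k + 1)) ∂M.prob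
      = ∫⁻ ω, M.chosenValue δ lam π n w k ω ∂M.prob := by
  have hw' : Measurable fun z : ℕ × ℝ => w z.1 z.2 := measurable_from_prod_countable_right hw
  have ih := measurable_encodeState hδ hlam hπ n k
  have hp : Measurable fun n : ℕ => n - 1 := measurable_of_countable _
  have hN := hp.comp ih.snd
  have hA := measurable_chosen hlam (hπ k) ih.fst measurable_id hN
  have hI := measurable_intensity (M := M) lam ih.fst measurable_id
  have h0 := encodeState_nonneg (M := M) hδ hlam π n k
  have hsA : ∀ c, MeasurableSet {ω : regularSet | M.chosen lam π ω k
      (encodeState (M.state δ lam π n ω k)).1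
      ((encodeState (M.state δ lam π n ω k)).2 - 1) = c} := fun c =>
    hA (t := {c}) MeasurableSpace.measurableSet_top
  have hpvI : Measurable fun z : ℕ × ℝ =>
      ∫⁻ ζ, M.pauseValue δ w z.1 (max M.lamBar z.2) ζ ∂M.mark :=
    Measurable.lintegral_prod_right' (f := fun y : (ℕ × ℝ) × ((ℝ × ℝ) × (ℝ × ℝ)) =>
      M.pauseValue δ w y.1.1 (max M.lamBar y.1.2) y.2) (measurable_pauseValue δ hw
      (measurable_fst.comp measurable_fst)
      (measurable_const.max (measurable_snd.comp measurable_fst)) (fun _ => le_max_left _ _)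
      measurable_snd)
  set g : ℕ → ℝ → (ℝ × ℝ) × (ℝ × ℝ) → ℝ≥0∞ := M.pauseValue δ w
  have hg : ∀ n l, M.lamBar ≤ l → Measurable (g n l) := fun n l hl =>
    measurable_pauseValue δ hw measurable_const measurable_const (fun _ => hl) measurable_id
  -- The part due to `E₁` and `E_F`, which is the same before and after averaging over the residual.
  set Q : CatOmega → ℝ≥0∞ := fun ω => (M.state δ lam π n ω k).elim 0 fun z =>
    if M.chosen lam π ω k z.1 z.2 = .pause then 0 else
    if M.chosen lam π ω k z.1 z.2 = .pay then M.disc z.1 * M.T1 δ w z.2 (M.intensity lam z.1 ω)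
    else M.disc z.1 * M.TF δ z.2 with hQ
  have hdT := M.measurable_disc.comp ih.fst
  have hQm : AEMeasurable Q M.prob := by
    refine M.aemeasurable_of_regularSet (measurable_elim_of_encodeState
      (F := fun t m (ω : regularSet) => if M.chosen lam π ω k t m = .pause then 0 else
        if M.chosen lam π ω k t m = .pay then M.disc t * M.T1 δ w m (M.intensity lam t ω)
        else M.disc t * M.TF δ m) ih 0 ?_)
    refine Measurable.ite (hsA _) measurable_const (Measurable.ite (hsA _) ?_ ?_)
    · exact hdT.mul ((hw'.comp ((hp.comp hN).prodMk hI)).add_const _)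
    · exact hdT.mul ((measurable_grid δ).comp hN).ennreal_ofReal
  have hf : AEMeasurable (fun ω => (M.pauseState δ lam π n k ω).elim 0 fun z => M.disc z.1 *
      g z.2 (M.intensity lam z.1 ω) (M.residual lam z.1 ω)) M.prob := by
    simp only [elim_pauseState]
    refine M.aemeasurable_of_regularSet (measurable_elim_of_encodeState
      (F := fun t m (ω : regularSet) => if M.chosen lam π ω k t m = .pause then
        M.disc t * g m (M.intensity lam t ω) (M.residual lam t ω) else 0) ih 0 ?_)
    refine Measurable.ite (hsA _) (hdT.mul ?_) measurable_const
    exact measurable_pauseValue δ hw hN hI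
      (fun ω => (isRegular_coe ω).lamBar_le_intensity hlam _)
      (measurable_residual hlam ih.fst h0 measurable_id)
  have hh : AEMeasurable (fun ω => (M.pauseState δ lam π n k ω).elim 0 fun z => M.disc z.1 *
      ∫⁻ ζ, g z.2 (M.intensity lam z.1 ω) ζ ∂M.mark) M.prob := by
    simp only [elim_pauseState]
    refine M.aemeasurable_of_regularSet (measurable_elim_of_encodeState
      (F := fun t m (ω : regularSet) => if M.chosen lam π ω k t m = .pause then
        M.disc t * ∫⁻ ζ, g m (M.intensity lam t ω) ζ ∂M.mark else 0) ih 0 ?_)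
    refine Measurable.ite (hsA _) (hdT.mul ?_) measurable_const
    convert hpvI.comp (hN.prodMk hI) using 2 with ω
    simp only [Function.comp_apply, id_eq]
    rw [max_eq_right ((isRegular_coe ω).lamBar_le_intensity hlam _)]
  have hset : ∀ i j, NullMeasurableSet (M.waitSet lam (M.pauseState δ lam π n k) i j) M.prob := by
    intro i j
    refine M.nullMeasurableSet_of_regularSet ?_
    have : {ω : regularSet | (ω : CatOmega) ∈ M.waitSet lam (M.pauseState δ lam π n k) i j} =
        {ω : regularSet | (encodeState (M.state δ lam π n ω k)).2 ≠ 0} ∩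
        {ω : regularSet | M.chosen lam π ω k (encodeState (M.state δ lam π n ω k)).1
          ((encodeState (M.state δ lam π n ω k)).2 - 1) = .pause} ∩
        {ω : regularSet | nextJump (encodeState (M.state δ lam π n ω k)).1 (ω : CatOmega) = i} ∩
        {ω : regularSet | M.nextClaim lam (encodeState (M.state δ lam π n ω k)).1 (ω : CatOmega)
          = j} := by
      ext ω
      simp only [waitSet, pauseState_eq_some, mem_ofPred_eq, mem_inter_iff]
      rcases hst : M.state δ lam π n (ω : CatOmega) k with _ | ⟨t, m⟩
      · simp [encodeState]
      · simp only [Option.some.injEq, Prod.mk.injEq, encodeState]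
        constructor
        · rintro ⟨_, _, ⟨⟨rfl, rfl⟩, h1⟩, h2, h3⟩
          exact ⟨⟨⟨by omega, by simpa using h1⟩, h2⟩, h3⟩
        · rintro ⟨⟨⟨_, h1⟩, h2⟩, h3⟩
          exact ⟨t, m, ⟨⟨rfl, rfl⟩, by simpa using h1⟩, h2, h3⟩
    rw [this]
    exact (((ih.snd (measurableSet_singleton 0).compl).inter (hsA _)).inter
      (measurable_nextJump ih.fst measurable_id (measurableSet_singleton i))).inter
      (measurable_nextClaim hlam ih.fst h0 measurable_id (measurableSet_singleton j))
  have hD0 : ∀ ω t m, IsRegular ω → M.pauseState δ lam π n k ω = some (t, m) → 0 ≤ t :=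
    fun ω t m hω h => hω.state_nonneg hδ hlam (pauseState_eq_some.1 h).1
  have hD : ∀ ω ω' t m, IsRegular ω → M.pauseState δ lam π n k ω = some (t, m) →
      M.SameUntil lam t ω ω' → M.pauseState δ lam π n k ω' = some (t, m) := by
    intro ω ω' t m hω h hs
    rw [pauseState_eq_some] at h ⊢
    refine ⟨hω.state_congr hδ hlam h.1 hs, ?_⟩
    rw [← h.2]
    unfold chosen
    rw [hs.observed, hs.intensity]
  have key := M.lintegral_residual hlam hD0 hD g hg hset hf hh
  rw [← lintegral_add_left' (aemeasurable_discPayment hδ hlam hπ n k)]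
  calc _ = ∫⁻ ω, ((M.pauseState δ lam π n k ω).elim 0 fun z => M.disc z.1 *
        g z.2 (M.intensity lam z.1 ω) (M.residual lam z.1 ω)) + Q ω ∂M.prob := by
        refine lintegral_congr_ae ?_
        filter_upwards [M.ae_isRegular] with ω hω
        rw [elim_pauseState, discPayment, payment, state]
        simp only [hQ]
        rcases hst : M.state δ lam π n ω k with _ | ⟨t, m⟩
        · simp [stateValue]
        · have ht := hω.state_nonneg hδ hlam hst
          simp only [Option.elim_some]
          cases hc : M.chosen lam π ω k t m with
          | pause =>
            simp only [if_true, add_zero]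
            exact hω.step_pause hδ hlam ht m w
          | pay =>
            simp [step, stateValue, T1, mul_comm M.p δ]
            ring
          | finish => simp [step, stateValue, TF]
    _ = ∫⁻ ω, ((M.pauseState δ lam π n k ω).elim 0 fun z => M.disc z.1 *
        ∫⁻ ζ, g z.2 (M.intensity lam z.1 ω) ζ ∂M.mark) + Q ω ∂M.prob := by
        rw [lintegral_add_left' hf, lintegral_add_left' hh, key]
    _ = _ := by
        refine lintegral_congr_ae ?_
        filter_upwards [M.ae_isRegular] with ω hω
        rw [elim_pauseState, chosenValue]
        simp only [hQ]
        rcases hst : M.state δ lam π n ω k with _ | ⟨t, m⟩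
        · simp
        · simp only [Option.elim_some]
          cases hc : M.chosen lam π ω k t m with
          | pause =>
            simp only [if_true, add_zero, actionValue]
            rw [T0_eq_lintegral_pauseValue hδ (hω.lamBar_le_intensity hlam t) hw]
          | pay => simp [actionValue]
          | finish => simp [actionValue]

end CatModel

namespace CatModel

variable {M : CatModel} {lam δ : ℝ} {ω : CatOmega}

/-! ### Growth of the surplus and of the decision times -/

theorem grid_gridIndex_le (hδ : 0 < δ) {x : ℝ} (hx : 0 ≤ x) : M.grid δ (M.gridIndex δ x) ≤ x :=
  (M.isGreatest_grid_gridIndex hδ hx).1.2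

theorem grid_succ (n : ℕ) : M.grid δ (n + 1) = M.grid δ n + M.p * δ := by
  simp only [grid, Nat.cast_add, Nat.cast_one]; ring

theorem grid_pred_add {n : ℕ} (hn : n ≠ 0) : M.grid δ (n - 1) + M.p * δ = M.grid δ n := by
  rw [← grid_succ, Nat.sub_add_cancel (Nat.one_le_iff_ne_zero.2 hn)]

theorem gridIndex_le_succ (hδ : 0 < δ) {n : ℕ} {x : ℝ} (hx : x ≤ M.grid δ n + M.p * δ) :
    M.gridIndex δ x ≤ n + 1 := by
  have h : 0 < M.p * δ := mul_pos M.p_pos hδ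
  unfold gridIndex
  refine Nat.floor_le_of_le ?_
  rw [div_le_iff₀ h, Nat.cast_add, Nat.cast_one]
  unfold grid at hx
  linarith

/-- The surplus grows at most at rate `p`, the index by at most one. The last bound is a clock: `E₀`
ends with a catastrophe, a claim or the lapse of `δ`, each of which adds at least one to the sum. -/
theorem IsRegular.step_pause_bounds (h : IsRegular ω) (hδ : 0 < δ) (hlam : M.lamBar ≤ lam)
    {t s : ℝ} (ht : 0 ≤ t) {n m : ℕ} (hs : (M.step δ lam ω t n .pause).2 = some (s, m)) :
    M.grid δ m ≤ M.grid δ n + M.p * (s - t) ∧ m ≤ n + 1 ∧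
      (nextJump t ω + M.nextClaim lam t ω + t / δ : ℝ) + 1 ≤
        nextJump s ω + M.nextClaim lam s ω + s / δ := by
  have hp := M.p_pos
  have hts := h.le_of_step hδ hlam ht hs
  have hJ : (nextJump t ω : ℝ) ≤ nextJump s ω := by exact_mod_cast h.nextJump_mono hts
  have hC : (M.nextClaim lam t ω : ℝ) ≤ M.nextClaim lam s ω := by
    exact_mod_cast h.nextClaim_mono hlam ht hts
  have hD : t / δ ≤ s / δ := by gcongr
  have hg := grid_nonneg (M := M) hδ.le n
  simp only [step] at hs
  split_ifs at hs with h1 h2 h3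
  · simp only [Option.some.injEq, Prod.mk.injEq] at hs
    obtain ⟨rfl, rfl⟩ := hs
    have hU : 0 < claimSize (M.nextClaim lam t ω) ω := h.claim_pos _
    set τ := M.claimTime lam (M.nextClaim lam t ω) ω with hτ
    have hτδ : τ - t ≤ δ := by linarith [h1.trans (min_le_left _ _)]
    have := mul_le_mul_of_nonneg_left hτδ hp.le
    refine ⟨?_, gridIndex_le_succ hδ (by linarith), ?_⟩
    · have := grid_gridIndex_le (M := M) hδ (not_lt.1 h2)
      linarith
    · have h4 : M.nextClaim lam t ω < M.nextClaim lam τ ω := by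
        rw [← not_le, ← h.lt_claimTime_iff hlam (ht.trans hts), ← hτ]
        exact lt_irrefl _
      have : (M.nextClaim lam t ω : ℝ) + 1 ≤ M.nextClaim lam τ ω := by exact_mod_cast h4
      linarith
  · simp only [Option.some.injEq, Prod.mk.injEq] at hs
    obtain ⟨rfl, rfl⟩ := hs
    set T := jumpTime (nextJump t ω) ω with hT
    have hTδ : T - t ≤ δ := by linarith
    have := mul_le_mul_of_nonneg_left hTδ hp.le
    have h0 := mul_nonneg hp.le (sub_nonneg.2 hts)
    refine ⟨grid_gridIndex_le hδ (by linarith), gridIndex_le_succ hδ (by linarith), ?_⟩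
    have h4 : nextJump t ω < nextJump T ω := h.jumpTime_le_iff.1 le_rfl
    have : (nextJump t ω : ℝ) + 1 ≤ nextJump T ω := by exact_mod_cast h4
    linarith
  · simp only [Option.some.injEq, Prod.mk.injEq] at hs
    obtain ⟨rfl, rfl⟩ := hs
    refine ⟨by rw [grid_succ, add_sub_cancel_left], le_rfl, ?_⟩
    have : (t + δ) / δ = t / δ + 1 := by field_simp
    linarith

theorem IsRegular.grid_state_le (h : IsRegular ω) (hδ : 0 < δ) (hlam : M.lamBar ≤ lam)
    {π : CatRule} {n k m : ℕ} {t : ℝ}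
    (hs : M.state δ lam π n ω k = some (t, m)) : M.grid δ m ≤ M.grid δ n + M.p * t := by
  induction k generalizing t m with
  | zero =>
    simp only [state, Option.some.injEq, Prod.mk.injEq] at hs
    obtain ⟨rfl, rfl⟩ := hs
    simp
  | succ k ih =>
    rw [state] at hs
    split at hs
    · simp at hs
    · next s l hk =>
      have h0 := h.state_nonneg hδ hlam hk
      have hl := ih hk
      cases hc : M.chosen lam π ω k s l with
      | finish => simp [hc, step] at hs
      | pay =>
        simp only [hc, step, Option.some.injEq, Prod.mk.injEq] at hs
        obtain ⟨rfl, rfl⟩ := hs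
        refine le_trans ?_ hl
        have hpd : 0 ≤ M.p * δ := mul_nonneg M.p_pos.le hδ.le
        have : ((l - 1 : ℕ) : ℝ) ≤ l := by exact_mod_cast Nat.sub_le l 1
        have := mul_le_mul_of_nonneg_right this hpd
        simpa [grid, mul_assoc] using this
      | pause =>
        rw [hc] at hs
        have := (h.step_pause_bounds hδ hlam h0 hs).1
        linarith

/-- A potential argument: `E₁` leaves `k + m` unchanged, since it lowers the index by one, while
`E₀` raises it by at most two and advances the clock by at least one. -/
theorem IsRegular.index_add_le (h : IsRegular ω) (hδ : 0 < δ) (hlam : M.lamBar ≤ lam)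
    {π : CatRule} {n : ℕ} (hpay : ∀ k t m, M.state δ lam π n ω k = some (t, m) →
      M.chosen lam π ω k t m = .pay → 0 < m) {k m : ℕ} {t : ℝ}
    (hs : M.state δ lam π n ω k = some (t, m)) :
    (k + m : ℝ) ≤ n + 2 * (nextJump t ω + M.nextClaim lam t ω + t / δ) := by
  induction k generalizing t m with
  | zero =>
    simp only [state, Option.some.injEq, Prod.mk.injEq] at hs
    obtain ⟨rfl, rfl⟩ := hs
    simp only [CharP.cast_eq_zero, zero_add, zero_div, add_zero, le_add_iff_nonneg_right]
    positivity
  | succ k ih =>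
    rw [state] at hs
    split at hs
    · simp at hs
    · next s l hk =>
      have h0 := h.state_nonneg hδ hlam hk
      have hl := ih hk
      cases hc : M.chosen lam π ω k s l with
      | finish => simp [hc, step] at hs
      | pay =>
        have hl0 := hpay k s l hk hc
        simp only [hc, step, Option.some.injEq, Prod.mk.injEq] at hs
        obtain ⟨rfl, rfl⟩ := hs
        rw [Nat.cast_sub (by omega : 1 ≤ l)]
        push_cast
        linarith
      | pause =>
        rw [hc] at hs
        obtain ⟨_, h1, h2⟩ := h.step_pause_bounds hδ hlam h0 hs
        have : (m : ℝ) ≤ l + 1 := by exact_mod_cast h1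
        push_cast
        linarith

/-- Decision times do not accumulate: only finitely many points occur by time `b`, so `index_add_le`
bounds the number of actions chosen by then. -/
theorem IsRegular.eventually_lt_time (h : IsRegular ω) (hδ : 0 < δ) (hlam : M.lamBar ≤ lam)
    {π : CatRule} {n : ℕ} (hpay : ∀ k t m, M.state δ lam π n ω k = some (t, m) →
      M.chosen lam π ω k t m = .pay → 0 < m) (b : ℝ) :
    ∀ᶠ k in atTop, ∀ t m, M.state δ lam π n ω k = some (t, m) → b < t := by
  obtain ⟨N, hN⟩ := exists_nat_gt (n + 2 * (nextJump b ω + M.nextClaim lam b ω + b / δ) : ℝ)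
  filter_upwards [eventually_ge_atTop N] with k hk t m hs
  by_contra hc
  rw [not_lt] at hc
  have h0 := h.state_nonneg hδ hlam hs
  have h1 := h.index_add_le hδ hlam hpay hs
  have hJ : (nextJump t ω : ℝ) ≤ nextJump b ω := by exact_mod_cast h.nextJump_mono hc
  have hC : (M.nextClaim lam t ω : ℝ) ≤ M.nextClaim lam b ω := by
    exact_mod_cast h.nextClaim_mono hlam h0 hc
  have hD : t / δ ≤ b / δ := by gcongr
  have hk' : (N : ℝ) ≤ k := by exact_mod_cast hk
  have : (0 : ℝ) ≤ m := Nat.cast_nonneg m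
  linarith

/-! ### The bound `x + p / q` -/

/-- With `K = p / q` the term `K * q * s` is the premium income `p s`; the rate is left free so that
`q / 2` can be used later. -/
theorem exp_mul_add_le {q K G s : ℝ} (hq : 0 ≤ q) (hK : 0 ≤ K) (hG : 0 ≤ G) (hs : 0 ≤ s) :
    Real.exp (-(q * s)) * (K + (G + K * q * s)) ≤ K + G := by
  have h1 : q * s + 1 ≤ Real.exp (q * s) := Real.add_one_le_exp _
  have h2 : Real.exp (-(q * s)) * Real.exp (q * s) = 1 := by rw [← Real.exp_add]; simp
  have h3 : K + (G + K * q * s) ≤ (K + G) * Real.exp (q * s) := by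
    have := mul_le_mul_of_nonneg_left h1 (add_nonneg hK hG)
    have := mul_nonneg hG (mul_nonneg hq hs)
    nlinarith
  calc _ ≤ Real.exp (-(q * s)) * ((K + G) * Real.exp (q * s)) :=
        mul_le_mul_of_nonneg_left h3 (Real.exp_nonneg _)
    _ = (K + G) * (Real.exp (-(q * s)) * Real.exp (q * s)) := by ring
    _ = K + G := by rw [h2, mul_one]

theorem disc_mul_le (M : CatModel) {G s x : ℝ} (hG : 0 ≤ G) (hs : 0 ≤ s)
    (hx : x ≤ G + M.p * s) :
    M.disc s * ENNReal.ofReal (M.p / M.q + x) ≤ ENNReal.ofReal (M.p / M.q + G) := by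
  have hq := M.q_pos
  have hK : 0 ≤ M.p / M.q := div_nonneg M.p_pos.le hq.le
  rw [disc, ← ENNReal.ofReal_mul (Real.exp_nonneg _)]
  refine ENNReal.ofReal_le_ofReal (le_trans ?_ (exp_mul_add_le hq.le hK hG hs))
  refine mul_le_mul_of_nonneg_left ?_ (Real.exp_nonneg _)
  rw [div_mul_cancel₀ _ hq.ne']
  linarith

/-- The function `x + p / q` on the grid. -/
noncomputable def growthBound (M : CatModel) (δ : ℝ) (n : ℕ) (_ : ℝ) : ℝ≥0∞ :=
  ENNReal.ofReal (M.p / M.q + M.grid δ n)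

theorem pauseValue_growthBound_le (hδ : 0 < δ) (n : ℕ) {ξ : (ℝ × ℝ) × (ℝ × ℝ)}
    (ha : 0 < ξ.1.1) (hu : 0 < ξ.2.2) :
    M.pauseValue δ (M.growthBound δ) n lam ξ ≤ M.growthBound δ n lam := by
  have hp := M.p_pos
  have hK : 0 ≤ M.p / M.q := div_nonneg hp.le M.q_pos.le
  have hg := grid_nonneg (M := M) hδ.le n
  -- The excess paid out and the bound at the grid point below recombine to the bound at `x`, so
  -- rounding down loses nothing.
  have hcomb : ∀ {x : ℝ}, 0 ≤ x → ENNReal.ofReal (x - M.grid δ (M.gridIndex δ x)) +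
      ENNReal.ofReal (M.p / M.q + M.grid δ (M.gridIndex δ x)) =
      ENNReal.ofReal (M.p / M.q + x) := by
    intro x hx
    rw [← ENNReal.ofReal_add (sub_nonneg.2 (grid_gridIndex_le hδ hx))
      (add_nonneg hK (grid_nonneg hδ.le _))]
    congr 1; ring
  unfold pauseValue growthBound
  split_ifs with h1 h2 h3
  · simp
  · rw [hcomb (not_lt.1 h2)]
    exact M.disc_mul_le hg (Real.sInf_nonneg fun _ hx => hx.1) (by linarith)
  · rw [hcomb (add_nonneg hg (mul_nonneg hp.le ha.le))]
    exact M.disc_mul_le hg ha.le le_rfl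
  · exact M.disc_mul_le hg hδ.le (grid_succ n).le

end CatModel

namespace CatModel

variable {M : CatModel} {lam δ : ℝ} {ω : CatOmega}

/-! ### Monotonicity of the operators -/

theorem T0_mono (hlam : M.lamBar ≤ lam) {w w' : ℕ → ℝ → ℝ≥0∞}
    (h : ∀ n l, M.lamBar ≤ l → w n l ≤ w' n l) (n : ℕ) : M.T0 δ w n lam ≤ M.T0 δ w' n lam := by
  have hl := M.lamBar_le_lamC hlam
  unfold T0
  refine add_le_add_left (add_le_add_left (add_le_add (add_le_add ?_ ?_) ?_) _) _
  · exact mul_le_mul_right (h _ _ (hl _)) _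
  · exact lintegral_mono fun ω => mul_le_mul_right (h _ _ (hl _)) _
  · refine lintegral_mono_ae (ae_restrict_of_ae ?_)
    filter_upwards [M.ae_isRegular] with ω hω
    refine mul_le_mul_right (h _ _ ?_) _
    have : 0 < jumpSize 0 ω := hω.jump_pos 0
    linarith [hl (jumpTime 0 ω)]

theorem T1_mono (hlam : M.lamBar ≤ lam) {w w' : ℕ → ℝ → ℝ≥0∞}
    (h : ∀ n l, M.lamBar ≤ l → w n l ≤ w' n l) (n : ℕ) : M.T1 δ w n lam ≤ M.T1 δ w' n lam :=
  add_le_add_left (h _ _ hlam) _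

theorem T_le {w : ℕ → ℝ → ℝ≥0∞} {n : ℕ} {b : ℝ≥0∞} (h0 : M.T0 δ w n lam ≤ b)
    (h1 : n ≠ 0 → M.T1 δ w n lam ≤ b) (hF : M.TF δ n ≤ b) : M.T δ w n lam ≤ b := by
  unfold T
  split_ifs with hn
  · exact max_le h0 hF
  · exact max_le (max_le h0 (h1 hn)) hF

theorem T0_le_T (w : ℕ → ℝ → ℝ≥0∞) (n : ℕ) : M.T0 δ w n lam ≤ M.T δ w n lam := by
  unfold T; split_ifs <;> simp

theorem T1_le_T (w : ℕ → ℝ → ℝ≥0∞) {n : ℕ} (hn : n ≠ 0) : M.T1 δ w n lam ≤ M.T δ w n lam := by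
  unfold T; simp [hn]

theorem TF_le_T (w : ℕ → ℝ → ℝ≥0∞) (n : ℕ) : M.TF δ n ≤ M.T δ w n lam := by
  unfold T; split_ifs <;> simp

theorem T_mono (hlam : M.lamBar ≤ lam) {w w' : ℕ → ℝ → ℝ≥0∞}
    (h : ∀ n l, M.lamBar ≤ l → w n l ≤ w' n l) (n : ℕ) : M.T δ w n lam ≤ M.T δ w' n lam :=
  T_le ((T0_mono hlam h n).trans (T0_le_T _ _))
    (fun hn => (T1_mono hlam h n).trans (T1_le_T _ hn)) (TF_le_T _ _)

theorem T_congr (hlam : M.lamBar ≤ lam) {w w' : ℕ → ℝ → ℝ≥0∞}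
    (h : ∀ n l, M.lamBar ≤ l → w n l = w' n l) (n : ℕ) : M.T δ w n lam = M.T δ w' n lam :=
  le_antisymm (T_mono hlam (fun n l hl => (h n l hl).le) n)
    (T_mono hlam (fun n l hl => (h n l hl).ge) n)

theorem T0_congr (hlam : M.lamBar ≤ lam) {w w' : ℕ → ℝ → ℝ≥0∞}
    (h : ∀ n l, M.lamBar ≤ l → w n l = w' n l) (n : ℕ) : M.T0 δ w n lam = M.T0 δ w' n lam :=
  le_antisymm (T0_mono hlam (fun n l hl => (h n l hl).le) n)
    (T0_mono hlam (fun n l hl => (h n l hl).ge) n)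

theorem actionValue_le_T (w : ℕ → ℝ → ℝ≥0∞) {a : CatAction} {n : ℕ} (h : a = .pay → 0 < n) :
    M.actionValue δ w a n lam ≤ M.T δ w n lam := by
  cases a with
  | pause => exact T0_le_T _ _
  | pay => exact T1_le_T _ (h rfl).ne'
  | finish => exact TF_le_T _ _

theorem TF_pred_add (hδ : 0 ≤ δ) {n : ℕ} (hn : n ≠ 0) :
    M.TF δ (n - 1) + ENNReal.ofReal (δ * M.p) = M.TF δ n := by
  unfold TF
  rw [← ENNReal.ofReal_add (grid_nonneg hδ _) (mul_nonneg hδ M.p_pos.le), mul_comm δ,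
    grid_pred_add hn]

/-- Closing at once is no better than paying `p δ` first and continuing with at least the closing
value. This removes `E_F` from the optimal partition. -/
theorem TF_le_T1 (hδ : 0 ≤ δ) {w : ℕ → ℝ → ℝ≥0∞} {n : ℕ} (hn : n ≠ 0)
    (h : M.TF δ (n - 1) ≤ w (n - 1) lam) : M.TF δ n ≤ M.T1 δ w n lam := by
  rw [← TF_pred_add hδ hn]
  exact add_le_add_left h _

theorem TF_zero : M.TF δ 0 = 0 := by simp [TF, grid]

/-- Clamping the intensity at `lamBar` extends the operator to a Borel function on all of `ℝ`
without changing it on the relevant half line; `valueIter` is clamped for the same reason. -/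
theorem measurable_T0 (hδ : 0 < δ) {w : ℕ → ℝ → ℝ≥0∞} (hw : ∀ n, Measurable (w n)) :
    Measurable fun z : ℕ × ℝ => M.T0 δ w z.1 (max M.lamBar z.2) := by
  simp only [T0_eq_lintegral_pauseValue hδ (le_max_left _ _) hw]
  exact Measurable.lintegral_prod_right' (f := fun y : (ℕ × ℝ) × ((ℝ × ℝ) × (ℝ × ℝ)) =>
    M.pauseValue δ w y.1.1 (max M.lamBar y.1.2) y.2) (measurable_pauseValue δ hw
    (measurable_fst.comp measurable_fst)
    (measurable_const.max (measurable_snd.comp measurable_fst)) (fun _ => le_max_left _ _)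
    measurable_snd)

theorem measurable_T1 {w : ℕ → ℝ → ℝ≥0∞} (hw : ∀ n, Measurable (w n)) :
    Measurable fun z : ℕ × ℝ => M.T1 δ w z.1 (max M.lamBar z.2) :=
  measurable_from_prod_countable_right fun n =>
    Measurable.add_const (f := fun l => w (n - 1) (max M.lamBar l))
      ((hw _).comp (measurable_const.max measurable_id)) _

theorem measurable_T (hδ : 0 < δ) {w : ℕ → ℝ → ℝ≥0∞} (hw : ∀ n, Measurable (w n)) (n : ℕ) :
    Measurable fun l => M.T δ w n (max M.lamBar l) := by
  have h0 := (measurable_T0 (M := M) hδ hw).comp (measurable_prodMk_left (x := n))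
  have h1 := (measurable_T1 (M := M) (δ := δ) hw).comp (measurable_prodMk_left (x := n))
  unfold T
  split_ifs
  · exact h0.max measurable_const
  · exact (h0.max h1).max measurable_const

/-! ### Value iteration -/

/-- The iterates of the operator `T`, started at the value of closing the company. -/
noncomputable def valueIter (M : CatModel) (δ : ℝ) : ℕ → ℕ → ℝ → ℝ≥0∞
  | 0 => fun n _ => M.TF δ n
  | l + 1 => fun n lam => M.T δ (valueIter M δ l) n (max M.lamBar lam)

theorem valueIter_succ (hlam : M.lamBar ≤ lam) (l n : ℕ) :
    M.valueIter δ (l + 1) n lam = M.T δ (M.valueIter δ l) n lam := by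
  simp only [valueIter, max_eq_right hlam]

theorem measurable_valueIter (hδ : 0 < δ) (l n : ℕ) : Measurable (M.valueIter δ l n) := by
  induction l generalizing n with
  | zero => exact measurable_const
  | succ l ih => exact measurable_T hδ ih n

theorem monotone_valueIter : Monotone (M.valueIter δ) := by
  refine monotone_nat_of_le_succ fun l => ?_
  induction l with
  | zero => exact fun n lam => TF_le_T _ _
  | succ l ih => exact fun n lam => T_mono (le_max_left _ _) (fun n l _ => ih n l) n

theorem TF_le_valueIter (l n : ℕ) (lam : ℝ) : M.TF δ n ≤ M.valueIter δ l n lam :=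
  monotone_valueIter (Nat.zero_le l) n lam

/-- The limit of the value iteration. -/
noncomputable def valueLim (M : CatModel) (δ : ℝ) (n : ℕ) (lam : ℝ) : ℝ≥0∞ :=
  ⨆ l, M.valueIter δ l n lam

theorem measurable_valueLim (hδ : 0 < δ) (n : ℕ) : Measurable (M.valueLim δ n) :=
  Measurable.iSup fun l => measurable_valueIter hδ l n

theorem valueIter_le_valueLim (l n : ℕ) (lam : ℝ) : M.valueIter δ l n lam ≤ M.valueLim δ n lam :=
  le_iSup (fun l => M.valueIter δ l n lam) l

theorem pauseValue_mono {w w' : ℕ → ℝ → ℝ≥0∞} (h : w ≤ w') (n : ℕ)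
    (ξ : (ℝ × ℝ) × (ℝ × ℝ)) : M.pauseValue δ w n lam ξ ≤ M.pauseValue δ w' n lam ξ := by
  unfold pauseValue
  split_ifs
  · exact le_rfl
  all_goals first
    | exact mul_le_mul_right (add_le_add_right (h _ _) _) _
    | exact mul_le_mul_right (h _ _) _

theorem pauseValue_valueLim (n : ℕ) (ξ : (ℝ × ℝ) × (ℝ × ℝ)) :
    M.pauseValue δ (M.valueLim δ) n lam ξ = ⨆ l, M.pauseValue δ (M.valueIter δ l) n lam ξ := by
  unfold pauseValue valueLim
  split_ifs
  · simp
  all_goals simp only [ENNReal.mul_iSup, ENNReal.add_iSup]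

/-- Monotone convergence, once `T0` is written as one integral of `pauseValue`. -/
theorem T0_valueLim (hδ : 0 < δ) (hlam : M.lamBar ≤ lam) (n : ℕ) :
    M.T0 δ (M.valueLim δ) n lam = ⨆ l, M.T0 δ (M.valueIter δ l) n lam := by
  simp only [T0_eq_lintegral_pauseValue hδ hlam (measurable_valueLim hδ),
    T0_eq_lintegral_pauseValue hδ hlam (measurable_valueIter hδ _), pauseValue_valueLim]
  refine lintegral_iSup (fun l => ?_) fun i j hij ξ => pauseValue_mono (monotone_valueIter hij) n ξ
  exact measurable_pauseValue δ (measurable_valueIter hδ l) measurable_const measurable_const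
    (fun _ => hlam) measurable_id

theorem T_valueLim (hδ : 0 < δ) (hlam : M.lamBar ≤ lam) (n : ℕ) :
    M.T δ (M.valueLim δ) n lam = M.valueLim δ n lam := by
  have hstep : ∀ l, M.T δ (M.valueIter δ l) n lam ≤ M.valueLim δ n lam := fun l => by
    rw [← valueIter_succ hlam]; exact valueIter_le_valueLim _ _ _
  refine le_antisymm (T_le ?_ (fun hn => ?_) (valueIter_le_valueLim 0 n lam)) (iSup_le fun l => ?_)
  · rw [T0_valueLim hδ hlam]
    exact iSup_le fun l => (T0_le_T _ _).trans (hstep l)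
  · unfold T1
    rw [valueLim, ENNReal.iSup_add]
    exact iSup_le fun l => (T1_le_T (M.valueIter δ l) hn).trans (hstep l)
  · refine (monotone_valueIter l.le_succ n lam).trans ?_
    rw [valueIter_succ hlam]
    exact T_mono hlam (fun n l' _ => valueIter_le_valueLim l n l') n

/-- `T W ≤ W` contains `T_F ≤ W`, and applying the monotone `T` repeatedly preserves the bound for
the iterates. It is used both for minimality and, with `growthBound`, for linear growth. -/
theorem valueLim_le {W : ℕ → ℝ → ℝ≥0∞}
    (hW : ∀ n lam, M.lamBar ≤ lam → M.T δ W n lam ≤ W n lam) (n : ℕ) (hlam : M.lamBar ≤ lam) :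
    M.valueLim δ n lam ≤ W n lam := by
  refine iSup_le fun l => ?_
  induction l generalizing n lam with
  | zero => exact (TF_le_T _ _).trans (hW n lam hlam)
  | succ l ih =>
    rw [valueIter_succ hlam]
    exact (T_mono hlam (fun n _ hl => ih n hl) n).trans (hW n lam hlam)

theorem T_growthBound_le (hδ : 0 < δ) (n : ℕ) (hlam : M.lamBar ≤ lam) :
    M.T δ (M.growthBound δ) n lam ≤ M.growthBound δ n lam := by
  have hK : 0 ≤ M.p / M.q := div_nonneg M.p_pos.le M.q_pos.le
  refine T_le ?_ (fun hn => ?_) ?_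
  · rw [T0_eq_lintegral_pauseValue hδ hlam (w := M.growthBound δ) fun n => measurable_const]
    refine (lintegral_mono_ae (g := fun _ => M.growthBound δ n lam) ?_).trans (by simp)
    filter_upwards [M.ae_mark_pos.1, M.ae_mark_pos.2.2.2] with ξ h1 h2
    exact pauseValue_growthBound_le hδ n h1 h2
  · unfold T1 growthBound
    rw [← ENNReal.ofReal_add (add_nonneg hK (grid_nonneg hδ.le _))
      (mul_nonneg hδ.le M.p_pos.le), mul_comm δ, add_assoc, grid_pred_add hn]
  · exact ENNReal.ofReal_le_ofReal (by linarith)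

theorem valueLim_le_growthBound (hδ : 0 < δ) (n : ℕ) (hlam : M.lamBar ≤ lam) :
    M.valueLim δ n lam ≤ M.growthBound δ n lam :=
  valueLim_le (fun n _ hl => T_growthBound_le hδ n hl) n hlam

end CatModel

namespace CatModel

variable {M : CatModel} {lam δ : ℝ} {ω : CatOmega}

/-! ### Values of strategies -/

theorem value_eq_tsum (hδ : 0 < δ) (hlam : M.lamBar ≤ lam) {π : CatRule}
    (hπ : ∀ k, Measurable (π k)) (n : ℕ) :
    M.value δ π n lam = ∑' k, ∫⁻ ω, M.discPayment δ lam π n k ω ∂M.prob := by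
  rw [← lintegral_tsum fun k => aemeasurable_discPayment hδ hlam hπ n k]
  refine lintegral_congr fun ω => ?_
  unfold dividends
  rw [lintegral_sum_measure]
  refine tsum_congr fun k => ?_
  rw [lintegral_smul_measure, lintegral_dirac' _ (by exact M.measurable_disc)]
  exact mul_comm _ _

theorem lintegral_stateValue_zero (w : ℕ → ℝ → ℝ≥0∞) (π : CatRule) (n : ℕ) :
    ∫⁻ ω, M.stateValue lam ω w (M.state δ lam π n ω 0) ∂M.prob = w n lam := by
  have := M.isProbabilityMeasure_prob
  calc _ = ∫⁻ _, w n lam ∂M.prob := by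
        refine lintegral_congr_ae ?_
        filter_upwards [M.ae_isRegular] with ω hω
        simp [state, stateValue, hω.intensity_zero]
    _ = _ := by simp

theorem lintegral_discPayment_add_le (hδ : 0 < δ) (hlam : M.lamBar ≤ lam) {π : CatRule}
    (hπ : ∀ k, Measurable (π k)) (n k : ℕ) {w w' : ℕ → ℝ → ℝ≥0∞} (hw : ∀ n, Measurable (w n))
    (h : ∀ᵐ ω ∂M.prob, ∀ t m, M.state δ lam π n ω k = some (t, m) →
      M.actionValue δ w (M.chosen lam π ω k t m) m (M.intensity lam t ω) ≤
        w' m (M.intensity lam t ω)) :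
    ∫⁻ ω, M.discPayment δ lam π n k ω ∂M.prob
        + ∫⁻ ω, M.stateValue lam ω w (M.state δ lam π n ω (k + 1)) ∂M.prob
      ≤ ∫⁻ ω, M.stateValue lam ω w' (M.state δ lam π n ω k) ∂M.prob := by
  rw [lintegral_discPayment_add hδ hlam hπ n k hw]
  refine lintegral_mono_ae ?_
  filter_upwards [h] with ω hω
  rw [chosenValue, stateValue_eq_elim]
  rcases hst : M.state δ lam π n ω k with _ | ⟨t, m⟩
  · simp
  · exact mul_le_mul_right (hω t m hst) _

theorem lintegral_discPayment_add_eq (hδ : 0 < δ) (hlam : M.lamBar ≤ lam) {π : CatRule}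
    (hπ : ∀ k, Measurable (π k)) (n k : ℕ) {w w' : ℕ → ℝ → ℝ≥0∞} (hw : ∀ n, Measurable (w n))
    (h : ∀ᵐ ω ∂M.prob, ∀ t m, M.state δ lam π n ω k = some (t, m) →
      M.actionValue δ w (M.chosen lam π ω k t m) m (M.intensity lam t ω) =
        w' m (M.intensity lam t ω)) :
    ∫⁻ ω, M.discPayment δ lam π n k ω ∂M.prob
        + ∫⁻ ω, M.stateValue lam ω w (M.state δ lam π n ω (k + 1)) ∂M.prob
      = ∫⁻ ω, M.stateValue lam ω w' (M.state δ lam π n ω k) ∂M.prob := by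
  rw [lintegral_discPayment_add hδ hlam hπ n k hw]
  refine lintegral_congr_ae ?_
  filter_upwards [h] with ω hω
  rw [chosenValue, stateValue_eq_elim]
  rcases hst : M.state δ lam π n ω k with _ | ⟨t, m⟩
  · simp
  · simp only [Option.elim_some]
    rw [hω t m hst]

/-- Telescoping of the one-step inequality: undoing the last action costs one application of `T`,
which moves the terminal value from `l` to `l + 1`. -/
theorem sum_lintegral_discPayment_add_le (hδ : 0 < δ) (hlam : M.lamBar ≤ lam) {π : CatRule}
    {n : ℕ} (hπ : M.IsGridStrategy δ π n lam) (K l : ℕ) :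
    ∑ k ∈ Finset.range K, ∫⁻ ω, M.discPayment δ lam π n k ω ∂M.prob
        + ∫⁻ ω, M.stateValue lam ω (M.valueIter δ l) (M.state δ lam π n ω K) ∂M.prob
      ≤ M.valueIter δ (l + K) n lam := by
  induction K generalizing l with
  | zero => simp [lintegral_stateValue_zero]
  | succ K ih =>
    rw [Finset.sum_range_succ, add_assoc, ← add_assoc l, add_right_comm l]
    refine le_trans (add_le_add_right ?_ _) (ih (l + 1))
    refine lintegral_discPayment_add_le hδ hlam hπ.1 n K (measurable_valueIter hδ l) ?_
    filter_upwards [M.ae_isRegular, hπ.2] with ω hω h t m hs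
    rw [valueIter_succ (hω.lamBar_le_intensity hlam t)]
    exact actionValue_le_T _ (h K t m hs)

theorem value_le_valueLim (hδ : 0 < δ) (hlam : M.lamBar ≤ lam) {π : CatRule} {n : ℕ}
    (hπ : M.IsGridStrategy δ π n lam) : M.value δ π n lam ≤ M.valueLim δ n lam := by
  rw [value_eq_tsum hδ hlam hπ.1, ENNReal.tsum_eq_iSup_nat]
  refine iSup_le fun K => le_trans ?_ (valueIter_le_valueLim (0 + K) n lam)
  exact le_self_add.trans (sum_lintegral_discPayment_add_le hδ hlam hπ K 0)

/-- The action of index `L` is `E_F`, whose payment is the value `valueIter δ 0` of the state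
reached; after it no state exists and no dividends are paid. -/
theorem value_of_hasLength (hδ : 0 < δ) (hlam : M.lamBar ≤ lam) {π : CatRule}
    (hπ : ∀ k, Measurable (π k)) {n L : ℕ} (hL : M.HasLength δ π n lam (L + 1)) :
    M.value δ π n lam = ∑ k ∈ Finset.range L, ∫⁻ ω, M.discPayment δ lam π n k ω ∂M.prob
      + ∫⁻ ω, M.stateValue lam ω (M.valueIter δ 0) (M.state δ lam π n ω L) ∂M.prob := by
  have hlast : ∀ᵐ ω ∂M.prob, M.discPayment δ lam π n L ω =
      M.stateValue lam ω (M.valueIter δ 0) (M.state δ lam π n ω L) := by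
    filter_upwards [hL] with ω h
    unfold discPayment payment
    rcases hst : M.state δ lam π n ω L with _ | ⟨t, m⟩
    · simp [stateValue]
    · simp [(h L t m hst).2 rfl, step, stateValue, valueIter, TF]
  have hnone : ∀ᵐ ω ∂M.prob, ∀ j, M.state δ lam π n ω (L + 1 + j) = none := by
    filter_upwards [hL] with ω h j
    induction j with
    | zero =>
      rw [add_zero, state]
      rcases hst : M.state δ lam π n ω L with _ | ⟨t, m⟩
      · rfl
      · simp [(h L t m hst).2 rfl, step]
    | succ j ih => rw [← add_assoc, state, ih]
  have hzero : ∀ k ∉ Finset.range (L + 1), ∫⁻ ω, M.discPayment δ lam π n k ω ∂M.prob = 0 := by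
    intro k hk
    obtain ⟨j, rfl⟩ := Nat.exists_eq_add_of_le (not_lt.1 fun h => hk (Finset.mem_range.2 h))
    refine (lintegral_congr_ae ?_).trans lintegral_zero
    filter_upwards [hnone] with ω h
    simp [discPayment, payment, h j]
  rw [value_eq_tsum hδ hlam hπ, tsum_eq_sum hzero, Finset.sum_range_succ,
    lintegral_congr_ae hlast]

/-! ### Optimal strategies with finitely many control actions -/

open Classical in
/-- The better one of `E₁` and `E₀`. -/
noncomputable def greedyAction (M : CatModel) (δ : ℝ) (w : ℕ → ℝ → ℝ≥0∞) (z : ℕ × ℝ) : CatAction :=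
  if z.1 ≠ 0 ∧ M.T0 δ w z.1 (max M.lamBar z.2) ≤ M.T1 δ w z.1 (max M.lamBar z.2) then .pay
  else .pause

theorem measurable_greedyAction (hδ : 0 < δ) {w : ℕ → ℝ → ℝ≥0∞} (hw : ∀ n, Measurable (w n)) :
    Measurable (M.greedyAction δ w) := by
  refine Measurable.ite (MeasurableSet.inter ?_ ?_) measurable_const measurable_const
  · exact measurable_fst (measurableSet_singleton 0).compl
  · exact measurableSet_le (measurable_T0 hδ hw) (measurable_T1 hw)

/-- If `w` dominates the closing value, the maximum in `T` is attained by `E₁` or `E₀`: by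
`TF_le_T1` for `n ≠ 0`, and because closing pays `0` for `n = 0`. -/
theorem actionValue_greedyAction (hδ : 0 ≤ δ) (hlam : M.lamBar ≤ lam) {w : ℕ → ℝ → ℝ≥0∞}
    (hw : ∀ n, M.TF δ n ≤ w n lam) (n : ℕ) :
    M.actionValue δ w (M.greedyAction δ w (n, lam)) n lam = M.T δ w n lam := by
  unfold greedyAction
  simp only [max_eq_right hlam]
  split_ifs with h
  · refine le_antisymm (T1_le_T w h.1) (T_le h.2 (fun _ => le_rfl) (TF_le_T1 hδ h.1 (hw _)))
  · refine le_antisymm (T0_le_T w n) ?_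
    by_cases hn : n = 0
    · subst hn
      exact T_le le_rfl (fun h => absurd rfl h) (by rw [TF_zero]; exact zero_le)
    · have h1 : M.T1 δ w n lam ≤ M.T0 δ w n lam := (not_le.1 fun h' => h ⟨hn, h'⟩).le
      exact T_le le_rfl (fun _ => h1) ((TF_le_T1 hδ hn (hw _)).trans h1)

/-- The optimal strategy among those with `L + 1` control actions. -/
noncomputable def greedyRule (M : CatModel) (δ : ℝ) (L : ℕ) : CatRule := fun k info =>
  -- After action `k < L` there are `L - 1 - k` further actions before the closing one, so this
  -- iterate is the continuation value.
  if k = L then .finish else M.greedyAction δ (M.valueIter δ (L - 1 - k)) info.2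

theorem isGridStrategy_greedyRule (hδ : 0 < δ) (L n : ℕ) (lam : ℝ) :
    M.IsGridStrategy δ (M.greedyRule δ L) n lam := by
  refine ⟨fun k => ?_, Eventually.of_forall fun ω k t m _ h => ?_⟩
  · unfold greedyRule
    split_ifs
    · exact measurable_const
    · exact (measurable_greedyAction hδ (measurable_valueIter hδ _)).comp measurable_snd
  · unfold chosen greedyRule greedyAction at h
    split_ifs at h with h1 h2
    exact Nat.pos_of_ne_zero h2.1

theorem hasLength_greedyRule (L n : ℕ) (lam : ℝ) :
    M.HasLength δ (M.greedyRule δ L) n lam (L + 1) := by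
  refine Eventually.of_forall fun ω k t m _ => ?_
  unfold chosen greedyRule greedyAction
  split_ifs with h1 h2 <;> simp [h1]

theorem value_greedyRule (hδ : 0 < δ) (hlam : M.lamBar ≤ lam) (L n : ℕ) :
    M.value δ (M.greedyRule δ L) n lam = M.valueIter δ L n lam := by
  have hπ := (isGridStrategy_greedyRule (M := M) hδ L n lam).1
  rw [value_of_hasLength hδ hlam hπ (hasLength_greedyRule L n lam)]
  have key : ∀ K, K ≤ L → ∑ k ∈ Finset.range K,
      ∫⁻ ω, M.discPayment δ lam (M.greedyRule δ L) n k ω ∂M.prob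
        + ∫⁻ ω, M.stateValue lam ω (M.valueIter δ (L - K))
            (M.state δ lam (M.greedyRule δ L) n ω K) ∂M.prob = M.valueIter δ L n lam := by
    intro K hK
    induction K with
    | zero => simp [lintegral_stateValue_zero]
    | succ K ih =>
      rw [← ih (by omega), Finset.sum_range_succ, add_assoc]
      congr 1
      refine lintegral_discPayment_add_eq hδ hlam hπ n K (measurable_valueIter hδ _) ?_
      filter_upwards [M.ae_isRegular] with ω hω t m _
      have hl := hω.lamBar_le_intensity hlam t
      obtain ⟨j, hj⟩ : ∃ j, L = K + 1 + j := Nat.exists_eq_add_of_le hK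
      have h1 : L - K = L - (K + 1) + 1 := by omega
      have h2 : L - 1 - K = L - (K + 1) := by omega
      rw [h1, valueIter_succ hl, chosen, greedyRule, if_neg (by omega), h2]
      exact actionValue_greedyAction hδ.le hl (fun n => TF_le_valueIter _ n _) m
  have := key L le_rfl
  rwa [Nat.sub_self] at this

/-- The shift by one arises because the closing action is counted in the horizon but is already
contained in the starting point of the iteration. -/
theorem horizonValue_succ (hδ : 0 < δ) (hlam : M.lamBar ≤ lam) (L n : ℕ) :
    M.horizonValue δ (L + 1) n lam = M.valueIter δ L n lam := by
  refine le_antisymm (iSup₂_le fun π hπ => ?_) ?_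
  · rw [value_of_hasLength hδ hlam hπ.1.1 hπ.2]
    simpa using sum_lintegral_discPayment_add_le hδ hlam hπ.1 L 0
  · rw [← value_greedyRule hδ hlam]
    exact le_iSup₂_of_le (M.greedyRule δ L)
      ⟨isGridStrategy_greedyRule hδ L n lam, hasLength_greedyRule L n lam⟩ le_rfl

theorem gridValue_eq (hδ : 0 < δ) (hlam : M.lamBar ≤ lam) (n : ℕ) :
    M.gridValue δ n lam = M.valueLim δ n lam := by
  refine le_antisymm (iSup₂_le fun π hπ => value_le_valueLim hδ hlam hπ) (iSup_le fun L => ?_)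
  rw [← value_greedyRule hδ hlam]
  exact le_iSup₂_of_le (M.greedyRule δ L) (isGridStrategy_greedyRule hδ L n lam) le_rfl

theorem tendsto_horizonValue (hδ : 0 < δ) (hlam : M.lamBar ≤ lam) (n : ℕ) :
    Tendsto (fun l => M.horizonValue δ l n lam) atTop (𝓝 (M.gridValue δ n lam)) := by
  rw [← tendsto_add_atTop_iff_nat 1, gridValue_eq hδ hlam]
  simp only [horizonValue_succ hδ hlam]
  exact tendsto_atTop_iSup fun i j hij => monotone_valueIter hij n lam

/-! ### The optimal stationary strategy -/

/-- Dominated convergence: the discounted bound along the path never exceeds its initial value, and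
tends to `0` as the decision times tend to infinity. -/
theorem tendsto_lintegral_stateValue (hδ : 0 < δ) (hlam : M.lamBar ≤ lam) {π : CatRule} {n : ℕ}
    (hπ : M.IsGridStrategy δ π n lam) {w : ℕ → ℝ → ℝ≥0∞} (hw : ∀ n, Measurable (w n))
    (hb : ∀ n lam, M.lamBar ≤ lam → w n lam ≤ M.growthBound δ n lam) :
    Tendsto (fun k => ∫⁻ ω, M.stateValue lam ω w (M.state δ lam π n ω k) ∂M.prob) atTop
      (𝓝 0) := by
  have := M.isProbabilityMeasure_prob
  have hq := M.q_pos
  have hp := M.p_pos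
  have hG := grid_nonneg (M := M) hδ.le n
  have hbound : ∀ ω, IsRegular ω → ∀ k t m, M.state δ lam π n ω k = some (t, m) →
      M.disc t * w m (M.intensity lam t ω) ≤ M.disc t * ENNReal.ofReal (M.p / M.q + M.grid δ m) :=
    fun ω hω k t m _ => mul_le_mul_right (hb _ _ (hω.lamBar_le_intensity hlam t)) _
  rw [← lintegral_zero (μ := M.prob)]
  refine tendsto_lintegral_of_dominated_convergence' (fun _ => M.growthBound δ n lam)
    (fun k => aemeasurable_stateValue hδ hlam hπ.1 n k hw) (fun k => ?_) ?_ ?_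
  · filter_upwards [M.ae_isRegular] with ω hω
    rcases hst : M.state δ lam π n ω k with _ | ⟨t, m⟩
    · exact zero_le
    · exact (hbound ω hω k t m hst).trans
        (M.disc_mul_le hG (hω.state_nonneg hδ hlam hst) (hω.grid_state_le hδ hlam hst))
  · simp [growthBound]
  · filter_upwards [M.ae_isRegular, hπ.2] with ω hω hpay
    -- Half of the discounting absorbs the premium income, by `exp_mul_add_le` with rate `q / 2` and
    -- `K = p / (q / 2)`; the other half forces the limit `0`.
    set K := 2 * (M.p / M.q) with hK
    have hK0 : 0 ≤ M.p / M.q := div_nonneg hp.le hq.le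
    have hf : Tendsto (fun t => ENNReal.ofReal (Real.exp (-(M.q / 2 * t)) * (K + M.grid δ n)))
        atTop (𝓝 0) := by
      rw [← ENNReal.ofReal_zero, ← zero_mul (K + M.grid δ n)]
      refine ENNReal.tendsto_ofReal (Tendsto.mul_const _ ?_)
      exact Real.tendsto_exp_neg_atTop_nhds_zero.comp
        (tendsto_id.const_mul_atTop (half_pos hq))
    rw [ENNReal.tendsto_nhds_zero] at hf ⊢
    intro ε hε
    obtain ⟨b, hb'⟩ := eventually_atTop.1 (hf ε hε)
    filter_upwards [hω.eventually_lt_time hδ hlam hpay b] with k hk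
    rcases hst : M.state δ lam π n ω k with _ | ⟨t, m⟩
    · exact zero_le
    · refine (hbound ω hω k t m hst).trans (le_trans ?_ (hb' t (hk t m hst).le))
      have ht := hω.state_nonneg hδ hlam hst
      have hg := hω.grid_state_le hδ hlam hst
      have h1 := exp_mul_add_le (half_pos hq).le (by positivity : 0 ≤ K) hG ht
      have h2 : K * (M.q / 2) * t = M.p * t := by rw [hK]; field_simp
      have h3 : -(M.q * t) = -(M.q / 2 * t) + -(M.q / 2 * t) := by ring
      rw [h2] at h1
      rw [disc, ← ENNReal.ofReal_mul (Real.exp_nonneg _), h3, Real.exp_add, mul_assoc]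
      refine ENNReal.ofReal_le_ofReal (mul_le_mul_of_nonneg_left (le_trans ?_ h1)
        (Real.exp_nonneg _))
      exact mul_le_mul_of_nonneg_left (by linarith) (Real.exp_nonneg _)

/-- Verification: if every chosen action attains the fixed point equation, then the payments of `K`
actions plus the remaining value equal `valueLim` for every `K`, and the remainder vanishes. -/
theorem value_eq_valueLim (hδ : 0 < δ) (hlam : M.lamBar ≤ lam) {π : CatRule} {n : ℕ}
    (hπ : M.IsGridStrategy δ π n lam)
    (h : ∀ k, ∀ᵐ ω ∂M.prob, ∀ t m, M.state δ lam π n ω k = some (t, m) →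
      M.actionValue δ (M.valueLim δ) (M.chosen lam π ω k t m) m (M.intensity lam t ω) =
        M.valueLim δ m (M.intensity lam t ω)) :
    M.value δ π n lam = M.valueLim δ n lam := by
  have key : ∀ K, ∑ k ∈ Finset.range K, ∫⁻ ω, M.discPayment δ lam π n k ω ∂M.prob
      + ∫⁻ ω, M.stateValue lam ω (M.valueLim δ) (M.state δ lam π n ω K) ∂M.prob
        = M.valueLim δ n lam := by
    intro K
    induction K with
    | zero => simp [lintegral_stateValue_zero]
    | succ K ih =>
      rw [← ih, Finset.sum_range_succ, add_assoc,
        lintegral_discPayment_add_eq hδ hlam hπ.1 n K (measurable_valueLim hδ) (h K)]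
  have h1 := (ENNReal.tendsto_nat_tsum fun k =>
    ∫⁻ ω, M.discPayment δ lam π n k ω ∂M.prob).add (tendsto_lintegral_stateValue hδ hlam hπ
      (measurable_valueLim hδ) fun n _ hl => valueLim_le_growthBound hδ n hl)
  simp only [key, add_zero] at h1
  rw [value_eq_tsum hδ hlam hπ.1]
  exact tendsto_nhds_unique h1 tendsto_const_nhds

theorem mem_optA (hδ : 0 < δ) {z : ℕ × ℝ} : z ∈ M.optA δ ↔ M.lamBar ≤ z.2 ∧ z.1 ≠ 0 ∧
    M.T1 δ (M.valueLim δ) z.1 z.2 = M.valueLim δ z.1 z.2 := by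
  unfold optA
  rw [mem_ofPred_eq]
  refine and_congr_right fun hl => ?_
  rw [T1, T1, gridValue_eq hδ hl, gridValue_eq hδ hl]

theorem mem_optNA (hδ : 0 < δ) {z : ℕ × ℝ} : z ∈ M.optNA δ ↔ M.lamBar ≤ z.2 ∧ z ∉ M.optA δ ∧
    M.T0 δ (M.valueLim δ) z.1 z.2 = M.valueLim δ z.1 z.2 := by
  unfold optNA
  rw [mem_ofPred_eq]
  refine and_congr_right fun hl => ?_
  rw [T0_congr hl (fun n l h => gridValue_eq hδ h n), gridValue_eq hδ hl]

/-- The greedy action for `valueLim` attains `T`, hence `valueLim` itself, and it is always `E₁` or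
`E₀`. -/
theorem mem_optA_or_mem_optNA (hδ : 0 < δ) {z : ℕ × ℝ} (hz : M.lamBar ≤ z.2) :
    z ∈ M.optA δ ∨ z ∈ M.optNA δ := by
  by_cases hA : z ∈ M.optA δ
  · exact Or.inl hA
  refine Or.inr ((mem_optNA hδ).2 ⟨hz, hA, ?_⟩)
  have hA' := fun h0 h1 => hA ((mem_optA hδ).2 ⟨hz, h0, h1⟩)
  have hT := T_valueLim (M := M) hδ hz z.1
  have h := actionValue_greedyAction hδ.le hz
    (fun n => valueIter_le_valueLim (M := M) (δ := δ) 0 n z.2) z.1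
  rw [hT, greedyAction] at h
  split_ifs at h with h'
  · exact absurd h (hA' h'.1)
  · exact h

theorem optB_eq_empty (hδ : 0 < δ) : M.optB δ = ∅ :=
  eq_empty_of_forall_notMem fun _ hz => hz.2.1 (mem_optA_or_mem_optNA hδ hz.1)

theorem measurableSet_optA (hδ : 0 < δ) : MeasurableSet (M.optA δ) := by
  have hV : Measurable fun z : ℕ × ℝ => M.valueLim δ z.1 z.2 :=
    measurable_from_prod_countable_right (measurable_valueLim hδ)
  have : M.optA δ = {z : ℕ × ℝ | M.lamBar ≤ z.2} ∩ ({z : ℕ × ℝ | z.1 ≠ 0} ∩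
      {z | M.T1 δ (M.valueLim δ) z.1 (max M.lamBar z.2) = M.valueLim δ z.1 z.2}) := by
    ext z
    rw [mem_optA hδ]
    exact and_congr_right fun hl => by simp [max_eq_right hl]
  rw [this]
  exact (measurableSet_le measurable_const measurable_snd).inter
    ((measurable_fst (measurableSet_singleton 0).compl).inter
    (measurableSet_eq_fun (measurable_T1 (measurable_valueLim hδ)) hV))

theorem optNA_eq (hδ : 0 < δ) : M.optNA δ = {z : ℕ × ℝ | M.lamBar ≤ z.2} \ M.optA δ := by
  ext z
  refine ⟨fun h => ⟨h.1, h.2.1⟩, fun h => ?_⟩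
  exact (mem_optA_or_mem_optNA hδ h.1).resolve_left h.2

theorem isPartition_optPartition (hδ : 0 < δ) : M.IsPartition (M.optPartition δ) where
  measurable_A := measurableSet_optA hδ
  measurable_NA := by
    change MeasurableSet (M.optNA δ)
    rw [optNA_eq hδ]
    exact (measurableSet_le measurable_const measurable_snd).diff (measurableSet_optA hδ)
  measurable_B := by
    change MeasurableSet (M.optB δ)
    rw [optB_eq_empty hδ]
    exact MeasurableSet.empty
  disjoint_A_NA := disjoint_left.2 fun _ h h' => h'.2.1 h
  disjoint_A_B := disjoint_left.2 fun _ h h' => h'.2.1 (Or.inl h)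
  disjoint_NA_B := disjoint_left.2 fun _ h h' => h'.2.1 (Or.inr h)
  union := by
    change M.optA δ ∪ M.optNA δ ∪ M.optB δ = _
    rw [optB_eq_empty hδ, union_empty]
    ext z
    exact ⟨fun h => h.elim (fun h => h.1) fun h => h.1, mem_optA_or_mem_optNA hδ⟩
  zero_notMem := fun _ h => h.2.1 rfl

theorem isGridStrategy_optPartition (hδ : 0 < δ) (n : ℕ) (lam : ℝ) :
    M.IsGridStrategy δ (M.optPartition δ).rule n lam := by
  have hP := isPartition_optPartition (M := M) hδ
  refine ⟨fun k => ?_, Eventually.of_forall fun ω k t m _ h => ?_⟩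
  · refine Measurable.comp (g := (M.optPartition δ).action) ?_ measurable_snd
    exact Measurable.ite hP.measurable_A measurable_const
      (Measurable.ite hP.measurable_NA measurable_const measurable_const)
  · unfold chosen CatPartition.rule CatPartition.action at h
    split_ifs at h with h1
    exact Nat.pos_of_ne_zero h1.2.1

theorem value_optPartition (hδ : 0 < δ) (hlam : M.lamBar ≤ lam) (n : ℕ) :
    M.value δ (M.optPartition δ).rule n lam = M.gridValue δ n lam := by
  rw [gridValue_eq hδ hlam]
  refine value_eq_valueLim hδ hlam (isGridStrategy_optPartition hδ n lam) fun k => ?_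
  filter_upwards [M.ae_isRegular] with ω hω t m _
  have hl := hω.lamBar_le_intensity hlam t
  unfold chosen CatPartition.rule CatPartition.action
  split_ifs with h1 h2
  · exact ((mem_optA hδ).1 h1).2.2
  · exact ((mem_optNA hδ).1 h2).2.2
  · exact absurd (mem_optA_or_mem_optNA hδ hl) (not_or.2 ⟨h1, h2⟩)

end CatModel

/-! ### The proposition -/

theorem mainTheorem9 (M : CatModel) (δ : ℝ) (hδ : 0 < δ) :
    -- the finite-horizon values increase to the grid-optimal value
    (∀ n lam, M.lamBar ≤ lam →
      (∀ l, 1 ≤ l → M.horizonValue δ l n lam ≤ M.horizonValue δ (l + 1) n lam) ∧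
      Tendsto (fun l => M.horizonValue δ l n lam) atTop (𝓝 (M.gridValue δ n lam))) ∧
    -- the grid-optimal value is finite, Borel measurable, and solves the discrete HJB equation
    (∀ n, Measurable fun lam : Ici M.lamBar => M.gridValue δ n lam) ∧
    (∃ K : ℝ, ∀ n lam, M.lamBar ≤ lam →
      M.gridValue δ n lam ≤ ENNReal.ofReal (K + M.grid δ n)) ∧
    (∀ n lam, M.lamBar ≤ lam → M.T δ (M.gridValue δ) n lam = M.gridValue δ n lam) ∧
    -- it is the smallest supersolution with linear growth
    (M.IsSupersolution δ (M.gridValue δ) ∧ M.HasLinearGrowth δ (M.gridValue δ) ∧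
      ∀ W : ℕ → ℝ → ℝ≥0∞, M.IsSupersolution δ W → M.HasLinearGrowth δ W →
        ∀ n lam, M.lamBar ≤ lam → M.gridValue δ n lam ≤ W n lam) ∧
    -- it is attained by the stationary strategy of the optimal partition
    (M.IsPartition (M.optPartition δ) ∧ (M.optPartition δ).B = ∅ ∧
      ∀ n lam, M.lamBar ≤ lam →
        M.IsGridStrategy δ (M.optPartition δ).rule n lam ∧
        M.value δ (M.optPartition δ).rule n lam = M.gridValue δ n lam) := by
  have hV : ∀ n lam, M.lamBar ≤ lam → M.gridValue δ n lam = M.valueLim δ n lam :=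
    fun n _ hl => CatModel.gridValue_eq hδ hl n
  have hbound : ∀ n lam, M.lamBar ≤ lam →
      M.gridValue δ n lam ≤ ENNReal.ofReal (M.p / M.q + M.grid δ n) := fun n lam hl => by
    rw [hV n lam hl]
    exact CatModel.valueLim_le_growthBound hδ n hl
  have hT : ∀ n lam, M.lamBar ≤ lam → M.T δ (M.gridValue δ) n lam = M.gridValue δ n lam :=
    fun n lam hl => by
      rw [CatModel.T_congr hl hV, CatModel.T_valueLim hδ hl, hV n lam hl]
  refine ⟨fun n lam hl => ⟨fun l h1 => ?_, CatModel.tendsto_horizonValue hδ hl n⟩, fun n => ?_,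
    ⟨M.p / M.q, hbound⟩, hT,
    ⟨⟨fun n => ⟨?_, fun lam hl => ((hbound n lam hl).trans_lt ENNReal.ofReal_lt_top).ne⟩,
      fun n lam hl => (hT n lam hl).le⟩, ⟨M.p / M.q, fun n _ lam hl => hbound n lam hl.le⟩,
      fun W hW _ n lam hl => ?_⟩,
    CatModel.isPartition_optPartition hδ, CatModel.optB_eq_empty hδ, fun n lam hl =>
      ⟨CatModel.isGridStrategy_optPartition hδ n lam, CatModel.value_optPartition hδ hl n⟩⟩
  · obtain ⟨L, rfl⟩ := Nat.exists_eq_add_of_le' h1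
    rw [CatModel.horizonValue_succ hδ hl, CatModel.horizonValue_succ hδ hl]
    exact CatModel.monotone_valueIter L.le_succ n lam
  · have : (fun lam : Ici M.lamBar => M.gridValue δ n lam) =
        fun lam : Ici M.lamBar => M.valueLim δ n lam := funext fun lam => hV n lam lam.2
    rw [this]
    exact (CatModel.measurable_valueLim hδ n).comp measurable_subtype_coe
  -- `gridValue` has been identified with the Borel function `valueLim` on `[lamBar, ∞)`, which
  -- suffices for the restricted measure.
  · refine (CatModel.measurable_valueLim (M := M) hδ n).aemeasurable.congr ?_
    exact (ae_restrict_mem measurableSet_Ici).mono fun lam hl => (hV n lam hl).symm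
  · rw [hV n lam hl]
    exact CatModel.valueLim_le hW.2 n hl
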